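/- Let $s,t,k,b$ be integers with $s,t\ge 2$ and $k\ge b\ge 1$. Let $S^s_{b,k}$ be the $s$-legged spider with length vector $(b,k,\ldots,k)$, that is, the tree formed by $s$ paths (legs), one of length $b$ and $s-1$ of length $k$ (lengths counted in edges), that share one common end and are vertex-disjoint otherwise. Let $t*S^s_{b,k}$ be the union of $t$ labeled copies of $S^s_{b,k}$ which agree on the set of the $s$ leaves but are pairwise vertex-disjoint outside it. For a graph $H$, let $\mathrm{ex}(n,H)$ be the largest number of edges in an $n$-vertex graph that does not contain $H$ as a (not necessarily induced) subgraph. Then, as $n\to\infty$, $$\mathrm{ex}(n,\,t*S^s_{b,k}) = O\!\left(n^{1+\frac{s-1}{(s-1)k+b}}\right),$$ where the implied constant may depend on $s,t,k,b$. -/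

import Mathlib

namespace SimpleGraph

/-- The embedding of `V` onto the `i`-th of `t` labelled copies of `V` that agree on `R` and are
pairwise disjoint outside `R`: a root `v ∈ R` is sent to the shared vertex `inl v`, and a vertex
`v ∉ R` is sent to its `i`-th private copy `inr (v, i)`. -/
noncomputable def blowupCopy {V : Type*} (R : Set V) (t : ℕ) (i : Fin t) :
    V ↪ ↥R ⊕ (↥Rᶜ × Fin t) :=
  open scoped Classical in
  { toFun := fun v => if h : v ∈ R then Sum.inl ⟨v, h⟩ else Sum.inr (⟨v, h⟩, i)
    inj' := by
      intro u v huv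
      by_cases hu : u ∈ R <;> by_cases hv : v ∈ R <;> simp_all }

/-- The `t`-blowup `t * T_R`: the union of `t` labelled copies of `T` which agree on the root set
`R` but are pairwise vertex-disjoint outside `R`. -/
noncomputable def blowup {V : Type*} (T : SimpleGraph V) (R : Set V) (t : ℕ) :
    SimpleGraph (↥R ⊕ (↥Rᶜ × Fin t)) :=
  ⨆ i : Fin t, T.map (blowupCopy R t i)

/-- The vertices of the spider with length vector `ℓ`: `none` is the center, and `some ⟨i, m⟩` is
the vertex at distance `m + 1` from the center on the `i`-th leg, where `0 ≤ m < ℓ i`. -/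
abbrev SpiderVertex {s : ℕ} (ℓ : Fin s → ℕ) : Type :=
  Option (Σ i : Fin s, Fin (ℓ i))

/-- The successor relation of the spider, directed away from the center. -/
def SpiderStep {s : ℕ} (ℓ : Fin s → ℕ) : SpiderVertex ℓ → SpiderVertex ℓ → Prop
  | none, some ⟨_, m⟩ => (m : ℕ) = 0
  | some ⟨i, m⟩, some ⟨j, m'⟩ => i = j ∧ (m' : ℕ) = (m : ℕ) + 1
  | _, none => False

/-- The `s`-legged spider with length vector `ℓ`: `s` paths, the `i`-th of length `ℓ i`, that share
one common end (the center) and are vertex-disjoint outside it. -/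
def spider {s : ℕ} (ℓ : Fin s → ℕ) : SimpleGraph (SpiderVertex ℓ) :=
  SimpleGraph.fromRel (SpiderStep ℓ)

/-- The leaves of the spider: the ends, other than the center, of its legs. -/
def spiderLeaves {s : ℕ} (ℓ : Fin s → ℕ) : Set (SpiderVertex ℓ) :=
  {v | ∃ (i : Fin s) (m : Fin (ℓ i)), (m : ℕ) + 1 = ℓ i ∧ v = some ⟨i, m⟩}

/-- The length vector `(b, k, …, k)` with `s` entries. -/
def legLengths (s b k : ℕ) : Fin s → ℕ := fun i => if (i : ℕ) = 0 then b else k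

/-- The graph `t * S^s_{b,k}`: the `t`-blowup of the `s`-legged spider with length vector
`(b, k, …, k)`, rooted at the set of its leaves. -/
noncomputable abbrev spiderBlowup (t s b k : ℕ) :
    SimpleGraph (↥(spiderLeaves (legLengths s b k)) ⊕
      (↥(spiderLeaves (legLengths s b k))ᶜ × Fin t)) :=
  blowup (spider (legLengths s b k)) (spiderLeaves (legLengths s b k)) t

end SimpleGraph

/-! After regularization (`exists_almost_regular`) it suffices to treat a graph on n vertices with
all degrees between δ and a constant multiple of δ. Let M = (s-1)k + b be the number of edges of the
spider. The spider has at least of order nδ^M embeddings, while there are only n^s tuples of leaves.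
So if δ^M is a large multiple of n^(s-1), an average tuple carries many spiders; this threshold is
the exponent of the theorem. Many spiders on one tuple need not be disjoint, however. What is wanted
is a robust tuple, one whose spiders can avoid every bounded set of vertices: from it, t disjoint
spiders are picked greedily (`blowup_isContained`).

Suppose that there is no robust tuple. Restrict the embeddings to a piece of the spider: a subpath
of a leg, a path of length two through the centre, or a subspider. A restriction is heavy if too
many others agree with it on its ends. The pieces are treated by increasing size. Once smaller
pieces have light fibres, few copies of a piece with given ends pass through a given inner vertex,
so a heavy copy can be rerouted around any bounded set. If the heavy copies were a positive
proportion of the nΔ^m possible ones (Δ the degree bound, m the number of edges of the piece), they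
would produce a robust tuple. Hence they are sparse, and the embeddings containing them are
discarded at small cost (`exists_light_subfamily`, `Attainable.and_fiberLe`). Finally the whole
spider has light fibres over its leaves, which gives nδ^M = O(n^s).

The substance is that dense heavy pieces yield robust spiders of the full size. The family is first
cleaned so that the last vertex of a piece can also be changed while the rest stays fixed. A
connection then grows by one edge: connect to another neighbour of the last-but-one vertex and step
back to that vertex. Repeating this, connections of every larger length appear, and the parity of
the excess decides where they end (`pathAvoid_of_flexible`, `spiderAvoid_of_flexible`). For
subspiders this fails only when two legs of length one have odd excess, since both would end at the
centre; there the light paths of length two bound the fibre directly (`fiberLe_of_cross`). For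
paths, a broom (`exists_broom`) supplies many vertices flexibly connected to the same ends, and
`spiderAvoid_of_dense_paths` builds the spider around it. -/

namespace SpiderTuran

open Finset SimpleGraph

/-! ### Large fibres, common subsets and counts of tree homomorphisms -/

section Counting

open scoped Classical

/-- Every finite set contains a subset in which each fibre of each of finitely many maps is large;
the size of the loss is controlled by the sizes of the images. -/
lemma exists_large_fibers {α R : Type*} [Fintype R] {β : R → Type*} (D : Finset α)
    (π : ∀ r, α → β r) (θ : R → ℕ) :
    ∃ F ⊆ D, (∀ r, ∀ a ∈ F, θ r ≤ #{x ∈ F | π r x = π r a}) ∧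
      #D ≤ #F + ∑ r, θ r * #(D.image (π r)) := by
  -- At a maximizer, discarding a whole fibre of `π r` loses its size and gains at least `θ r`, so
  -- no fibre present is smaller than `θ r`. Comparison with `D` gives the size bound. The values
  -- are integers because they may be negative.
  let Φ : Finset α → ℤ := fun F => (#F : ℤ) - ∑ r, (θ r : ℤ) * #(F.image (π r))
  obtain ⟨F, hF, hmax⟩ := exists_max_image D.powerset Φ ⟨D, mem_powerset_self D⟩
  rw [mem_powerset] at hF
  refine ⟨F, hF, fun r a ha => ?_, ?_⟩
  · have h1 := hmax {x ∈ F | ¬ π r x = π r a}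
      (mem_powerset.2 ((filter_subset _ _).trans hF))
    have h2 : #{x ∈ F | π r x = π r a} + #{x ∈ F | ¬ π r x = π r a} = #F :=
      card_filter_add_card_filter_not _
    have h3 : ∀ r', #(({x ∈ F | ¬ π r x = π r a}).image (π r')) + (if r' = r then 1 else 0)
        ≤ #(F.image (π r')) := by
      intro r'
      split_ifs with h
      · subst h
        have : insert (π r' a) (({x ∈ F | ¬ π r' x = π r' a}).image (π r')) ⊆ F.image (π r') := by
          intro y hy
          rw [mem_insert] at hy
          rcases hy with rfl | hy
          · exact mem_image_of_mem _ ha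
          · exact image_subset_image (filter_subset _ _) hy
        have h4 := card_le_card this
        rwa [card_insert_of_notMem] at h4
        intro h
        obtain ⟨x, hx, hx'⟩ := mem_image.1 h
        exact (mem_filter.1 hx).2 hx'
      · exact card_le_card (image_subset_image (filter_subset _ _))
    have h5 : ∑ r', (θ r' : ℤ) * #(({x ∈ F | ¬ π r x = π r a}).image (π r')) + θ r
        ≤ ∑ r', (θ r' : ℤ) * #(F.image (π r')) := by
      have : (θ r : ℤ) = ∑ r', (θ r' : ℤ) * ((if r' = r then 1 else 0 : ℕ) : ℤ) := by
        rw [sum_eq_single r (fun r' _ h => by rw [if_neg h, Nat.cast_zero, mul_zero])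
          (fun h => absurd (mem_univ r) h), if_pos rfl, Nat.cast_one, mul_one]
      rw [this, ← sum_add_distrib]
      refine sum_le_sum fun r' _ => ?_
      rw [← mul_add]
      refine mul_le_mul_of_nonneg_left ?_ (Int.natCast_nonneg _)
      rw [← Nat.cast_add]
      exact Int.ofNat_le.2 (h3 r')
    simp only [Φ] at h1
    omega
  · have h1 := hmax D (mem_powerset_self D)
    simp only [Φ] at h1
    have h2 : 0 ≤ ∑ r, (θ r : ℤ) * #(F.image (π r)) :=
      sum_nonneg fun r _ => mul_nonneg (Int.natCast_nonneg _) (Int.natCast_nonneg _)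
    have h3 : (#D : ℤ) ≤ #F + ∑ r, (θ r : ℤ) * #(D.image (π r)) := by linarith
    exact_mod_cast h3

/-- If every set of a family is a positive proportion of `S`, then some `q`-subset of `S` lies in
a positive proportion of the family. -/
lemma exists_common_subset {ρ σ : Type*} (c q : ℕ) (R : Finset ρ) (S : Finset σ)
    (X : ρ → Finset σ) (hS : 0 < #S)
    (hX : ∀ r ∈ R, X r ⊆ S) (hc : ∀ r ∈ R, #S ≤ c * (#(X r) - q)) (hR : R.Nonempty) :
    ∃ Q ⊆ S, #Q = q ∧ #R ≤ c ^ q * #{r ∈ R | Q ⊆ X r} := by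
  -- The elements are chosen one at a time. The slack `- q` in `hc` leaves each surviving `X r` a
  -- proportion `1 / c` of `S` outside the elements already chosen, so averaging finds an element
  -- kept by `1 / c` of the survivors.
  suffices h : ∀ q' ≤ q, ∃ Q ⊆ S, #Q = q' ∧ #R ≤ c ^ q' * #{r ∈ R | Q ⊆ X r} from h q le_rfl
  intro q' hq'
  induction q' with
  | zero => exact ⟨∅, by simp, by simp, by simp⟩
  | succ m ih =>
    obtain ⟨Q, hQS, hQ, hQc⟩ := ih (by omega)
    set R' : Finset ρ := {r ∈ R | Q ⊆ X r} with hR'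
    have hsum : ∑ x ∈ S \ Q, #{r ∈ R' | x ∈ X r} = ∑ r ∈ R', #{x ∈ S \ Q | x ∈ X r} := by
      simp only [card_filter]
      exact sum_comm
    have hlow : ∀ r ∈ R', #S ≤ c * #{x ∈ S \ Q | x ∈ X r} := by
      intro r hr
      rw [hR', mem_filter] at hr
      refine (hc r hr.1).trans (Nat.mul_le_mul_left _ ?_)
      have : X r \ Q ⊆ {x ∈ S \ Q | x ∈ X r} := by
        intro x hx
        rw [mem_sdiff] at hx
        simp [hx.1, hx.2, hX r hr.1 hx.1]
      have h2 := le_card_sdiff Q (X r)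
      have h3 := card_le_card this
      omega
    have hR'pos : 0 < #R' := by
      rcases Nat.eq_zero_or_pos (#R') with h | h
      · rw [h, mul_zero] at hQc
        have := hR.card_pos
        omega
      · exact h
    have hex : ∃ x ∈ S \ Q, #R' ≤ c * #{r ∈ R' | x ∈ X r} := by
      by_contra! hcon
      have h1 : #R' * #S ≤ c * ∑ x ∈ S \ Q, #{r ∈ R' | x ∈ X r} := by
        rw [hsum, mul_sum, ← smul_eq_mul, ← sum_const]
        exact sum_le_sum hlow
      have hne : (S \ Q).Nonempty := by
        obtain ⟨r, hr⟩ := card_pos.1 hR'pos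
        have h2 := hlow r hr
        rcases (S \ Q).eq_empty_or_nonempty with h | h
        · rw [h] at h2
          simp at h2
          simp [h2] at hS
        · exact h
      have h2 : c * ∑ x ∈ S \ Q, #{r ∈ R' | x ∈ X r} < ∑ x ∈ S \ Q, #R' := by
        rw [mul_sum]
        exact sum_lt_sum_of_nonempty hne hcon
      rw [sum_const, smul_eq_mul] at h2
      have h3 : #(S \ Q) ≤ #S := card_le_card sdiff_subset
      have := Nat.mul_le_mul_right (#R') h3
      nlinarith
    obtain ⟨x, hx, hxc⟩ := hex
    rw [mem_sdiff] at hx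
    refine ⟨insert x Q, insert_subset hx.1 hQS, by rw [card_insert_of_notMem hx.2, hQ], ?_⟩
    have heq : {r ∈ R' | x ∈ X r} = {r ∈ R | insert x Q ⊆ X r} := by
      ext r
      simp only [hR', mem_filter, insert_subset_iff]
      tauto
    rw [← heq, pow_succ, mul_assoc]
    exact hQc.trans (Nat.mul_le_mul_left _ hxc)

variable {V : Type*} [Fintype V]

/-- The homomorphisms from a connected graph to a graph of maximum degree at most `Δ` with
prescribed values on a nonempty set. -/
lemma card_hom_extending_le {ι : Type*} [Fintype ι] (T : SimpleGraph ι) (hT : T.Preconnected)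
    (G : SimpleGraph V) (Δ : ℕ) (hΔ : ∀ v, #{w | G.Adj v w} ≤ Δ)
    (I : Finset ι) (hI : I.Nonempty) (φ : ι → V) :
    #{a : ι → V | (∀ u v, T.Adj u v → G.Adj (a u) (a v)) ∧ ∀ v ∈ I, a v = φ v}
      ≤ Δ ^ (Fintype.card ι - #I) := by
  generalize hd : Fintype.card ι - #I = d
  induction d generalizing I φ with
  | zero =>
    have hIu : I = univ := by
      rw [← card_eq_iff_eq_univ]
      have := card_le_univ I
      omega
    rw [pow_zero, card_le_one]
    intro a ha b hb
    simp only [mem_filter, hIu, mem_univ, true_and, forall_const] at ha hb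
    funext v
    rw [ha.2, hb.2]
  | succ d ih =>
    have hIu : ∃ v, v ∉ I := by
      by_contra! h
      have : I = univ := by ext; simp [h]
      rw [this, card_univ] at hd
      omega
    obtain ⟨v0, hv0⟩ := hIu
    obtain ⟨u0, hu0⟩ := hI
    -- A walk leaving `I` crosses its boundary, which gives a free vertex with a prescribed
    -- neighbour: at most `Δ` choices for its image.
    obtain ⟨w⟩ := hT u0 v0
    obtain ⟨e, -, he1, he2⟩ := w.exists_boundary_dart (I : Set ι) (by simpa using hu0)
      (by simpa using hv0)
    simp only [mem_coe] at he1 he2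
    set u := e.fst
    set v := e.snd
    have hadj : T.Adj u v := e.adj
    have hsub : ({a : ι → V | (∀ u v, T.Adj u v → G.Adj (a u) (a v)) ∧ ∀ v ∈ I, a v = φ v} :
          Finset (ι → V)) ⊆
        ({w | G.Adj (φ u) w} : Finset V).biUnion fun x =>
          {a : ι → V | (∀ u v, T.Adj u v → G.Adj (a u) (a v)) ∧
            ∀ y ∈ insert v I, a y = Function.update φ v x y} := by
      intro a ha
      simp only [mem_filter, mem_univ, true_and] at ha
      simp only [mem_biUnion, mem_filter, mem_univ, true_and]
      refine ⟨a v, ?_, ha.1, ?_⟩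
      · rw [← ha.2 u he1]
        exact ha.1 _ _ hadj
      · intro y hy
        rcases eq_or_ne y v with rfl | hyv
        · simp
        · rw [Function.update_of_ne hyv]
          exact ha.2 y ((mem_insert.1 hy).resolve_left hyv)
    refine (card_le_card hsub).trans (card_biUnion_le.trans ?_)
    refine (sum_le_card_nsmul _ _ (Δ ^ d) ?_).trans ?_
    · intro x _
      refine ih (insert v I) (insert_nonempty _ _) _ ?_
      rw [card_insert_of_notMem he2]
      omega
    · rw [smul_eq_mul, pow_succ, mul_comm]
      exact Nat.mul_le_mul_left _ (hΔ _)

/-- The number of homomorphisms from a connected graph to a graph of bounded degree. -/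
lemma card_hom_le {ι : Type*} [Fintype ι] [Nonempty ι] (T : SimpleGraph ι) (hT : T.Preconnected)
    (G : SimpleGraph V) (Δ : ℕ) (hΔ : ∀ v, #{w | G.Adj v w} ≤ Δ) :
    #{a : ι → V | ∀ u v, T.Adj u v → G.Adj (a u) (a v)}
      ≤ Fintype.card V * Δ ^ (Fintype.card ι - 1) := by
  obtain ⟨r⟩ := ‹Nonempty ι›
  have hsub : ({a : ι → V | ∀ u v, T.Adj u v → G.Adj (a u) (a v)} : Finset (ι → V)) ⊆
      (univ : Finset V).biUnion fun x =>
        {a : ι → V | (∀ u v, T.Adj u v → G.Adj (a u) (a v)) ∧ ∀ y ∈ ({r} : Finset ι), a y = x} := by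
    intro a ha
    simpa using ha
  refine (card_le_card hsub).trans (card_biUnion_le.trans ?_)
  refine (sum_le_card_nsmul _ _ (Δ ^ (Fintype.card ι - 1)) ?_).trans (by simp)
  intro x _
  exact card_hom_extending_le T hT G Δ hΔ {r} (singleton_nonempty r) fun _ => x

lemma card_le_of_hom_extending {ι : Type*} [Fintype ι] (T : SimpleGraph ι) (hT : T.Preconnected)
    (G : SimpleGraph V) (Δ : ℕ) (hΔ : ∀ v, #{w | G.Adj v w} ≤ Δ)
    (I : Finset ι) (hI : I.Nonempty) (φ : ι → V) (F : Finset (ι → V))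
    (hF : ∀ a ∈ F, ∀ u v, T.Adj u v → G.Adj (a u) (a v)) (hφ : ∀ a ∈ F, ∀ v ∈ I, a v = φ v) :
    #F ≤ Δ ^ (Fintype.card ι - #I) := by
  refine (card_le_card fun a ha => ?_).trans (card_hom_extending_le T hT G Δ hΔ I hI φ)
  exact mem_filter.2 ⟨mem_univ _, hF a ha, hφ a ha⟩

lemma card_le_of_hom {ι : Type*} [Fintype ι] [Nonempty ι] (T : SimpleGraph ι)
    (hT : T.Preconnected) (G : SimpleGraph V) (Δ : ℕ) (hΔ : ∀ v, #{w | G.Adj v w} ≤ Δ)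
    (F : Finset (ι → V)) (hF : ∀ a ∈ F, ∀ u v, T.Adj u v → G.Adj (a u) (a v)) :
    #F ≤ Fintype.card V * Δ ^ (Fintype.card ι - 1) := by
  refine (card_le_card fun a ha => ?_).trans (card_hom_le T hT G Δ hΔ)
  exact mem_filter.2 ⟨mem_univ _, hF a ha⟩

end Counting

/-! ### Robust paths and spiders, and the embedding of the blowup -/

section Connections

open scoped Classical

variable {V : Type*} {G : SimpleGraph V}

/-- `p 0, …, p l` is a path of `G`. -/
def IsPath (G : SimpleGraph V) (l : ℕ) (p : ℕ → V) : Prop :=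
  (∀ m < l, G.Adj (p m) (p (m + 1))) ∧ ∀ m ≤ l, ∀ m' ≤ l, p m = p m' → m = m'

/-- There is a path of length `l` from `x` to `y` whose inner vertices avoid `W`. -/
def PathAvoid (G : SimpleGraph V) (l : ℕ) (x y : V) (W : Finset V) : Prop :=
  ∃ p : ℕ → V, IsPath G l p ∧ p 0 = x ∧ p l = y ∧ ∀ m, 0 < m → m < l → p m ∉ W

/-- There is a spider with length vector `ℓ` and leaves `z` whose other vertices avoid `W`. -/
def SpiderAvoid {s : ℕ} (G : SimpleGraph V) (ℓ : Fin s → ℕ) (z : Fin s → V) (W : Finset V) :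
    Prop :=
  ∃ (c : V) (p : Fin s → ℕ → V), (∀ i, IsPath G (ℓ i) (p i)) ∧ (∀ i, p i 0 = c) ∧
    (∀ i, p i (ℓ i) = z i) ∧
    (∀ i j m m', i ≠ j → 0 < m → 0 < m' → m ≤ ℓ i → m' ≤ ℓ j → p i m ≠ p j m') ∧
    ∀ i m, m < ℓ i → p i m ∉ W

lemma IsPath.reverse {l : ℕ} {p : ℕ → V} (h : IsPath G l p) :
    IsPath G l fun m => p (l - m) := by
  refine ⟨fun m hm => ?_, fun m hm m' hm' he => ?_⟩
  · have := h.1 (l - (m + 1)) (by omega)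
    rw [show l - (m + 1) + 1 = l - m by omega] at this
    exact this.symm
  · have := h.2 (l - m) (by omega) (l - m') (by omega) he
    omega

lemma PathAvoid.symm {l : ℕ} {x y : V} {W : Finset V} (h : PathAvoid G l x y W) :
    PathAvoid G l y x W := by
  obtain ⟨p, hp, h0, hl, hW⟩ := h
  exact ⟨_, hp.reverse, by simpa using hl, by simpa using h0,
    fun m h1 h2 => hW _ (by omega) (by omega)⟩

/-- Extending a path beyond its end. -/
lemma PathAvoid.append {l : ℕ} {x y c : V} {W : Finset V} (h : PathAvoid G l x y (insert c W))
    (hl : 0 < l) (hyc : G.Adj y c) (hxc : x ≠ c) (hy : y ∉ W) : PathAvoid G (l + 1) x c W := by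
  obtain ⟨p, hp, h0, hpl, hW⟩ := h
  have hne : ∀ m ≤ l, p m ≠ c := by
    intro m hm
    rcases Nat.eq_zero_or_pos m with rfl | hm0
    · rwa [h0]
    · rcases hm.lt_or_eq with h | rfl
      · intro h'
        exact hW m hm0 h (by simp [h'])
      · rw [hpl]
        exact hyc.ne
  refine ⟨fun m => if m ≤ l then p m else c, ⟨fun m hm => ?_, fun m hm m' hm' he => ?_⟩, ?_, ?_,
    fun m h1 h2 => ?_⟩
  · rcases (Nat.lt_succ_iff.1 hm).lt_or_eq with h | rfl
    · simpa [h.le, Nat.succ_le_of_lt h] using hp.1 m h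
    · simpa [hpl] using hyc
  · by_cases h1 : m ≤ l <;> by_cases h2 : m' ≤ l
    · simp only [h1, h2, if_true] at he
      exact hp.2 m h1 m' h2 he
    · simp only [h1, h2, if_true, if_false] at he
      exact absurd he (hne m h1)
    · simp only [h1, h2, if_true, if_false] at he
      exact absurd he.symm (hne m' h2)
    · omega
  · simpa using h0
  · simp
  · rcases (Nat.lt_succ_iff.1 h2).lt_or_eq with h | rfl
    · simp only [h.le, if_true]
      exact fun h' => hW m h1 h (mem_insert_of_mem h')
    · simpa [hpl] using hy

/-- Extending one leg of a spider beyond its leaf. -/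
lemma SpiderAvoid.append {s : ℕ} {ℓ : Fin s → ℕ} {z : Fin s → V} {W : Finset V} {y : V}
    (i : Fin s) (h : SpiderAvoid G ℓ z (insert y W)) (hy : G.Adj (z i) y) (hz : z i ∉ W)
    (hyz : ∀ j, y ≠ z j) :
    SpiderAvoid G (Function.update ℓ i (ℓ i + 1)) (Function.update z i y) W := by
  obtain ⟨c, p, hp, h0, hl, hd, hW⟩ := h
  have hne : ∀ j, ∀ m ≤ ℓ j, p j m ≠ y := by
    intro j m hm
    rcases hm.lt_or_eq with h | rfl
    · intro h'
      exact hW j m h (by simp [h'])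
    · rw [hl]
      exact (hyz j).symm
  let q : Fin s → ℕ → V := fun j m => if m ≤ ℓ j then p j m else y
  have hq : ∀ j m, m ≤ ℓ j → q j m = p j m := fun j m hm => by simp [q, hm]
  have hq' : ∀ j m, ℓ j < m → q j m = y := fun j m hm => by simp [q, not_le.2 hm]
  have hlen : ∀ j m, m ≤ Function.update ℓ i (ℓ i + 1) j → m ≤ ℓ j ∨ (j = i ∧ m = ℓ i + 1) := by
    intro j m hm
    rcases eq_or_ne j i with rfl | hj
    · rw [Function.update_self] at hm
      omega
    · rw [Function.update_of_ne hj] at hm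
      exact Or.inl hm
  refine ⟨c, q, fun j => ⟨fun m hm => ?_, fun m hm m' hm' he => ?_⟩, fun j => ?_, fun j => ?_,
    fun j j' m m' hj h1 h2 h3 h4 => ?_, fun j m hm => ?_⟩
  · rcases hlen j (m + 1) hm with h | ⟨rfl, h⟩
    · rw [hq j m (by omega), hq j _ h]
      exact (hp j).1 m (by omega)
    · rw [hq j m (by omega), hq' j _ (by omega), show m = ℓ j by omega, hl]
      exact hy
  · rcases hlen j m hm with h | ⟨rfl, h⟩ <;> rcases hlen j m' hm' with h' | ⟨h2, h'⟩
    · rw [hq j m h, hq j m' h'] at he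
      exact (hp j).2 m h m' h' he
    · subst h2
      rw [hq j m h, hq' j m' (by omega)] at he
      exact absurd he (hne j m h)
    · rw [hq j m' h', hq' j m (by omega)] at he
      exact absurd he.symm (hne j m' h')
    · omega
  · rw [hq j 0 (Nat.zero_le _), h0]
  · rcases eq_or_ne j i with rfl | hj
    · rw [Function.update_self, Function.update_self, hq' j _ (by omega)]
    · rw [Function.update_of_ne hj, Function.update_of_ne hj, hq j _ le_rfl, hl]
  · rcases hlen j m h3 with h | ⟨rfl, h⟩ <;> rcases hlen j' m' h4 with h' | ⟨h5, h'⟩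
    · rw [hq j m h, hq j' m' h']
      exact hd j j' m m' hj h1 h2 h h'
    · subst h5
      rw [hq j m h, hq' j' m' (by omega)]
      exact hne j m h
    · rw [hq j' m' h', hq' j m (by omega)]
      exact (hne j' m' h').symm
    · exact absurd h5.symm hj
  · have hm' : m < ℓ j ∨ (j = i ∧ m = ℓ i) := by
      rcases eq_or_ne j i with rfl | hj
      · rw [Function.update_self] at hm
        omega
      · rw [Function.update_of_ne hj] at hm
        exact Or.inl hm
    rcases hm' with h | ⟨rfl, rfl⟩
    · rw [hq j m h.le]
      exact fun h' => hW j m h (mem_insert_of_mem h')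
    · rw [hq j _ le_rfl, hl]
      exact hz

/-- A spider can be assembled from one given leg and flexible connections for the other legs. -/
lemma spiderAvoid_of_legs {s : ℕ} (L : Fin s → ℕ) (z : Fin s → V)
    (hz : Function.Injective z) (W : Finset V) (c : V) (hcW : c ∉ W)
    (i₀ : Fin s) (hi₀ : PathAvoid G (L i₀) c (z i₀) (W ∪ univ.image z)) (B : ℕ)
    (hB : #W + s + 1 + ∑ i, (L i + 1) ≤ B)
    (hflex : ∀ i, i ≠ i₀ → ∀ W' : Finset V, #W' ≤ B → PathAvoid G (L i) c (z i) W') :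
    SpiderAvoid G L z W := by
  -- The leg `i₀`, which has no flexibility, is laid first. Each further leg then avoids `W`, all
  -- leaves and the legs already laid, which is what `B` pays for.
  suffices h : ∀ I : Finset (Fin s), i₀ ∉ I → ∃ p : Fin s → ℕ → V,
      ∀ i ∈ insert i₀ I, IsPath G (L i) (p i) ∧ p i 0 = c ∧ p i (L i) = z i ∧
        (∀ m, 0 < m → m < L i → p i m ∉ W ∪ univ.image z) ∧
        ∀ j ∈ insert i₀ I, i ≠ j → ∀ m m', 0 < m → 0 < m' → m ≤ L i → m' ≤ L j →
          p i m ≠ p j m' by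
    obtain ⟨p, hp⟩ := h (univ.erase i₀) (notMem_erase _ _)
    have hall : ∀ i, i ∈ insert i₀ (univ.erase i₀) := fun i => by
      rw [insert_erase (mem_univ _)]
      exact mem_univ i
    refine ⟨c, p, fun i => (hp i (hall i)).1, fun i => (hp i (hall i)).2.1,
      fun i => (hp i (hall i)).2.2.1,
      fun i j m m' hij h1 h2 h3 h4 => (hp i (hall i)).2.2.2.2 j (hall j) hij m m' h1 h2 h3 h4,
      fun i m hm => ?_⟩
    rcases Nat.eq_zero_or_pos m with rfl | hm0
    · rwa [(hp i (hall i)).2.1]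
    · exact fun h => (hp i (hall i)).2.2.2.1 m hm0 hm (mem_union_left _ h)
  intro I
  induction I using Finset.induction_on with
  | empty =>
    intro _
    obtain ⟨q, hq, h0, hl, hW⟩ := hi₀
    refine ⟨fun _ => q, fun i hi => ?_⟩
    obtain rfl : i = i₀ := by simpa using hi
    exact ⟨hq, h0, hl, hW, fun j hj hij => absurd (by simpa using hj) hij.symm⟩
  | insert a I ha ih =>
    intro hI
    rw [mem_insert, not_or] at hI
    obtain ⟨p, hp⟩ := ih hI.2
    set U : Finset V := (insert i₀ I).biUnion fun j => (range (L j + 1)).image (p j) with hU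
    have hUc : #U ≤ ∑ i, (L i + 1) := by
      refine card_biUnion_le.trans ((sum_le_sum fun j _ => ?_).trans
        (sum_le_sum_of_subset (subset_univ _)))
      exact card_image_le.trans (by simp)
    obtain ⟨q, hq, hq0, hql, hqW⟩ := hflex a (Ne.symm hI.1) ((W ∪ univ.image z) ∪ U) (by
      have h1 := card_union_le (W ∪ univ.image z) U
      have h2 := card_union_le W (univ.image z)
      have h3 : #(univ.image z) ≤ s := card_image_le.trans (by simp)
      omega)
    have hmemU : ∀ j ∈ insert i₀ I, ∀ m ≤ L j, p j m ∈ U := fun j hj m hm =>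
      mem_biUnion.2 ⟨j, hj, mem_image_of_mem _ (mem_range.2 (by omega))⟩
    have hcross : ∀ j ∈ insert i₀ I, ∀ m m', 0 < m → 0 < m' → m ≤ L j → m' ≤ L a →
        p j m ≠ q m' := by
      intro j hj m m' h1 h2 h3 h4 he
      rcases h4.lt_or_eq with h | rfl
      · exact hqW m' h2 h (mem_union_right _ (he ▸ hmemU j hj m h3))
      · rw [hql] at he
        rcases h3.lt_or_eq with h | rfl
        · refine (hp j hj).2.2.2.1 m h1 h (mem_union_right _ ?_)
          rw [he]
          exact mem_image_of_mem _ (mem_univ _)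
        · rw [(hp j hj).2.2.1] at he
          have := hz he
          subst this
          rcases mem_insert.1 hj with rfl | h
          · exact hI.1 rfl
          · exact ha h
    have hane : ∀ j ∈ insert i₀ I, j ≠ a := by
      intro j hj h
      subst h
      rcases mem_insert.1 hj with rfl | h
      · exact hI.1 rfl
      · exact ha h
    have hsplit : ∀ j ∈ insert i₀ (insert a I), j = a ∨ j ∈ insert i₀ I := by
      intro j hj
      simp only [mem_insert] at hj ⊢
      tauto
    refine ⟨Function.update p a q, fun i hi => ?_⟩
    rcases hsplit i hi with h | hi'
    · subst h
      simp only [Function.update_self]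
      refine ⟨hq, hq0, hql, fun m h1 h2 h3 => hqW m h1 h2 (mem_union_left _ h3), ?_⟩
      intro j hj hij m m' h1 h2 h3 h4
      rw [Function.update_of_ne hij.symm]
      exact (hcross j ((hsplit j hj).resolve_left hij.symm) m' m h2 h1 h4 h3).symm
    · rw [Function.update_of_ne (hane i hi')]
      obtain ⟨h1, h2, h3, h4, h5⟩ := hp i hi'
      refine ⟨h1, h2, h3, h4, ?_⟩
      intro j hj hij m m' h6 h7 h8 h9
      rcases hsplit j hj with h | hj
      · subst h
        rw [Function.update_self]
        exact hcross i hi' m m' h6 h7 h8 h9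
      · rw [Function.update_of_ne (hane j hj)]
        exact h5 j hj hij m m' h6 h7 h8 h9

/-- The vertex of a spider at distance `m` from the center on the `i`-th leg. -/
def spiderPos {s : ℕ} (ℓ : Fin s → ℕ) (i : Fin s) (m : ℕ) : SpiderVertex ℓ :=
  -- Positions past the end of the leg fall back to the centre, hence the bounds on `m` in the
  -- lemmas below.
  if h : m - 1 < ℓ i ∧ m ≠ 0 then some ⟨i, ⟨m - 1, h.1⟩⟩ else none

lemma spiderPos_zero {s : ℕ} (ℓ : Fin s → ℕ) (i : Fin s) : spiderPos ℓ i 0 = none := by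
  simp [spiderPos]

lemma spiderPos_succ {s : ℕ} (ℓ : Fin s → ℕ) (i : Fin s) (m : ℕ) (h : m < ℓ i) :
    spiderPos ℓ i (m + 1) = some ⟨i, ⟨m, h⟩⟩ := by
  simp [spiderPos, h]

lemma spiderPos_cases {s : ℕ} {ℓ : Fin s → ℕ} (v : SpiderVertex ℓ) :
    v = none ∨ ∃ i m, m < ℓ i ∧ v = spiderPos ℓ i (m + 1) := by
  rcases v with _ | ⟨i, m, hm⟩
  · exact Or.inl rfl
  · exact Or.inr ⟨i, m, hm, (spiderPos_succ ℓ i m hm).symm⟩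

lemma spider_adj_iff {s : ℕ} {ℓ : Fin s → ℕ} {u v : SpiderVertex ℓ} :
    (spider ℓ).Adj u v ↔ ∃ i m, m < ℓ i ∧
      ((u = spiderPos ℓ i m ∧ v = spiderPos ℓ i (m + 1)) ∨
        (v = spiderPos ℓ i m ∧ u = spiderPos ℓ i (m + 1))) := by
  have key : ∀ u v : SpiderVertex ℓ, SpiderStep ℓ u v ↔
      ∃ i m, m < ℓ i ∧ u = spiderPos ℓ i m ∧ v = spiderPos ℓ i (m + 1) := by
    intro u v
    constructor
    · intro h
      rcases u with _ | ⟨i, m, hm⟩ <;> rcases v with _ | ⟨j, m', hm'⟩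
      · exact h.elim
      · have h0 : m' = 0 := h
        subst h0
        exact ⟨j, 0, hm', (spiderPos_zero _ _).symm, (spiderPos_succ _ _ _ hm').symm⟩
      · exact h.elim
      · obtain ⟨rfl, h2⟩ : i = j ∧ m' = m + 1 := h
        subst h2
        exact ⟨i, m + 1, hm', (spiderPos_succ _ _ _ hm).symm, (spiderPos_succ _ _ _ hm').symm⟩
    · rintro ⟨i, m, hm, rfl, rfl⟩
      rw [spiderPos_succ _ _ _ hm]
      rcases m with _ | m
      · rw [spiderPos_zero]
        exact rfl
      · rw [spiderPos_succ _ _ _ (by omega)]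
        exact ⟨rfl, rfl⟩
  have hne : ∀ i m, m < ℓ i → spiderPos ℓ i m ≠ spiderPos ℓ i (m + 1) := by
    intro i m hm
    rw [spiderPos_succ _ _ _ hm]
    rcases m with _ | m
    · rw [spiderPos_zero]
      simp
    · rw [spiderPos_succ _ _ _ (by omega)]
      simp
  rw [spider, fromRel_adj, key, key]
  constructor
  · rintro ⟨-, ⟨i, m, h, h'⟩ | ⟨i, m, h, h'⟩⟩
    · exact ⟨i, m, h, Or.inl h'⟩
    · exact ⟨i, m, h, Or.inr h'⟩
  · rintro ⟨i, m, h, ⟨rfl, rfl⟩ | ⟨rfl, rfl⟩⟩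
    · exact ⟨hne i m h, Or.inl ⟨i, m, h, rfl, rfl⟩⟩
    · exact ⟨(hne i m h).symm, Or.inr ⟨i, m, h, rfl, rfl⟩⟩

/-- If every bounded set of vertices can be avoided by spiders with the same leaves, then the
blowup of the spider is contained in the graph. -/
lemma blowup_isContained {s : ℕ} (L : Fin s → ℕ) (hs : 0 < s) (hL : ∀ i, 0 < L i) (t : ℕ)
    (z : Fin s → V)
    (h : ∀ W : Finset V, #W ≤ s + t * ∑ i, (L i + 1) → SpiderAvoid G L z W) :
    blowup (spider L) (spiderLeaves L) t ⊑ G := by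
  let i0 : Fin s := ⟨0, hs⟩
  let ev : (Fin s → ℕ → V) → SpiderVertex L → V := fun p v =>
    match v with
    | none => p i0 0
    | some ⟨i, m⟩ => p i (m + 1)
  let Good : (Fin s → ℕ → V) → Prop := fun p => (∀ i, IsPath G (L i) (p i)) ∧
    (∀ i j, p i 0 = p j 0) ∧ (∀ i, p i (L i) = z i) ∧
    (∀ i j m m', i ≠ j → 0 < m → 0 < m' → m ≤ L i → m' ≤ L j → p i m ≠ p j m') ∧
    ∀ i m, m < L i → p i m ∉ univ.image z
  -- Greedy choice of `t` spiders, disjoint outside the leaves: the forbidden set consists of the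
  -- `s` leaves and the earlier spiders, each of at most `∑ i, (L i + 1)` vertices.
  have hfam : ∀ j ≤ t, ∃ f : ℕ → Fin s → ℕ → V, ∀ a < j, Good (f a) ∧
      ∀ a' < a, ∀ i i' m m', m < L i → m' ≤ L i' → f a i m ≠ f a' i' m' := by
    intro j hj
    induction j with
    | zero => exact ⟨fun _ _ _ => z i0, by simp⟩
    | succ j ih =>
      obtain ⟨f, hf⟩ := ih (by omega)
      set U : Finset V := (range j).biUnion fun a => univ.biUnion fun i =>
        (range (L i + 1)).image (f a i) with hU
      have hUc : #U ≤ t * ∑ i, (L i + 1) := by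
        refine card_biUnion_le.trans ((sum_le_card_nsmul _ _ (∑ i, (L i + 1)) ?_).trans ?_)
        · intro a _
          refine card_biUnion_le.trans (sum_le_sum fun i _ => ?_)
          exact card_image_le.trans (by simp)
        · rw [card_range, smul_eq_mul]
          exact Nat.mul_le_mul_right _ (by omega)
      obtain ⟨c, p, h1, h2, h3, h4, h5⟩ := h (univ.image z ∪ U) (by
        have h1 := card_union_le (univ.image z) U
        have h3 : #(univ.image z) ≤ s := card_image_le.trans (by simp)
        omega)
      refine ⟨Function.update f j p, fun a ha => ?_⟩
      rcases (Nat.lt_succ_iff.1 ha).lt_or_eq with haj | rfl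
      · rw [Function.update_of_ne haj.ne]
        refine ⟨(hf a haj).1, fun a' ha' => ?_⟩
        rw [Function.update_of_ne (ha'.trans haj).ne]
        exact (hf a haj).2 a' ha'
      · rw [Function.update_self]
        refine ⟨⟨h1, fun i j => by rw [h2, h2], h3, h4,
          fun i m hm hm' => h5 i m hm (mem_union_left _ hm')⟩, fun a' ha' => ?_⟩
        rw [Function.update_of_ne ha'.ne]
        intro i i' m m' hm hm' he
        refine h5 i m hm (mem_union_right _ ?_)
        rw [he]
        exact mem_biUnion.2 ⟨a', mem_range.2 ha', mem_biUnion.2 ⟨i', mem_univ _,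
          mem_image_of_mem _ (mem_range.2 (by omega))⟩⟩
  obtain ⟨f, hf⟩ := hfam t le_rfl
  have hevpos : ∀ p, Good p → ∀ i m, m ≤ L i → ev p (spiderPos L i m) = p i m := by
    intro p hp i m hm
    rcases m with _ | m
    · rw [spiderPos_zero]
      exact hp.2.1 _ _
    · rw [spiderPos_succ _ _ _ (by omega)]
  have hevadj : ∀ p, Good p → ∀ u v, (spider L).Adj u v → G.Adj (ev p u) (ev p v) := by
    intro p hp u v huv
    obtain ⟨i, m, hm, ⟨rfl, rfl⟩ | ⟨rfl, rfl⟩⟩ := spider_adj_iff.1 huv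
    · rw [hevpos p hp i m hm.le, hevpos p hp i _ hm]
      exact (hp.1 i).1 m hm
    · rw [hevpos p hp i m hm.le, hevpos p hp i _ hm]
      exact ((hp.1 i).1 m hm).symm
  have hleaf : ∀ v ∈ spiderLeaves L, ∃ i, v = spiderPos L i (L i) := by
    rintro v ⟨i, m, hm, rfl⟩
    refine ⟨i, ?_⟩
    rw [← hm, spiderPos_succ _ _ _ m.2]
  have hnonleaf : ∀ v ∉ spiderLeaves L, ∃ i m, m < L i ∧ v = spiderPos L i m := by
    intro v hv
    rcases spiderPos_cases v with rfl | ⟨i, m, hm, rfl⟩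
    · exact ⟨i0, 0, hL _, (spiderPos_zero _ _).symm⟩
    · refine ⟨i, m + 1, lt_of_le_of_ne hm fun he => hv ?_, rfl⟩
      exact ⟨i, ⟨m, hm⟩, he, spiderPos_succ _ _ _ hm⟩
  have hevinj : ∀ p, Good p → ∀ u v, ev p u = ev p v → u = v := by
    intro p hp u v huv
    have key : ∀ i m, m < L i → ev p none ≠ ev p (spiderPos L i (m + 1)) := by
      intro i m hm he
      rw [hevpos p hp i _ hm, ← spiderPos_zero L i, hevpos p hp i 0 (Nat.zero_le _)] at he
      have := (hp.1 i).2 0 (Nat.zero_le _) _ hm he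
      omega
    rcases spiderPos_cases u with rfl | ⟨i, m, hm, rfl⟩ <;>
      rcases spiderPos_cases v with rfl | ⟨i', m', hm', rfl⟩
    · rfl
    · exact absurd huv (key i' m' hm')
    · exact absurd huv.symm (key i m hm)
    · rw [hevpos p hp i _ hm, hevpos p hp i' _ hm'] at huv
      rcases eq_or_ne i i' with rfl | hi
      · have h : m + 1 = m' + 1 := (hp.1 i).2 _ hm _ hm' huv
        rw [h]
      · exact absurd huv (hp.2.2.2.1 i i' _ _ hi (by omega) (by omega) hm hm')
  -- For `t = 0` the family `f` carries no information, but the leaves must still be placed; one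
  -- extra spider does this.
  rcases Nat.eq_zero_or_pos t with rfl | ht
  · obtain ⟨c, p, h1, h2, h3, h4, h5⟩ := h (univ.image z) (by
      have h3 : #(univ.image z) ≤ s := card_image_le.trans (by simp)
      omega)
    have hp : Good p := ⟨h1, fun i j => by rw [h2, h2], h3, h4, h5⟩
    refine ⟨⟨⟨Sum.elim (fun v => ev p v) fun v => v.2.elim0, ?_⟩, ?_⟩⟩
    · intro u v huv
      rw [blowup, iSup_adj] at huv
      exact huv.choose.elim0
    · rintro (u | ⟨_, u⟩) (v | ⟨_, v⟩) huv
      · exact congrArg Sum.inl (Subtype.ext (hevinj p hp _ _ huv))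
      · exact v.elim0
      · exact u.elim0
      · exact u.elim0
  have hG : ∀ a : Fin t, Good (f a) := fun a => (hf a a.2).1
  let φ : ↥(spiderLeaves L) ⊕ (↥(spiderLeaves L)ᶜ × Fin t) → V :=
    Sum.elim (fun v => ev (f 0) v) fun v => ev (f v.2) v.1
  have hφ : ∀ (a : Fin t) v, φ (blowupCopy (spiderLeaves L) t a v) = ev (f a) v := by
    intro a v
    by_cases hv : v ∈ spiderLeaves L
    · have : blowupCopy (spiderLeaves L) t a v = Sum.inl ⟨v, hv⟩ :=
        (dif_pos hv)
      rw [this]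
      obtain ⟨i, rfl⟩ := hleaf v hv
      change ev (f 0) _ = _
      rw [hevpos _ (hf 0 ht).1 i _ le_rfl, hevpos _ (hG a) i _ le_rfl, (hf 0 ht).1.2.2.1,
        (hG a).2.2.1]
    · have : blowupCopy (spiderLeaves L) t a v = Sum.inr (⟨v, hv⟩, a) :=
        (dif_neg hv)
      rw [this]
      rfl
  have hlr : ∀ u ∈ spiderLeaves L, ∀ v ∉ spiderLeaves L, ∀ a : Fin t,
      ev (f 0) u ≠ ev (f a) v := by
    intro u hu v hv a he
    obtain ⟨i, rfl⟩ := hleaf u hu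
    obtain ⟨i', m, hm, rfl⟩ := hnonleaf v hv
    rw [hevpos _ (hf 0 ht).1 i _ le_rfl, hevpos _ (hG a) i' _ hm.le, (hf 0 ht).1.2.2.1] at he
    exact (hG a).2.2.2.2 i' m hm (he ▸ mem_image_of_mem _ (mem_univ _))
  have hrr : ∀ u ∉ spiderLeaves L, ∀ v ∉ spiderLeaves L, ∀ a a' : Fin t, a' < a →
      ev (f a) u ≠ ev (f a') v := by
    intro u hu v hv a a' haa he
    obtain ⟨i, m, hm, rfl⟩ := hnonleaf u hu
    obtain ⟨i', m', hm', rfl⟩ := hnonleaf v hv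
    rw [hevpos _ (hG a) i _ hm.le, hevpos _ (hG a') i' _ hm'.le] at he
    exact (hf a a.2).2 a' haa i i' m m' hm hm'.le he
  refine ⟨⟨⟨φ, ?_⟩, ?_⟩⟩
  · intro u v huv
    rw [blowup, iSup_adj] at huv
    obtain ⟨a, ha⟩ := huv
    rw [map_adj] at ha
    obtain ⟨u', v', h1, rfl, rfl⟩ := ha
    rw [hφ, hφ]
    exact hevadj _ (hG a) _ _ h1
  · rintro (u | ⟨u, a⟩) (v | ⟨v, a'⟩) huv
    · exact congrArg Sum.inl (Subtype.ext (hevinj _ (hf 0 ht).1 _ _ huv))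
    · exact absurd huv (hlr u u.2 v v.2 a')
    · exact absurd huv.symm (hlr v v.2 u u.2 a)
    · rcases lt_trichotomy a a' with h | rfl | h
      · exact absurd huv.symm (hrr v v.2 u u.2 a' a h)
      · have := hevinj _ (hG a) _ _ huv
        have h2 : u = v := Subtype.ext this
        rw [h2]
      · exact absurd huv (hrr u u.2 v v.2 a a' h)

end Connections

/-! ### Restrictions of families of maps and their fibres -/

section Restriction

open scoped Classical

variable {V : Type*} {κ κ' : Type*}

/-- The restriction of a function to `E`. -/
noncomputable def restr (E : Set κ) (ρ : κ → V) : κ → Option V :=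
  fun v => if v ∈ E then some (ρ v) else none

lemma restr_eq_iff {E : Set κ} {ρ ρ' : κ → V} :
    restr E ρ = restr E ρ' ↔ ∀ v ∈ E, ρ v = ρ' v := by
  constructor
  · intro h v hv
    have := congrFun h v
    simpa [restr, hv] using this
  · intro h
    funext v
    by_cases hv : v ∈ E
    · simp [restr, hv, h v hv]
    · simp [restr, hv]

/-- The members of `F` which agree with `ρ` on `E`. -/
noncomputable def agreeing (F : Finset (κ → V)) (E : Set κ) (ρ : κ → V) : Finset (κ → V) :=
  {ρ' ∈ F | ∀ v ∈ E, ρ' v = ρ v}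

lemma mem_agreeing {F : Finset (κ → V)} {E : Set κ} {ρ ρ' : κ → V} :
    ρ' ∈ agreeing F E ρ ↔ ρ' ∈ F ∧ ∀ v ∈ E, ρ' v = ρ v := by
  rw [agreeing, mem_filter]

/-- The number of restrictions to `E` of members of `F`. -/
noncomputable def restrCard (F : Finset (κ → V)) (E : Set κ) : ℕ := #(F.image (restr E))

/-- Each fibre of the restriction to `E` has at most `f` elements. -/
def FiberLe (F : Finset (κ → V)) (E : Set κ) (f : ℕ) : Prop :=
  ∀ ρ ∈ F, #(agreeing F E ρ) ≤ f

lemma agreeing_mono {F F' : Finset (κ → V)} (h : F' ⊆ F) (E : Set κ) (ρ : κ → V) :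
    agreeing F' E ρ ⊆ agreeing F E ρ := filter_subset_filter _ h

lemma FiberLe.mono {F F' : Finset (κ → V)} {E : Set κ} {f f' : ℕ}
    (h : FiberLe F E f) (hs : F' ⊆ F) (hf : f ≤ f') : FiberLe F' E f' := fun ρ hρ =>
  (card_le_card (agreeing_mono hs E ρ)).trans ((h ρ (hs hρ)).trans hf)

lemma exists_large_restr_fibers {R : Type*} [Fintype R] (𝓕 : Finset (κ → V))
    (E : R → Set κ) (θ : R → ℕ) :
    ∃ F ⊆ 𝓕, (∀ r, ∀ ρ ∈ F, θ r ≤ #(agreeing F (E r) ρ)) ∧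
      #𝓕 ≤ #F + ∑ r, θ r * restrCard 𝓕 (E r) := by
  obtain ⟨F, hF, h1, h2⟩ := exists_large_fibers 𝓕 (fun r => restr (E r)) θ
  refine ⟨F, hF, fun r ρ hρ => ?_, h2⟩
  simpa only [restr_eq_iff, agreeing] using h1 r ρ hρ

lemma card_image_le_card_image {α β γ : Type*} (F : Finset α) (f : α → β) (g : α → γ)
    (h : ∀ a ∈ F, ∀ b ∈ F, f a = f b → g a = g b) : #(F.image g) ≤ #(F.image f) := by
  rcases F.eq_empty_or_nonempty with rfl | ⟨a0, ha0⟩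
  · simp
  · let φ : β → γ := fun y => if hy : ∃ a ∈ F, f a = y then g hy.choose else g a0
    have : F.image g ⊆ (F.image f).image φ := by
      intro y hy
      obtain ⟨a, ha, rfl⟩ := mem_image.1 hy
      refine mem_image.2 ⟨f a, mem_image_of_mem _ ha, ?_⟩
      have hy : ∃ a' ∈ F, f a' = f a := ⟨a, ha, rfl⟩
      simp only [φ, dif_pos hy]
      exact h _ hy.choose_spec.1 _ ha hy.choose_spec.2
    exact (card_le_card this).trans card_image_le

/-- A restriction to `E` is determined by the composite with any `w` whose range covers `E`, so
restrictions can be counted by counting maps from a smaller tree. -/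
lemma restrCard_le (𝓕 : Finset (κ → V)) (E : Set κ) (w : κ' → κ) (hE : E ⊆ Set.range w)
    (S : Finset (κ' → V)) (hS : ∀ ρ ∈ 𝓕, ρ ∘ w ∈ S) : restrCard 𝓕 E ≤ #S := by
  have h1 : #(𝓕.image (restr E)) ≤ #(𝓕.image fun ρ => ρ ∘ w) := by
    refine card_image_le_card_image _ _ _ fun a _ b _ hab => restr_eq_iff.2 fun v hv => ?_
    obtain ⟨j, rfl⟩ := hE hv
    exact congrFun hab j
  exact h1.trans (card_le_card (image_subset_iff.2 hS))

/-- Fibres partition the family. This makes the cleaning over the ends cheap when all fibres over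
the ends are heavy. -/
lemma mul_restrCard_le (𝓕 : Finset (κ → V)) (E : Set κ) (g : ℕ)
    (h : ∀ ρ ∈ 𝓕, g ≤ #(agreeing 𝓕 E ρ)) : g * restrCard 𝓕 E ≤ #𝓕 := by
  rw [restrCard, card_eq_sum_card_image (restr E) 𝓕, mul_comm, ← smul_eq_mul]
  refine card_nsmul_le_sum _ _ _ fun y hy => ?_
  obtain ⟨ρ, hρ, rfl⟩ := mem_image.1 hy
  simpa only [restr_eq_iff, agreeing] using h ρ hρ

/-- A union bound over the position and the vertex of `W` that it hits. It turns bounds on pinned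
fibres into the avoidance of bounded sets. -/
lemma card_le_of_exists_pinned {α β : Type*} (F : Finset α) (P : Finset β) (W : Finset V)
    (v : β → α → V) (f : ℕ) (hF : ∀ a ∈ F, ∃ m ∈ P, v m a ∈ W)
    (h : ∀ m ∈ P, ∀ w ∈ W, #{a ∈ F | v m a = w} ≤ f) : #F ≤ #P * #W * f := by
  have : F ⊆ (P ×ˢ W).biUnion fun x => {a ∈ F | v x.1 a = x.2} := by
    intro a ha
    obtain ⟨m, hm, hw⟩ := hF a ha
    exact mem_biUnion.2 ⟨(m, v m a), mem_product.2 ⟨hm, hw⟩, mem_filter.2 ⟨ha, rfl⟩⟩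
  refine (card_le_card this).trans (card_biUnion_le.trans ?_)
  refine (sum_le_card_nsmul _ _ f fun x hx => ?_).trans ?_
  · exact h _ (mem_product.1 hx).1 _ (mem_product.1 hx).2
  · rw [card_product, smul_eq_mul]

end Restriction

/-! ### Finite paths and the lengthening of flexible connections -/

section Paths

open scoped Classical

variable {V : Type*} {G : SimpleGraph V}

/-- The extension of a finite sequence to all natural numbers by its last value. -/
def seqExt {V : Type*} {l : ℕ} (ρ : Fin (l + 1) → V) : ℕ → V := fun m => ρ ⟨min m l, by omega⟩

lemma seqExt_apply {l m : ℕ} (ρ : Fin (l + 1) → V) (hm : m < l + 1) :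
    seqExt ρ m = ρ ⟨m, hm⟩ := by
  simp only [seqExt]
  congr 2
  omega

lemma seqExt_val {l : ℕ} (ρ : Fin (l + 1) → V) (j : Fin (l + 1)) : seqExt ρ j = ρ j :=
  seqExt_apply ρ j.2

lemma IsPath.hom {l : ℕ} {p : ℕ → V} (h : IsPath G l p) (a m : ℕ) (ha : a + m ≤ l) :
    ∀ u v : Fin (m + 1), (pathGraph (m + 1)).Adj u v → G.Adj (p (a + u)) (p (a + v)) := by
  intro u v huv
  have hu := u.2
  have hv := v.2
  rw [pathGraph_adj] at huv
  rcases huv with h1 | h1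
  · have := h.1 (a + u) (by omega)
    rwa [add_assoc, h1] at this
  · have := h.1 (a + v) (by omega)
    rw [add_assoc, h1] at this
    exact this.symm

lemma IsPath.sub {l : ℕ} {p : ℕ → V} (h : IsPath G l p) (a m : ℕ) (ha : a + m ≤ l) :
    IsPath G m fun j => p (a + j) := by
  refine ⟨fun j hj => h.1 (a + j) (by omega), fun j hj j' hj' he => ?_⟩
  have := h.2 (a + j) (by omega) (a + j') (by omega) he
  omega

/-- Lengthening connections by moving the end of a path to a different neighbour of its parent. -/
lemma pathAvoid_of_flexible {l : ℕ} (hl : 2 ≤ l) (F : Finset (Fin (l + 1) → V))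
    (hpath : ∀ ρ ∈ F, IsPath G l (seqExt ρ)) (B : ℕ)
    (hA : ∀ ρ ∈ F, ∀ W : Finset V, #W ≤ B → ∃ ρ' ∈ F, seqExt ρ' 0 = seqExt ρ 0 ∧
      seqExt ρ' l = seqExt ρ l ∧ ∀ m, 0 < m → m < l → seqExt ρ' m ∉ W)
    (hB : ∀ ρ ∈ F, ∀ W : Finset V, #W ≤ B → ∃ ρ' ∈ F,
      (∀ m < l, seqExt ρ' m = seqExt ρ m) ∧ seqExt ρ' l ∉ W) (e : ℕ) :
    ∀ ρ ∈ F, ∀ W : Finset V, #W + e ≤ B →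
      PathAvoid G (l + e) (seqExt ρ 0) (seqExt ρ (l - e % 2)) W := by
  induction e with
  | zero =>
    intro ρ hρ W hW
    obtain ⟨ρ', hρ', h0, hl', h⟩ := hA ρ hρ W (by omega)
    exact ⟨seqExt ρ', hpath ρ' hρ', h0, by simpa using hl', h⟩
  | succ e ih =>
    intro ρ hρ W hW
    -- To reach odd excess, move the last vertex to another neighbour of its parent, connect to it,
    -- and step back to the parent. To reach even excess, reroute with the ends fixed, connect to
    -- the new parent, and take the last edge. Each step forbids one more vertex, hence the budget
    -- `#W + e ≤ B`.
    rcases Nat.mod_two_eq_zero_or_one e with he | he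
    · have he' : (e + 1) % 2 = 1 := by omega
      rw [he']
      obtain ⟨ρ', hρ', h1, h2⟩ := hB ρ hρ W (by omega)
      have hp := hpath ρ' hρ'
      have h3 := ih ρ' hρ' (insert (seqExt ρ (l - 1)) W) (by
        have := card_insert_le (seqExt ρ (l - 1)) W
        omega)
      rw [he, Nat.sub_zero, h1 0 (by omega)] at h3
      refine h3.append (by omega) ?_ ?_ h2
      · rw [← h1 (l - 1) (by omega)]
        have := hp.1 (l - 1) (by omega)
        rw [show l - 1 + 1 = l by omega] at this
        exact this.symm
      · intro h
        have := (hpath ρ hρ).2 0 (by omega) (l - 1) (by omega) h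
        omega
    · have he' : (e + 1) % 2 = 0 := by omega
      rw [he', Nat.sub_zero]
      obtain ⟨ρ', hρ', h0, h1, h2⟩ := hA ρ hρ W (by omega)
      have hp := hpath ρ' hρ'
      have h3 := ih ρ' hρ' (insert (seqExt ρ l) W) (by
        have := card_insert_le (seqExt ρ l) W
        omega)
      rw [he, h0] at h3
      refine h3.append (by omega) ?_ ?_ (h2 _ (by omega) (by omega))
      · rw [← h1]
        have := hp.1 (l - 1) (by omega)
        rwa [show l - 1 + 1 = l by omega] at this
      · intro h
        have := (hpath ρ hρ).2 0 (by omega) l (by omega) h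
        omega

variable [Fintype V]

/-- The number of paths of length `m` with prescribed vertices in the first `a + 1` positions. -/
lemma card_path_extending_le (Δ : ℕ) (hΔ : ∀ v, #{w | G.Adj v w} ≤ Δ) (m a : ℕ) (ha : a ≤ m)
    (φ : ℕ → V) (F : Finset (Fin (m + 1) → V)) (hpath : ∀ ρ ∈ F, IsPath G m (seqExt ρ))
    (hφ : ∀ ρ ∈ F, ∀ j ≤ a, seqExt ρ j = φ j) : #F ≤ Δ ^ (m - a) := by
  have h := card_le_of_hom_extending (pathGraph (m + 1)) (pathGraph_connected m).preconnected G
    Δ hΔ (Finset.Iic ⟨a, by omega⟩) ⟨⟨a, by omega⟩, by simp⟩ (fun j => φ j) F ?_ ?_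
  · rwa [Fin.card_Iic, Fintype.card_fin, show m + 1 - (a + 1) = m - a by omega] at h
  · intro ρ hρ u v huv
    have := (hpath ρ hρ).hom 0 m (by omega) u v huv
    simpa [seqExt_val] using this
  · intro ρ hρ v hv
    rw [← seqExt_val ρ v]
    exact hφ ρ hρ v (by simpa [Fin.le_def] using hv)

lemma card_path_le (Δ : ℕ) (hΔ : ∀ v, #{w | G.Adj v w} ≤ Δ) (m : ℕ)
    (F : Finset (Fin (m + 1) → V)) (hpath : ∀ ρ ∈ F, IsPath G m (seqExt ρ)) :
    #F ≤ Fintype.card V * Δ ^ m := by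
  have h := card_le_of_hom (pathGraph (m + 1)) (pathGraph_connected m).preconnected G Δ hΔ F ?_
  · rwa [Fintype.card_fin, Nat.add_sub_cancel] at h
  · intro ρ hρ u v huv
    have := (hpath ρ hρ).hom 0 m (by omega) u v huv
    simpa [seqExt_val] using this

end Paths

/-! ### Cleaning a dense family of paths, and brooms -/

section PathCleaning

open scoped Classical

variable {V : Type*} [Fintype V] {G : SimpleGraph V}

/-- The members of `F` with the same ends as `ρ`. -/
noncomputable def sameEnds {V : Type*} {l : ℕ} (F : Finset (Fin (l + 1) → V))
    (x y : V) : Finset (Fin (l + 1) → V) :=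
  {ρ ∈ F | seqExt ρ 0 = x ∧ seqExt ρ l = y}

lemma mem_sameEnds {V : Type*} {l : ℕ} {F : Finset (Fin (l + 1) → V)} {x y : V}
    {ρ : Fin (l + 1) → V} : ρ ∈ sameEnds F x y ↔ ρ ∈ F ∧ seqExt ρ 0 = x ∧ seqExt ρ l = y := by
  rw [sameEnds, mem_filter]

/-- Large fibres are enforced for two restrictions: to both ends with threshold `g`, and to all but
the last vertex with threshold `B + 1`. Heaviness makes the end pairs few, and a path without its
last vertex has at most `Fintype.card V * Δ ^ (l - 1)` values, so each costs at most a quarter of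
`F₀`. Members of a fibre of the second kind differ only in the last vertex, so one of them ends
outside `W`. -/
lemma exists_flexible_paths (Δ : ℕ) (hΔ : ∀ v, #{w | G.Adj v w} ≤ Δ) {l : ℕ} (hl : 2 ≤ l)
    (F₀ : Finset (Fin (l + 1) → V)) (hpath : ∀ ρ ∈ F₀, IsPath G l (seqExt ρ)) (A g B : ℕ)
    (hdense : Fintype.card V * Δ ^ l ≤ A * #F₀)
    (hheavy : ∀ ρ ∈ F₀, 4 * g ≤ #(sameEnds F₀ (seqExt ρ 0) (seqExt ρ l)))
    (hAB : 4 * A * (B + 1) ≤ Δ) (hpos : 0 < Fintype.card V * Δ ^ l) :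
    ∃ F ⊆ F₀, Fintype.card V * Δ ^ l ≤ 2 * A * #F ∧
      (∀ ρ ∈ F, g ≤ #(sameEnds F (seqExt ρ 0) (seqExt ρ l))) ∧
      ∀ ρ ∈ F, ∀ W : Finset V, #W ≤ B → ∃ ρ' ∈ F,
        (∀ m < l, seqExt ρ' m = seqExt ρ m) ∧ seqExt ρ' l ∉ W := by
  let E : Bool → Set (Fin (l + 1)) := fun r => if r then {0, Fin.last l} else {j | (j : ℕ) < l}
  have hE1 : ∀ ρ ρ' : Fin (l + 1) → V, (∀ v ∈ E true, ρ' v = ρ v) ↔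
      (seqExt ρ' 0 = seqExt ρ 0 ∧ seqExt ρ' l = seqExt ρ l) := by
    intro ρ ρ'
    simp only [E, if_true, Set.mem_insert_iff, Set.mem_singleton_iff, forall_eq_or_imp, forall_eq]
    rw [seqExt_apply ρ (Nat.succ_pos l), seqExt_apply ρ' (Nat.succ_pos l),
      seqExt_apply ρ (Nat.lt_succ_self l), seqExt_apply ρ' (Nat.lt_succ_self l)]
    rfl
  have hE2 : ∀ ρ ρ' : Fin (l + 1) → V, (∀ v ∈ E false, ρ' v = ρ v) ↔
      ∀ m < l, seqExt ρ' m = seqExt ρ m := by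
    intro ρ ρ'
    simp only [E, Bool.false_eq_true, if_false, Set.mem_ofPred_eq]
    constructor
    · intro h m hm
      rw [seqExt_apply ρ (by omega), seqExt_apply ρ' (by omega)]
      exact h ⟨m, by omega⟩ hm
    · intro h v hv
      rw [← seqExt_val ρ v, ← seqExt_val ρ' v]
      exact h v hv
  obtain ⟨F, hF, h1, h2⟩ := exists_large_restr_fibers F₀ E fun r => if r then g else B + 1
  have himg1 : 4 * g * restrCard F₀ (E true) ≤ #F₀ := by
    refine mul_restrCard_le F₀ (E true) (4 * g) fun ρ hρ => (hheavy ρ hρ).trans ?_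
    refine card_le_card fun ρ' hρ' => ?_
    rw [mem_sameEnds] at hρ'
    rw [mem_agreeing, hE1]
    exact hρ'
  have himg2 : restrCard F₀ (E false) ≤ Fintype.card V * Δ ^ (l - 1) := by
    obtain ⟨k, rfl⟩ : ∃ k, l = k + 1 := ⟨l - 1, by omega⟩
    refine (restrCard_le F₀ (E false) (Fin.castSucc : Fin (k + 1) → Fin (k + 2)) ?_
      (F₀.image fun ρ => ρ ∘ Fin.castSucc) fun ρ hρ => mem_image_of_mem _ hρ).trans ?_
    · intro v hv
      simp only [E, Bool.false_eq_true, if_false, Set.mem_ofPred_eq] at hv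
      exact ⟨⟨v, hv⟩, rfl⟩
    · refine card_path_le Δ hΔ k _ fun ρ hρ => ?_
      obtain ⟨ρ', hρ', rfl⟩ := mem_image.1 hρ
      have h := (hpath ρ' hρ').sub 0 k (by omega)
      have h3 : ∀ m ≤ k, seqExt (ρ' ∘ Fin.castSucc) m = seqExt ρ' (0 + m) := by
        intro m hm
        rw [zero_add, seqExt_apply _ (show m < k + 1 by omega), seqExt_apply ρ' (by omega)]
        rfl
      refine ⟨fun m hm => ?_, fun m hm m' hm' he => ?_⟩
      · rw [h3 m hm.le, h3 (m + 1) hm]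
        exact h.1 m hm
      · rw [h3 m hm, h3 m' hm'] at he
        exact h.2 m hm m' hm' he
  have hbig : 4 * (B + 1) * restrCard F₀ (E false) ≤ #F₀ := by
    have hA : 0 < A := by
      rcases Nat.eq_zero_or_pos A with rfl | h
      · omega
      · exact h
    refine Nat.le_of_mul_le_mul_left (c := A) ?_ hA
    calc A * (4 * (B + 1) * restrCard F₀ (E false))
        = 4 * A * (B + 1) * restrCard F₀ (E false) := by ring
      _ ≤ Δ * (Fintype.card V * Δ ^ (l - 1)) := Nat.mul_le_mul hAB himg2
      _ = Fintype.card V * Δ ^ l := by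
        rw [← mul_left_comm, ← pow_succ', Nat.sub_add_cancel (by omega)]
      _ ≤ A * #F₀ := hdense
  have hF2 : #F₀ ≤ 2 * #F := by
    simp only [Fintype.sum_bool, if_true, Bool.false_eq_true, if_false] at h2
    nlinarith
  refine ⟨F, hF, ?_, fun ρ hρ => ?_, fun ρ hρ W hW => ?_⟩
  · calc Fintype.card V * Δ ^ l ≤ A * #F₀ := hdense
      _ ≤ A * (2 * #F) := Nat.mul_le_mul_left _ hF2
      _ = 2 * A * #F := by ring
  · refine (by simpa using h1 true ρ hρ : g ≤ _).trans (card_le_card fun ρ' hρ' => ?_)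
    rw [mem_agreeing] at hρ'
    rw [mem_sameEnds]
    exact ⟨hρ'.1, (hE1 ρ ρ').1 hρ'.2⟩
  · by_contra! hcon
    have h3 := h1 false ρ hρ
    simp only [Bool.false_eq_true, if_false] at h3
    have h4 : #(agreeing F (E false) ρ) ≤ #W := by
      refine card_le_card_of_injOn (fun ρ' => seqExt ρ' l) (fun ρ' hρ' => ?_) ?_
      · rw [mem_coe, mem_agreeing] at hρ'
        exact hcon ρ' hρ'.1 ((hE2 ρ ρ').1 hρ'.2)
      · intro a ha b hb hab
        rw [mem_coe, mem_agreeing] at ha hb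
        funext v
        rw [← seqExt_val a v, ← seqExt_val b v]
        rcases (Nat.lt_succ_iff.1 v.2).lt_or_eq with h | h
        · rw [(hE2 ρ a).1 ha.2 v h, (hE2 ρ b).1 hb.2 v h]
        · rw [h]
          exact hab
    omega

/-- In a dense family of paths there are many paths from a common vertex `u` all of which are
continued, backwards, by each vertex of a set `Q` of prescribed size. -/
lemma exists_broom (Δ : ℕ) (hΔ : ∀ v, #{w | G.Adj v w} ≤ Δ) {k : ℕ}
    (F : Finset (Fin (k + 2) → V)) (hpath : ∀ ρ ∈ F, IsPath G (k + 1) (seqExt ρ))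
    (A q : ℕ) (hdense : Fintype.card V * Δ ^ (k + 1) ≤ A * #F)
    (hA : 4 * A * (q + 1) ≤ Δ) (hpos : 0 < Fintype.card V * Δ ^ (k + 1)) :
    ∃ (u : V) (Q : Finset V) (R : Finset (Fin (k + 1) → V)), #Q = q ∧ R.Nonempty ∧
      (∀ r ∈ R, seqExt r 0 = u) ∧
      (∀ r ∈ R, ∀ x ∈ Q, (Fin.cons x r : Fin (k + 2) → V) ∈ F) ∧
      Δ ^ k ≤ 2 * A * (4 * A) ^ q * #R := by
  have hn : 0 < Fintype.card V := Nat.pos_of_mul_pos_right hpos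
  have hΔpos : 0 < Δ := by
    have := Nat.pos_of_mul_pos_left hpos
    exact Nat.pos_of_ne_zero fun h => by simp [h] at this
  have hApos : 0 < A := by
    rcases Nat.eq_zero_or_pos A with rfl | h
    · omega
    · exact h
  -- Tails with fewer than `τ` backward continuations account for at most half of the lower bound
  -- for `#F`, so tails with at least `τ` are dense. Even after `q` elements are removed, `τ` is a
  -- proportion `1 / (4 * A)` of `Δ`.
  set τ := Δ / (2 * A) with hτ
  have hτ1 : 2 * A * τ ≤ Δ := Nat.mul_div_le _ _
  have hτ2 : Δ < 2 * A * (τ + 1) := Nat.lt_mul_div_succ _ (by omega)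
  have hτ3 : Δ ≤ 4 * A * (τ - q) := by
    have h1 : 2 * (q + 1) ≤ τ := by
      rw [hτ, Nat.le_div_iff_mul_le (by omega)]
      nlinarith
    obtain ⟨d, hd⟩ : ∃ d, τ = q + d := ⟨τ - q, by omega⟩
    rw [hd, Nat.add_sub_cancel_left]
    rw [hd] at hτ2 h1
    have : q + d + 1 ≤ 2 * d := by omega
    nlinarith [Nat.mul_le_mul_left (2 * A) this]
  set 𝓣 : Finset (Fin (k + 1) → V) := F.image Fin.tail with h𝓣
  have htail : ∀ ρ : Fin (k + 2) → V, ∀ m ≤ k, seqExt (Fin.tail ρ : Fin (k + 1) → V) m =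
      seqExt ρ (1 + m) := by
    intro ρ m hm
    rw [seqExt_apply _ (show m < k + 1 by omega), seqExt_apply ρ (show 1 + m < k + 2 by omega)]
    simp only [Fin.tail]
    congr 1
    ext
    simp [add_comm]
  have h𝓣path : ∀ r ∈ 𝓣, IsPath G k (seqExt r) := by
    intro r hr
    obtain ⟨ρ, hρ, rfl⟩ := mem_image.1 hr
    have h := (hpath ρ hρ).sub 1 k (by omega)
    refine ⟨fun m hm => ?_, fun m hm m' hm' he => ?_⟩
    · rw [htail ρ m hm.le, htail ρ (m + 1) hm]
      exact h.1 m hm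
    · rw [htail ρ m hm, htail ρ m' hm'] at he
      exact h.2 m hm m' hm' he
  have h𝓣card : #𝓣 ≤ Fintype.card V * Δ ^ k := card_path_le Δ hΔ k 𝓣 h𝓣path
  let X : (Fin (k + 1) → V) → Finset V := fun r => {x | (Fin.cons x r : Fin (k + 2) → V) ∈ F}
  have hXS : ∀ r, X r ⊆ ({w | G.Adj (seqExt r 0) w} : Finset V) := by
    intro r x hx
    have hx' : (Fin.cons x r : Fin (k + 2) → V) ∈ F := (mem_filter.1 hx).2
    have := (hpath _ hx').1 0 (by omega)
    rw [seqExt_apply _ (by omega), seqExt_apply _ (by omega)] at this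
    rw [mem_filter]
    refine ⟨mem_univ _, ?_⟩
    rw [seqExt_apply r (by omega)]
    exact this.symm
  have hXΔ : ∀ r, #(X r) ≤ Δ := fun r => (card_le_card (hXS r)).trans (hΔ _)
  have hFsum : #F = ∑ r ∈ 𝓣, #(X r) := by
    rw [card_eq_sum_card_image (Fin.tail : (Fin (k + 2) → V) → Fin (k + 1) → V) F]
    refine sum_congr rfl fun r _ => ?_
    refine card_bij (fun ρ _ => ρ 0) (fun ρ hρ => ?_) (fun a ha b hb hab => ?_) (fun x hx => ?_)
    · rw [mem_filter] at hρ
      refine mem_filter.2 ⟨mem_univ _, ?_⟩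
      rw [← hρ.2, Fin.cons_self_tail]
      exact hρ.1
    · rw [mem_filter] at ha hb
      rw [← Fin.cons_self_tail a, ← Fin.cons_self_tail b, ha.2, hb.2, hab]
    · refine ⟨Fin.cons x r, mem_filter.2 ⟨(mem_filter.1 hx).2, Fin.tail_cons _ _⟩, rfl⟩
  set R₀ : Finset (Fin (k + 1) → V) := {r ∈ 𝓣 | τ ≤ #(X r)} with hR₀
  have hR₀card : Fintype.card V * Δ ^ k ≤ 2 * A * #R₀ := by
    have h1 : #F ≤ τ * #𝓣 + Δ * #R₀ := by
      rw [hFsum, ← sum_filter_add_sum_filter_not 𝓣 (fun r => τ ≤ #(X r)), add_comm]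
      refine Nat.add_le_add ?_ ?_
      · refine (sum_le_card_nsmul _ _ τ fun r hr => ?_).trans ?_
        · exact (not_le.1 (mem_filter.1 hr).2).le
        · rw [smul_eq_mul, mul_comm]
          exact Nat.mul_le_mul_left _ (card_filter_le _ _)
      · refine (sum_le_card_nsmul _ _ Δ fun r _ => hXΔ r).trans ?_
        rw [smul_eq_mul, mul_comm]
    have h2 : 2 * (Fintype.card V * Δ ^ (k + 1)) ≤
        Fintype.card V * Δ ^ (k + 1) + Δ * (2 * A * #R₀) := by
      calc 2 * (Fintype.card V * Δ ^ (k + 1)) ≤ 2 * (A * #F) := Nat.mul_le_mul_left _ hdense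
        _ ≤ 2 * (A * (τ * #𝓣 + Δ * #R₀)) := by gcongr
        _ = (2 * A * τ) * #𝓣 + Δ * (2 * A * #R₀) := by ring
        _ ≤ Δ * (Fintype.card V * Δ ^ k) + Δ * (2 * A * #R₀) := by gcongr
        _ = _ := by ring
    refine Nat.le_of_mul_le_mul_left (c := Δ) ?_ hΔpos
    have h3 : Δ * (Fintype.card V * Δ ^ k) = Fintype.card V * Δ ^ (k + 1) := by ring
    omega
  -- Once the first vertex is fixed, all continuation sets lie in one neighbourhood of size at most
  -- `Δ` and fill a positive proportion of it, so `exists_common_subset` applies.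
  obtain ⟨u, hu⟩ : ∃ u, Δ ^ k ≤ 2 * A * #{r ∈ R₀ | seqExt r 0 = u} := by
    by_contra! hcon
    have h1 : #R₀ = ∑ u, #{r ∈ R₀ | seqExt r 0 = u} :=
      card_eq_sum_card_fiberwise fun _ _ => mem_univ _
    have h2 : ∑ u, 2 * A * #{r ∈ R₀ | seqExt r 0 = u} < ∑ _u : V, Δ ^ k :=
      sum_lt_sum_of_nonempty (card_pos.1 (by rwa [card_univ])) fun u _ => hcon u
    rw [← mul_sum, ← h1, sum_const, card_univ, smul_eq_mul] at h2
    omega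
  set R₁ : Finset (Fin (k + 1) → V) := {r ∈ R₀ | seqExt r 0 = u} with hR₁
  have hR₁ne : R₁.Nonempty := by
    rw [← card_pos]
    have : 0 < Δ ^ k := Nat.pow_pos hΔpos
    exact Nat.pos_of_ne_zero fun h => by rw [h] at hu; omega
  have hR₁τ : ∀ r ∈ R₁, τ ≤ #(X r) := fun r hr => (mem_filter.1 (mem_filter.1 hr).1).2
  have hR₁u : ∀ r ∈ R₁, seqExt r 0 = u := fun r hr => (mem_filter.1 hr).2
  have hR₁S : ∀ r ∈ R₁, X r ⊆ ({w | G.Adj u w} : Finset V) := fun r hr => by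
    rw [← hR₁u r hr]
    exact hXS r
  have hτpos : q < τ := by
    by_contra! h
    rw [Nat.sub_eq_zero_of_le h] at hτ3
    omega
  obtain ⟨Q, -, hQ, hQR⟩ := exists_common_subset (4 * A) q R₁ ({w | G.Adj u w} : Finset V) X
    (by
      obtain ⟨r, hr⟩ := hR₁ne
      have h1 := card_le_card (hR₁S r hr)
      have h2 := hR₁τ r hr
      omega) hR₁S
    (fun r hr => (hΔ u).trans (hτ3.trans (Nat.mul_le_mul_left _ (by
      have := hR₁τ r hr
      omega)))) hR₁ne
  have hfin : Δ ^ k ≤ 2 * A * (4 * A) ^ q * #{r ∈ R₁ | Q ⊆ X r} := by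
    refine hu.trans ?_
    rw [mul_assoc (2 * A)]
    exact Nat.mul_le_mul_left _ hQR
  refine ⟨u, Q, {r ∈ R₁ | Q ⊆ X r}, hQ, ?_, fun r hr => hR₁u r (mem_filter.1 hr).1,
    fun r hr x hx => ?_, hfin⟩
  · rw [← card_pos]
    have : 0 < Δ ^ k := Nat.pow_pos hΔpos
    exact Nat.pos_of_ne_zero fun h => by rw [h] at hfin; omega
  · exact (mem_filter.1 ((mem_filter.1 hr).2 hx)).2

end PathCleaning

/-! ### Avoiding bounded sets, hubs, and branching families of paths -/

section Branching

open scoped Classical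

variable {V : Type*} {G : SimpleGraph V}

lemma seqExt_cons_succ {d : ℕ} (x : V) (r : Fin (d + 1) → V) (m : ℕ) :
    seqExt (Fin.cons x r : Fin (d + 2) → V) (m + 1) = seqExt r m := by
  simp only [seqExt]
  have : (⟨min (m + 1) (d + 1), by omega⟩ : Fin (d + 2)) = Fin.succ ⟨min m d, by omega⟩ := by
    ext
    simp
  rw [this, Fin.cons_succ]

lemma seqExt_cons_zero {d : ℕ} (x : V) (r : Fin (d + 1) → V) :
    seqExt (Fin.cons x r : Fin (d + 2) → V) 0 = x := by
  rw [seqExt_apply _ (by omega)]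
  rfl

/-- The members of `F` from `x` to `y` whose inner vertices avoid `W`. -/
noncomputable def avoidingEnds {l : ℕ} (F : Finset (Fin (l + 1) → V)) (x y : V) (W : Finset V) :
    Finset (Fin (l + 1) → V) :=
  {ρ ∈ sameEnds F x y | ∀ m, 0 < m → m < l → seqExt ρ m ∉ W}

lemma mem_avoidingEnds {l : ℕ} {F : Finset (Fin (l + 1) → V)} {x y : V} {W : Finset V}
    {ρ : Fin (l + 1) → V} : ρ ∈ avoidingEnds F x y W ↔
      ρ ∈ sameEnds F x y ∧ ∀ m, 0 < m → m < l → seqExt ρ m ∉ W := by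
  rw [avoidingEnds, mem_filter]

/-- A bounded set meets only few of the paths with given ends. -/
lemma card_sameEnds_le {l : ℕ} (F : Finset (Fin (l + 1) → V)) (x y : V) (f : ℕ)
    (hpin : ∀ m w, 0 < m → m < l → #{ρ ∈ sameEnds F x y | seqExt ρ m = w} ≤ f) (W : Finset V) :
    #(sameEnds F x y) ≤ l * #W * f + #(avoidingEnds F x y W) := by
  have h := card_le_of_exists_pinned (sameEnds F x y \ avoidingEnds F x y W) (Ioo 0 l) W
    (fun m ρ => seqExt ρ m) f (fun ρ hρ => ?_) fun m hm w _ =>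
      (card_le_card (filter_subset_filter _ sdiff_subset)).trans
        (hpin m w (mem_Ioo.1 hm).1 (mem_Ioo.1 hm).2)
  · have h2 := card_sdiff_add_card (sameEnds F x y) (avoidingEnds F x y W)
    have h3 := card_le_card
      (subset_union_left : sameEnds F x y ⊆ sameEnds F x y ∪ avoidingEnds F x y W)
    have h4 : #(Ioo 0 l) * #W * f ≤ l * #W * f := by
      rw [Nat.card_Ioo]
      gcongr
      omega
    omega
  · rw [mem_sdiff, mem_avoidingEnds, not_and] at hρ
    by_contra! hcon
    exact hρ.2 hρ.1 fun m h1 h2 => hcon m (mem_Ioo.2 ⟨h1, h2⟩)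

/-- At most `l * B * f` of the paths with given ends have an inner vertex in `W`, fewer than the `g`
available. -/
lemma exists_avoiding {l : ℕ} (F : Finset (Fin (l + 1) → V)) (f g B : ℕ)
    (hpin : ∀ x y m w, 0 < m → m < l → #{ρ ∈ sameEnds F x y | seqExt ρ m = w} ≤ f)
    (hg : ∀ ρ ∈ F, g ≤ #(sameEnds F (seqExt ρ 0) (seqExt ρ l))) (hB : l * B * f < g) :
    ∀ ρ ∈ F, ∀ W : Finset V, #W ≤ B → ∃ ρ' ∈ F, seqExt ρ' 0 = seqExt ρ 0 ∧
      seqExt ρ' l = seqExt ρ l ∧ ∀ m, 0 < m → m < l → seqExt ρ' m ∉ W := by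
  intro ρ hρ W hW
  have h1 := card_sameEnds_le F (seqExt ρ 0) (seqExt ρ l) f (hpin _ _) W
  have h2 : l * #W * f ≤ l * B * f := by gcongr
  have h3 : 0 < #(avoidingEnds F (seqExt ρ 0) (seqExt ρ l) W) := by
    have := hg ρ hρ
    omega
  obtain ⟨ρ', hρ'⟩ := card_pos.1 h3
  rw [mem_avoidingEnds, mem_sameEnds] at hρ'
  exact ⟨ρ', hρ'.1.1, hρ'.1.2.1, hρ'.1.2.2, hρ'.2⟩

variable [Fintype V]

/-- Vertices joined to `x` by a path of length `d` and adjacent to many ends of the members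
of `R`. -/
lemma exists_many_adjacent_ends (Δ : ℕ) (hΔ : ∀ v, #{w | G.Adj v w} ≤ Δ) {d : ℕ} (hd : 1 ≤ d)
    (F : Finset (Fin (d + 2) → V)) (hpath : ∀ ρ ∈ F, IsPath G (d + 1) (seqExt ρ))
    (f g B M A : ℕ) (hf : 0 < f)
    (hpin : ∀ x y m w, 0 < m → m < d + 1 → #{ρ ∈ sameEnds F x y | seqExt ρ m = w} ≤ f)
    (hg : ∀ ρ ∈ F, g ≤ #(sameEnds F (seqExt ρ 0) (seqExt ρ (d + 1))))
    (x : V) (R : Finset (Fin (d + 1) → V)) (hR : R.Nonempty)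
    (hx : ∀ r ∈ R, (Fin.cons x r : Fin (d + 2) → V) ∈ F)
    (htail : ∀ y, #{r ∈ R | seqExt r d = y} ≤ f) (hRΔ : Δ ^ d ≤ A * #R)
    (hbig : (d + 1) * B * f + f * (A * f * M + 1) ≤ g) (W : Finset V) (hW : #W ≤ B) :
    ∃ c ∉ W, PathAvoid G d x c W ∧ M ≤ #{y | G.Adj c y ∧ ∃ r ∈ R, seqExt r d = y} := by
  by_contra! hcon
  set Y : Finset V := R.image fun r => seqExt r d with hY
  have hYne : 0 < #Y := card_pos.2 (hR.image _)
  have hRY : #R ≤ f * #Y := card_le_mul_card_image _ _ fun y _ => htail y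
  -- `P y` consists of the penultimate vertices of the paths from `x` to `y` that avoid `W`. Each `P
  -- y` has more than `A * f * M` elements, all in a set `C` of at most `Δ ^ d ≤ A * f * #Y`
  -- vertices, so double counting puts some `c` in more than `M` of them.
  let P : V → Finset V := fun y => (avoidingEnds F x y W).image fun ρ => seqExt ρ d
  have hPy : ∀ y ∈ Y, A * f * M + 1 ≤ #(P y) := by
    intro y hy
    obtain ⟨r, hr, rfl⟩ := mem_image.1 hy
    have h1 := card_sameEnds_le F x (seqExt r d) f (hpin _ _) W
    have h2 := hg _ (hx r hr)
    rw [seqExt_cons_zero, seqExt_cons_succ] at h2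
    have h3 : (d + 1) * #W * f ≤ (d + 1) * B * f := by gcongr
    have h4 : #(avoidingEnds F x (seqExt r d) W) ≤ f * #(P (seqExt r d)) := by
      refine card_le_mul_card_image _ _ fun c _ => ?_
      refine (card_le_card (filter_subset_filter _ fun ρ hρ =>
        (mem_avoidingEnds.1 hρ).1)).trans (hpin x (seqExt r d) d c hd (by omega))
    have h5 : f * (A * f * M + 1) ≤ f * #(P (seqExt r d)) := by omega
    exact Nat.le_of_mul_le_mul_left h5 hf
  set Pk : Finset (Fin (d + 1) → V) :=
    ({ρ ∈ F | seqExt ρ 0 = x} : Finset _).image fun ρ => ρ ∘ Fin.castSucc with hPk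
  have hinit : ∀ (ρ : Fin (d + 2) → V) m, m ≤ d →
      seqExt (ρ ∘ Fin.castSucc : Fin (d + 1) → V) m = seqExt ρ m := by
    intro ρ m hm
    rw [seqExt_apply _ (show m < d + 1 by omega), seqExt_apply ρ (by omega)]
    rfl
  have hPkpath : ∀ r ∈ Pk, IsPath G d (seqExt r) := by
    intro r hr
    obtain ⟨ρ, hρ, rfl⟩ := mem_image.1 hr
    have h := hpath ρ (mem_filter.1 hρ).1
    refine ⟨fun m hm => ?_, fun m hm m' hm' he => ?_⟩
    · rw [hinit ρ m hm.le, hinit ρ (m + 1) hm]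
      exact h.1 m (by omega)
    · rw [hinit ρ m hm, hinit ρ m' hm'] at he
      exact h.2 m (by omega) m' (by omega) he
  have hPkc : #Pk ≤ Δ ^ d := by
    refine card_path_extending_le Δ hΔ d 0 (Nat.zero_le _) (fun _ => x) Pk hPkpath
      fun r hr j hj => ?_
    obtain ⟨ρ, hρ, rfl⟩ := mem_image.1 hr
    rw [hinit ρ j (by omega), Nat.le_zero.1 hj]
    exact (mem_filter.1 hρ).2
  set C : Finset V := Pk.image fun r => seqExt r d with hC
  have hCc : #C ≤ Δ ^ d := card_image_le.trans hPkc
  have hPC : ∀ y, P y ⊆ C := by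
    intro y c hc
    obtain ⟨ρ, hρ, rfl⟩ := mem_image.1 hc
    have h1 := mem_sameEnds.1 (mem_avoidingEnds.1 hρ).1
    refine mem_image.2 ⟨ρ ∘ Fin.castSucc, mem_image_of_mem _ (mem_filter.2 ⟨h1.1, h1.2.1⟩), ?_⟩
    exact hinit ρ d le_rfl
  have hcount : ∑ y ∈ Y, #(P y) = ∑ c ∈ C, #{y ∈ Y | c ∈ P y} := by
    have : ∀ y, #(P y) = #{c ∈ C | c ∈ P y} := by
      intro y
      rw [filter_mem_eq_inter, inter_eq_right.2 (hPC y)]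
    simp only [this, card_filter]
    exact sum_comm
  have hup : ∀ c ∈ C, #{y ∈ Y | c ∈ P y} ≤ M := by
    intro c _
    rcases ({y ∈ Y | c ∈ P y} : Finset V).eq_empty_or_nonempty with h | ⟨y0, hy0⟩
    · rw [h, card_empty]
      exact Nat.zero_le _
    · have hprop : ∀ y, c ∈ P y → c ∉ W ∧ PathAvoid G d x c W ∧ G.Adj c y := by
        intro y hc
        obtain ⟨ρ, hρ, rfl⟩ := mem_image.1 hc
        rw [mem_avoidingEnds, mem_sameEnds] at hρ
        obtain ⟨⟨hρF, h0, h1⟩, h3⟩ := hρ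
        have hp := hpath ρ hρF
        refine ⟨h3 d hd (by omega), ⟨seqExt ρ, ?_, h0, rfl, fun m h4 h5 => h3 m h4 (by omega)⟩, ?_⟩
        · simpa using hp.sub 0 d (by omega)
        · have := hp.1 d (by omega)
          rwa [h1] at this
      obtain ⟨hc1, hc2, -⟩ := hprop y0 (mem_filter.1 hy0).2
      refine le_trans (card_le_card fun y hy => ?_) (hcon c hc1 hc2).le
      rw [mem_filter] at hy
      obtain ⟨r, hr, hry⟩ := mem_image.1 hy.1
      exact mem_filter.2 ⟨mem_univ _, (hprop y hy.2).2.2, r, hr, hry⟩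
  have h1 : #Y * (A * f * M + 1) ≤ ∑ y ∈ Y, #(P y) := by
    rw [← smul_eq_mul]
    exact card_nsmul_le_sum _ _ _ hPy
  have h2 : ∑ c ∈ C, #{y ∈ Y | c ∈ P y} ≤ #C * M := by
    rw [← smul_eq_mul]
    exact sum_le_card_nsmul _ _ _ hup
  have h3 : #C * M ≤ A * (f * #Y) * M :=
    Nat.mul_le_mul_right _ (hCc.trans (hRΔ.trans (Nat.mul_le_mul_left _ hRY)))
  have h4 : A * (f * #Y) * M = #Y * (A * f * M) := by ring
  rw [hcount] at h1
  rw [mul_add] at h1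
  omega

/-- A dense family of paths from a vertex contains a subfamily in which every path can be
rerouted, after any of its vertices, so as to avoid any bounded set. -/
lemma exists_branching (Δ : ℕ) (hΔ : ∀ v, #{w | G.Adj v w} ≤ Δ) (hΔ0 : 0 < Δ) {d : ℕ}
    (R : Finset (Fin (d + 1) → V)) (hpath : ∀ r ∈ R, IsPath G d (seqExt r)) (u : V)
    (hu : ∀ r ∈ R, seqExt r 0 = u) (hR : R.Nonempty) (A B : ℕ) (hRΔ : Δ ^ d ≤ A * #R)
    (hAB : A * (d * (B + 1)) < Δ) :
    ∃ R' ⊆ R, R'.Nonempty ∧ ∀ r ∈ R', ∀ a ≤ d, ∀ W : Finset V, #W ≤ B → ∃ r' ∈ R',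
      (∀ m ≤ a, seqExt r' m = seqExt r m) ∧ ∀ m, a < m → m ≤ d → seqExt r' m ∉ W := by
  let E : Fin d → Set (Fin (d + 1)) := fun j => {v | (v : ℕ) ≤ j}
  have hE : ∀ j (r r' : Fin (d + 1) → V), (∀ v ∈ E j, r' v = r v) ↔
      ∀ m ≤ (j : ℕ), seqExt r' m = seqExt r m := by
    intro j r r'
    have hj := j.2
    simp only [E, Set.mem_ofPred_eq]
    constructor
    · intro h m hm
      rw [seqExt_apply r (by omega), seqExt_apply r' (by omega)]
      exact h ⟨m, by omega⟩ hm
    · intro h v hv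
      rw [← seqExt_val r v, ← seqExt_val r' v]
      exact h v hv
  -- Fixing one vertex beyond a prefix with `j` edges leaves at most `Δ ^ (d - 1 - j)` paths, so
  -- this threshold yields at least `B + 1` different next vertices. There are at most `Δ ^ j`
  -- prefixes, so the total loss `d * (B + 1) * Δ ^ (d - 1)` is less than `#R`.
  obtain ⟨R', hR', h1, h2⟩ := exists_large_restr_fibers R E fun j => (B + 1) * Δ ^ (d - 1 - j)
  have hcard : ∀ j, restrCard R (E j) ≤ Δ ^ (j : ℕ) := by
    intro j
    have hj := j.2
    have hval : ∀ (r : Fin (d + 1) → V) m, m ≤ (j : ℕ) →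
        seqExt (r ∘ Fin.castLE (by omega) : Fin (j + 1) → V) m = seqExt r m := by
      intro r m hm
      rw [seqExt_apply _ (show m < (j : ℕ) + 1 by omega), seqExt_apply r (by omega)]
      rfl
    refine (restrCard_le R (E j) (Fin.castLE (by omega) : Fin (j + 1) → Fin (d + 1)) ?_
      (R.image fun r => r ∘ Fin.castLE (by omega)) fun r hr => mem_image_of_mem _ hr).trans ?_
    · intro v hv
      exact ⟨⟨v, Nat.lt_succ_of_le hv⟩, rfl⟩
    · refine card_path_extending_le Δ hΔ j 0 (Nat.zero_le _) (fun _ => u) _ ?_ ?_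
      · intro r' hr'
        obtain ⟨r, hr, rfl⟩ := mem_image.1 hr'
        have h := hpath r hr
        refine ⟨fun m hm => ?_, fun m hm m' hm' he => ?_⟩
        · rw [hval r m hm.le, hval r (m + 1) hm]
          exact h.1 m (by omega)
        · rw [hval r m hm, hval r m' hm'] at he
          exact h.2 m (by omega) m' (by omega) he
      · intro r' hr' m hm
        obtain ⟨r, hr, rfl⟩ := mem_image.1 hr'
        rw [hval r m (by omega), Nat.le_zero.1 hm]
        exact hu r hr
  have hsum : ∑ j : Fin d, (B + 1) * Δ ^ (d - 1 - j) * restrCard R (E j)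
      ≤ d * ((B + 1) * Δ ^ (d - 1)) := by
    refine (sum_le_card_nsmul _ _ ((B + 1) * Δ ^ (d - 1)) fun j _ => ?_).trans (by simp)
    have hj := j.2
    rw [mul_assoc]
    refine Nat.mul_le_mul_left _ ?_
    calc Δ ^ (d - 1 - j) * restrCard R (E j) ≤ Δ ^ (d - 1 - j) * Δ ^ (j : ℕ) :=
          Nat.mul_le_mul_left _ (hcard j)
      _ = Δ ^ (d - 1) := by rw [← pow_add, Nat.sub_add_cancel (by omega)]
  have hR'ne : R'.Nonempty := by
    rw [nonempty_iff_ne_empty]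
    rintro rfl
    rw [card_empty, zero_add] at h2
    rcases Nat.eq_zero_or_pos d with rfl | hd
    · have := hR.card_pos
      simp at h2
      simp [h2] at this
    · have h3 : A * #R ≤ A * (d * (B + 1)) * Δ ^ (d - 1) := by
        calc A * #R ≤ A * (d * ((B + 1) * Δ ^ (d - 1))) :=
              Nat.mul_le_mul_left _ (h2.trans hsum)
          _ = _ := by ring
      have h4 : A * (d * (B + 1)) * Δ ^ (d - 1) < Δ * Δ ^ (d - 1) :=
        Nat.mul_lt_mul_of_pos_right hAB (Nat.pow_pos hΔ0)
      rw [← pow_succ', Nat.sub_add_cancel hd] at h4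
      omega
  have hstep : ∀ r ∈ R', ∀ j < d, ∀ W : Finset V, #W ≤ B → ∃ r' ∈ R',
      (∀ m ≤ j, seqExt r' m = seqExt r m) ∧ seqExt r' (j + 1) ∉ W := by
    intro r hr j hj W hW
    by_contra! hcon
    have h3 := h1 ⟨j, hj⟩ r hr
    have h4 : agreeing R' (E ⟨j, hj⟩) r ⊆ W.biUnion fun w =>
        {r' ∈ R' | (∀ m ≤ j, seqExt r' m = seqExt r m) ∧ seqExt r' (j + 1) = w} := by
      intro r' hr'
      rw [mem_agreeing, hE] at hr'
      exact mem_biUnion.2 ⟨_, hcon r' hr'.1 hr'.2, mem_filter.2 ⟨hr'.1, hr'.2, rfl⟩⟩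
    have h5 : #(agreeing R' (E ⟨j, hj⟩) r) ≤ #W * Δ ^ (d - 1 - j) := by
      refine (card_le_card h4).trans (card_biUnion_le.trans ?_)
      rw [← smul_eq_mul]
      refine sum_le_card_nsmul _ _ _ fun w _ => ?_
      rw [show d - 1 - j = d - (j + 1) by omega]
      refine card_path_extending_le Δ hΔ d (j + 1) hj
        (fun m => if m ≤ j then seqExt r m else w) _ (fun ρ hρ => ?_) fun ρ hρ m hm => ?_
      · exact hpath ρ (hR' (mem_filter.1 hρ).1)
      · have h := (mem_filter.1 hρ).2
        by_cases hmj : m ≤ j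
        · simp only [hmj, if_true]
          exact h.1 m hmj
        · simp only [hmj, if_false]
          rw [show m = j + 1 by omega]
          exact h.2
    have h6 : (B + 1) * Δ ^ (d - 1 - j) ≤ #W * Δ ^ (d - 1 - j) := h3.trans h5
    have := Nat.le_of_mul_le_mul_right h6 (Nat.pow_pos hΔ0)
    omega
  refine ⟨R', hR', hR'ne, fun r hr a ha W hW => ?_⟩
  have hind : ∀ n, a + n ≤ d → ∃ r' ∈ R', (∀ m ≤ a, seqExt r' m = seqExt r m) ∧
      ∀ m, a < m → m ≤ a + n → seqExt r' m ∉ W := by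
    intro n
    induction n with
    | zero => exact fun _ => ⟨r, hr, fun _ _ => rfl, fun m h1 h2 => by omega⟩
    | succ n ih =>
      intro hn
      obtain ⟨r1, hr1, h3, h4⟩ := ih (by omega)
      obtain ⟨r2, hr2, h5, h6⟩ := hstep r1 hr1 (a + n) (by omega) W hW
      refine ⟨r2, hr2, fun m hm => ?_, fun m hm hm' => ?_⟩
      · rw [h5 m (by omega), h3 m hm]
      · rcases Nat.lt_or_ge (a + n) m with h | h
        · rw [show m = a + n + 1 by omega]
          exact h6
        · rw [h5 m h]
          exact h4 m hm h
  obtain ⟨r', hr', h3, h4⟩ := hind (d - a) (by omega)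
  exact ⟨r', hr', h3, fun m hm hm' => h4 m hm (by omega)⟩

end Branching

/-! ### From dense heavy paths to robust spiders -/

section PathStep

open scoped Classical

lemma exists_injective_choice {V : Type*} {s : ℕ} (P : Fin s → V → Prop)
    (h : ∀ i, ∀ W : Finset V, #W ≤ s → ∃ z ∉ W, P i z) :
    ∃ z : Fin s → V, Function.Injective z ∧ ∀ i, P i (z i) := by
  suffices h' : ∀ I : Finset (Fin s), ∃ z : Fin s → V, (∀ i ∈ I, P i (z i)) ∧
      ∀ i ∈ I, ∀ j ∈ I, z i = z j → i = j by
    obtain ⟨z, h1, h2⟩ := h' univ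
    exact ⟨z, fun i j hij => h2 i (mem_univ _) j (mem_univ _) hij, fun i => h1 i (mem_univ _)⟩
  intro I
  induction I using Finset.induction_on with
  | empty =>
    by_cases hs : Nonempty (Fin s)
    · obtain ⟨z, -, -⟩ := h hs.some ∅ (by simp)
      exact ⟨fun _ => z, by simp, by simp⟩
    · exact ⟨fun i => (hs ⟨i⟩).elim, by simp, by simp⟩
  | insert a I ha ih =>
    obtain ⟨z, h1, h2⟩ := ih
    obtain ⟨y, hy, hPy⟩ := h a (I.image z)
      (card_image_le.trans ((card_le_univ I).trans (by simp)))
    have hyI : ∀ i ∈ I, z i ≠ y := fun i hi he => hy (he ▸ mem_image_of_mem _ hi)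
    have hne : ∀ i ∈ I, i ≠ a := fun i hi he => ha (he ▸ hi)
    refine ⟨Function.update z a y, fun i hi => ?_, fun i hi j hj hij => ?_⟩
    · rcases mem_insert.1 hi with rfl | hi
      · rwa [Function.update_self]
      · rw [Function.update_of_ne (hne i hi)]
        exact h1 i hi
    · rcases mem_insert.1 hi with hia | hi' <;> rcases mem_insert.1 hj with hja | hj'
      · rw [hia, hja]
      · rw [hia, Function.update_self, Function.update_of_ne (hne j hj')] at hij
        exact absurd hij.symm (hyI j hj')
      · rw [hja, Function.update_self, Function.update_of_ne (hne i hi')] at hij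
        exact absurd hij (hyI i hi')
      · rw [Function.update_of_ne (hne i hi'), Function.update_of_ne (hne j hj')] at hij
        exact h2 i hi' j hj' hij

lemma legLengths_zero {s b k : ℕ} (hs : 0 < s) : legLengths s b k ⟨0, hs⟩ = b := by
  simp [legLengths]

lemma legLengths_of_ne {s b k : ℕ} (hs : 0 < s) {i : Fin s} (hi : i ≠ ⟨0, hs⟩) :
    legLengths s b k i = k := by
  have : (i : ℕ) ≠ 0 := fun h => hi (Fin.ext h)
  simp [legLengths, this]

universe u

/-- If a dense family of paths of length at most `k` has many members between the ends of each of
its members, then there are robust spiders. -/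
theorem spiderAvoid_of_dense_paths (s k b N A f₀ d : ℕ) (hs : 0 < s) (hb : 1 ≤ b) (hbk : b ≤ k)
    (hd : 1 ≤ d) (hdk : d + 1 ≤ k) : ∃ f Δ₀ : ℕ, ∀ (V : Type u) [Fintype V] (G : SimpleGraph V)
    (Δ : ℕ), (∀ v, #{w | G.Adj v w} ≤ Δ) → Δ₀ ≤ Δ → ∀ F₀ : Finset (Fin (d + 2) → V),
    (∀ ρ ∈ F₀, IsPath G (d + 1) (seqExt ρ)) →
    Fintype.card V * Δ ^ (d + 1) ≤ A * #F₀ → 0 < Fintype.card V * Δ ^ (d + 1) →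
    (∀ ρ ∈ F₀, f < #(sameEnds F₀ (seqExt ρ 0) (seqExt ρ (d + 1)))) →
    (∀ x y m w, 0 < m → m < d + 1 → #{ρ ∈ sameEnds F₀ x y | seqExt ρ m = w} ≤ f₀) →
    (∀ x y, ∀ S : Finset (Fin (d + 1) → V), (∀ r ∈ S, ∃ ρ ∈ F₀, r = Fin.tail ρ ∧
      seqExt r 0 = x ∧ seqExt r d = y) → #S ≤ f₀) →
    ∃ z, ∀ W : Finset V, #W ≤ N → SpiderAvoid G (legLengths s b k) z W := by
  set L := legLengths s b k with hL
  -- `B₀` is the budget of `spiderAvoid_of_legs`, and `q` exceeds any set to be avoided when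
  -- choosing from `Q`. `B` adds up to `k` lengthening steps and room for `Q` itself. The `+ 1` in
  -- `f` makes it positive, and `g` satisfies both the avoidance bound and the hub bound.
  set B₀ := N + s + 1 + ∑ i, (L i + 1) with hB₀
  set q := N + s + 1 with hq
  set B := B₀ + k + s + 3 + q with hB
  set A₂ := 2 * (2 * A) * (4 * (2 * A)) ^ q with hA₂
  set f := f₀ + 1 with hf
  set g := (d + 1) * B * f + f * (A₂ * f * (B + 1) + 1) + 1 with hg
  refine ⟨4 * g, 4 * A * (B + 1) + 4 * (2 * A) * (q + 1) + A₂ * (d * (B + 1)) +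
    A₂ * f * (B + 1) + 1,
    ?_⟩
  intro V _ G Δ hΔ hΔ₀ F₀ hpath₀ hdense hpos hheavy hpin htail
  have hΔpos : 0 < Δ := by omega
  obtain ⟨F, hF, hFdense, hFg, hFB⟩ := exists_flexible_paths Δ hΔ (by omega) F₀ hpath₀ A g B hdense
    (fun ρ hρ => (hheavy ρ hρ).le) (by omega) hpos
  have hpath : ∀ ρ ∈ F, IsPath G (d + 1) (seqExt ρ) := fun ρ hρ => hpath₀ ρ (hF hρ)
  have hFpin : ∀ x y m w, 0 < m → m < d + 1 → #{ρ ∈ sameEnds F x y | seqExt ρ m = w} ≤ f := by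
    intro x y m w h1 h2
    refine (card_le_card (filter_subset_filter _ fun ρ hρ => ?_)).trans
      ((hpin x y m w h1 h2).trans (Nat.le_succ _))
    rw [mem_sameEnds] at hρ ⊢
    exact ⟨hF hρ.1, hρ.2⟩
  have hFA := exists_avoiding F f g B hFpin hFg (by omega)
  obtain ⟨u, Q, R, hQ, hRne, hRu, hRQ, hRΔ⟩ := exists_broom Δ hΔ F hpath (2 * A) q hFdense
    (by omega) hpos
  rw [← hA₂] at hRΔ
  have hRpath : ∀ r ∈ R, IsPath G d (seqExt r) := by
    obtain ⟨x, hx⟩ : Q.Nonempty := by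
      rw [← card_pos]
      omega
    intro r hr
    have h := (hpath _ (hRQ r hr x hx)).sub 1 d (by omega)
    simpa only [add_comm 1, seqExt_cons_succ] using h
  have hRtail : ∀ y, #{r ∈ R | seqExt r d = y} ≤ f := by
    obtain ⟨x, hx⟩ : Q.Nonempty := by
      rw [← card_pos]
      omega
    intro y
    refine (htail u y _ fun r hr => ?_).trans (Nat.le_succ _)
    rw [mem_filter] at hr
    exact ⟨Fin.cons x r, hF (hRQ r hr.1 x hx), (Fin.tail_cons (α := fun _ => V) x r).symm,
      hRu r hr.1, hr.2⟩
  -- Each `x` in `Q` followed by a tail in `R` is a member of the cleaned family, so it can be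
  -- lengthened; position `d + 1` on that path is position `d` on the tail.
  have hflex : ∀ x ∈ Q, ∀ r ∈ R, ∀ e, ∀ W : Finset V, #W + e ≤ B →
      PathAvoid G (d + 1 + e) x (seqExt r (d - e % 2)) W := by
    intro x hx r hr e W hW
    have h := pathAvoid_of_flexible (by omega) F hpath B hFA hFB e _ (hRQ r hr x hx) W hW
    rwa [seqExt_cons_zero, show d + 1 - e % 2 = (d - e % 2) + 1 by omega, seqExt_cons_succ] at h
  -- A hub `c` is adjacent to more than `B` ends of `R`. From any `x'` in `Q` one goes to a free
  -- such end with even excess `e - 1` and steps to `c`. So odd excess can also reach a vertex that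
  -- does not depend on a chosen tail.
  have hhub : ∀ x ∈ Q, ∀ W : Finset V, #W ≤ B → ∃ c ∉ W, PathAvoid G d x c W ∧
      ∀ e, e % 2 = 1 → ∀ x' ∈ Q, x' ≠ c → ∀ W' : Finset V, #W' + e ≤ B →
        PathAvoid G (d + 1 + e) x' c W' := by
    intro x hx W hW
    obtain ⟨c, hc, hpc, hM⟩ := exists_many_adjacent_ends Δ hΔ hd F hpath f g B (B + 1) A₂
      (Nat.succ_pos _) hFpin hFg x R hRne (fun r hr => hRQ r hr x hx) hRtail hRΔ
      (by omega) W hW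
    refine ⟨c, hc, hpc, fun e he x' hx' hne W' hW' => ?_⟩
    obtain ⟨y, hy, hyW⟩ := exists_mem_notMem_of_card_lt_card
      (show #W' < #{y | G.Adj c y ∧ ∃ r ∈ R, seqExt r d = y} by omega)
    obtain ⟨hcy, r, hr, rfl⟩ := (mem_filter.1 hy).2
    have h := hflex x' hx' r hr (e - 1) (insert c W') (by
      have := card_insert_le c W'
      omega)
    rw [show (e - 1) % 2 = 0 by omega, Nat.sub_zero] at h
    have h2 := h.append (by omega) hcy.symm hne hyW
    rwa [show d + 1 + (e - 1) + 1 = d + 1 + e by omega] at h2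
  let i₀ : Fin s := ⟨0, hs⟩
  have hL0 : L i₀ = b := legLengths_zero hs
  have hLi : ∀ i, i ≠ i₀ → L i = k := fun i hi => legLengths_of_ne hs hi
  have hLk : ∀ i, L i ≤ k := fun i => by
    by_cases hi : i = i₀
    · rw [hi, hL0]
      exact hbk
    · rw [hLi i hi]
  have himgz : ∀ z : Fin s → V, #(univ.image z) ≤ s := fun z => card_image_le.trans (by simp)
  obtain ⟨zQ, hzQ⟩ : ∃ z : Fin s → V, Function.Injective z ∧ ∀ i, z i ∈ Q :=
    exists_injective_choice (fun _ x => x ∈ Q) fun _ W hW => by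
      obtain ⟨x, hx, hxW⟩ := exists_mem_notMem_of_card_lt_card (show #W < #Q by omega)
      exact ⟨x, hxW, hx⟩
  -- Flexible connections from `Q` have length at least `d + 1`. If `d < b` they can serve as all
  -- legs. Otherwise they serve only as the long legs, whose leaves are then in `Q`, and the leg of
  -- length `b` needs a shorter path.
  rcases Nat.lt_or_ge d b with hdb | hbd
  · -- the centers are taken in `Q`
    have hchoice : ∀ i, ∀ W : Finset V, #W ≤ s → ∃ z ∉ W, ∀ x ∈ Q, ∀ W' : Finset V, #W' ≤ B₀ →
        PathAvoid G (L i) x z W' := by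
      intro i W hW
      have hLi' : d + 1 ≤ L i := by
        by_cases hi : i = i₀
        · rw [hi, hL0]
          exact hdb
        · rw [hLi i hi]
          exact hdk
      have hLik := hLk i
      -- The fixed leaf is an end of a tail for even excess and a hub for odd excess.
      rcases Nat.mod_two_eq_zero_or_one (L i - (d + 1)) with he | he
      · have hY : #W < #(R.image fun r => seqExt r d) := by
          have h1 : #R ≤ f * #(R.image fun r => seqExt r d) :=
            card_le_mul_card_image _ _ fun y _ => hRtail y
          have h2 : Δ ≤ Δ ^ d := Nat.le_self_pow (by omega) _
          by_contra! h3
          have h4 : A₂ * #R ≤ A₂ * f * (B + 1) := by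
            rw [mul_assoc A₂ f]
            refine Nat.mul_le_mul_left _ (h1.trans (Nat.mul_le_mul_left _ (by omega)))
          omega
        obtain ⟨y, hy, hyW⟩ := exists_mem_notMem_of_card_lt_card hY
        obtain ⟨r, hr, rfl⟩ := mem_image.1 hy
        refine ⟨_, hyW, fun x hx W' hW' => ?_⟩
        have h := hflex x hx r hr (L i - (d + 1)) W' (by omega)
        rwa [he, Nat.sub_zero, show d + 1 + (L i - (d + 1)) = L i by omega] at h
      · obtain ⟨c, hc, -, hcf⟩ := hhub _ (hzQ.2 i) (W ∪ Q) (by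
          have := card_union_le W Q
          omega)
        rw [mem_union, not_or] at hc
        refine ⟨c, hc.1, fun x hx W' hW' => ?_⟩
        have h := hcf (L i - (d + 1)) he x hx (fun h => hc.2 (h ▸ hx)) W' (by omega)
        rwa [show d + 1 + (L i - (d + 1)) = L i by omega] at h
    obtain ⟨z, hz, hzP⟩ := exists_injective_choice _ hchoice
    refine ⟨z, fun W hW => ?_⟩
    obtain ⟨x, hx, hxW⟩ := exists_mem_notMem_of_card_lt_card (show #W < #Q by omega)
    refine spiderAvoid_of_legs L z hz W x hxW i₀ (hzP i₀ x hx _ ?_) B₀ (by omega)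
      fun i _ W' hW' => hzP i x hx W' hW'
    have h1 := card_union_le W (univ.image z)
    have h2 := himgz z
    omega
  -- The long legs have excess `e` and reach position `d - e % 2` of a tail. The short leg can run
  -- back along the tail from there if `b ≤ d - e % 2`; as `b ≤ d`, this fails only for `b = d` and
  -- odd `e`, where a hub is the centre.
  set e := k - (d + 1) with he
  rcases Nat.lt_or_ge d (b + e % 2) with hde | hde
  · -- the centers are adjacent to many ends of members of `R`
    have hbd' : b = d := by omega
    have he1 : e % 2 = 1 := by omega
    refine ⟨zQ, fun W hW => ?_⟩
    have h1 := card_union_le W (univ.image zQ)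
    have h2 := himgz zQ
    obtain ⟨c, hc, hpc, hcf⟩ := hhub _ (hzQ.2 i₀) (W ∪ univ.image zQ) (by omega)
    rw [mem_union, not_or] at hc
    refine spiderAvoid_of_legs L zQ hzQ.1 W c hc.1 i₀ ?_ B₀ (by omega) fun i hi W' hW' => ?_
    · rw [hL0, hbd']
      exact hpc.symm
    · have h := hcf e he1 (zQ i) (hzQ.2 i)
        (fun h => hc.2 (h ▸ mem_image_of_mem _ (mem_univ _))) W' (by omega)
      rw [hLi i hi]
      rw [show d + 1 + e = k by omega] at h
      exact h.symm
  · -- the centers lie below a fixed vertex of `R`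
    obtain ⟨R', hR', ⟨r₀, hr₀⟩, hbranch⟩ := exists_branching Δ hΔ hΔpos R hRpath u hRu hRne A₂ B hRΔ
      (by omega)
    set a := d - e % 2 - b with ha
    have hnotQ : ∀ x ∈ Q, seqExt r₀ a ≠ x := by
      intro x hx h
      have h1 := (hpath _ (hRQ r₀ (hR' hr₀) x hx)).2 0 (by omega) (a + 1) (by omega) (by
        rw [seqExt_cons_zero, seqExt_cons_succ, h])
      omega
    set z : Fin s → V := fun i => if i = i₀ then seqExt r₀ a else zQ i with hz
    have hz0 : z i₀ = seqExt r₀ a := if_pos rfl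
    have hzi : ∀ i, i ≠ i₀ → z i = zQ i := fun i hi => if_neg hi
    have hzinj : Function.Injective z := by
      intro i j hij
      by_cases hi : i = i₀ <;> by_cases hj : j = i₀
      · rw [hi, hj]
      · rw [hi, hz0, hzi j hj] at hij
        exact absurd hij (hnotQ _ (hzQ.2 j))
      · rw [hj, hz0, hzi i hi] at hij
        exact absurd hij.symm (hnotQ _ (hzQ.2 i))
      · rw [hzi i hi, hzi j hj] at hij
        exact hzQ.1 hij
    refine ⟨z, fun W hW => ?_⟩
    have h1 := card_union_le W (univ.image z)
    have h2 := himgz z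
    obtain ⟨r, hr, hra, hrW⟩ := hbranch r₀ hr₀ a (by omega) (W ∪ univ.image z) (by omega)
    have hab : a + b = d - e % 2 := by omega
    have hcW := hrW (a + b) (by omega) (by omega)
    rw [mem_union, not_or] at hcW
    refine spiderAvoid_of_legs L z hzinj W (seqExt r (a + b)) hcW.1 i₀ ?_ B₀ (by omega)
      fun i hi W' hW' => ?_
    · rw [hL0, hz0]
      refine PathAvoid.symm ⟨_, (hRpath r (hR' hr)).sub a b (by omega), ?_, rfl, ?_⟩
      · exact hra a le_rfl
      · exact fun m h3 h4 => hrW (a + m) (by omega) (by omega)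
    · rw [hLi i hi, hzi i hi, hab]
      have h := hflex _ (hzQ.2 i) r (hR' hr) e W' (by omega)
      rw [show d + 1 + e = k by omega] at h
      exact h.symm

end PathStep

/-! ### Spider embeddings and their lengthening -/

section SpiderMaps

variable {V : Type*} {G : SimpleGraph V} {s : ℕ}

/-- An embedding of the spider with length vector `ℓ`. -/
def IsSpiderMap (G : SimpleGraph V) (ℓ : Fin s → ℕ) (σ : SpiderVertex ℓ → V) : Prop :=
  Function.Injective σ ∧ ∀ u v, (spider ℓ).Adj u v → G.Adj (σ u) (σ v)

/-- The leaves of a spider, addressed by legs. -/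
def legEnds (ℓ : Fin s → ℕ) : Set (SpiderVertex ℓ) := Set.range fun i => spiderPos ℓ i (ℓ i)

lemma spiderPos_inj {ℓ : Fin s → ℕ} {i j : Fin s} {m m' : ℕ} (hm : m ≤ ℓ i) (hm' : m' ≤ ℓ j)
    (h : spiderPos ℓ i m = spiderPos ℓ j m') : (m = 0 ∧ m' = 0) ∨ (i = j ∧ m = m') := by
  rcases m with _ | m <;> rcases m' with _ | m'
  · exact Or.inl ⟨rfl, rfl⟩
  · rw [spiderPos_zero, spiderPos_succ _ _ _ (by omega)] at h
    simp at h
  · rw [spiderPos_zero, spiderPos_succ _ _ _ (by omega)] at h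
    simp at h
  · rw [spiderPos_succ _ _ _ (by omega), spiderPos_succ _ _ _ (by omega)] at h
    have h1 := Option.some.inj h
    obtain rfl : i = j := congrArg Sigma.fst h1
    have h2 : (⟨m, by omega⟩ : Fin (ℓ i)) = ⟨m', by omega⟩ := by simpa using h1
    have h3 : m = m' := congrArg Fin.val h2
    exact Or.inr ⟨rfl, by omega⟩

lemma spider_adj_spiderPos (ℓ : Fin s → ℕ) (i : Fin s) (m : ℕ) (hm : m < ℓ i) :
    (spider ℓ).Adj (spiderPos ℓ i m) (spiderPos ℓ i (m + 1)) :=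
  spider_adj_iff.2 ⟨i, m, hm, Or.inl ⟨rfl, rfl⟩⟩

lemma spider_preconnected (ℓ : Fin s → ℕ) : (spider ℓ).Preconnected := by
  have h : ∀ v : SpiderVertex ℓ, (spider ℓ).Reachable none v := by
    intro v
    rcases spiderPos_cases v with rfl | ⟨i, m, hm, rfl⟩
    · exact Reachable.refl _
    · have h2 : ∀ m ≤ ℓ i, (spider ℓ).Reachable none (spiderPos ℓ i m) := by
        intro m
        induction m with
        | zero =>
          intro _
          rw [spiderPos_zero]
        | succ m ih =>
          intro hm
          exact (ih (by omega)).trans (spider_adj_spiderPos ℓ i m hm).reachable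
      exact h2 (m + 1) hm
  exact fun u v => (h u).symm.trans (h v)

lemma card_spiderVertex (ℓ : Fin s → ℕ) : Fintype.card (SpiderVertex ℓ) = ∑ i, ℓ i + 1 := by
  rw [Fintype.card_option, Fintype.card_sigma]
  simp

/-- The inclusion of a spider into one with longer legs. -/
def spiderInc (ℓ' ℓ : Fin s → ℕ) : SpiderVertex ℓ' → SpiderVertex ℓ
  | none => none
  | some ⟨i, m⟩ => spiderPos ℓ i (m + 1)

lemma spiderInc_spiderPos (ℓ' ℓ : Fin s → ℕ) (i : Fin s) (m : ℕ) (hm : m ≤ ℓ' i) :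
    spiderInc ℓ' ℓ (spiderPos ℓ' i m) = spiderPos ℓ i m := by
  rcases m with _ | m
  · rw [spiderPos_zero, spiderPos_zero]
    rfl
  · rw [spiderPos_succ _ _ _ (by omega)]
    rfl

lemma spiderInc_adj {ℓ' ℓ : Fin s → ℕ} (h : ∀ i, ℓ' i ≤ ℓ i) (u v : SpiderVertex ℓ')
    (huv : (spider ℓ').Adj u v) : (spider ℓ).Adj (spiderInc ℓ' ℓ u) (spiderInc ℓ' ℓ v) := by
  obtain ⟨i, m, hm, ⟨rfl, rfl⟩ | ⟨rfl, rfl⟩⟩ := spider_adj_iff.1 huv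
  · rw [spiderInc_spiderPos _ _ _ _ hm.le, spiderInc_spiderPos _ _ _ _ hm]
    exact spider_adj_spiderPos ℓ i m (hm.trans_le (h i))
  · rw [spiderInc_spiderPos _ _ _ _ hm.le, spiderInc_spiderPos _ _ _ _ hm]
    exact (spider_adj_spiderPos ℓ i m (hm.trans_le (h i))).symm

lemma spiderInc_injective {ℓ' ℓ : Fin s → ℕ} (h : ∀ i, ℓ' i ≤ ℓ i) :
    Function.Injective (spiderInc ℓ' ℓ) := by
  have hnone : ∀ i m, m < ℓ' i → none ≠ spiderPos ℓ i (m + 1) := by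
    intro i m hm
    rw [spiderPos_succ _ _ _ (hm.trans_le (h i))]
    simp
  intro u v huv
  rcases spiderPos_cases u with rfl | ⟨i, m, hm, rfl⟩ <;>
    rcases spiderPos_cases v with rfl | ⟨j, m', hm', rfl⟩
  · rfl
  · rw [spiderInc_spiderPos _ _ _ _ hm'] at huv
    exact absurd huv (hnone _ _ hm')
  · rw [spiderInc_spiderPos _ _ _ _ hm] at huv
    exact absurd huv.symm (hnone _ _ hm)
  · rw [spiderInc_spiderPos _ _ _ _ hm, spiderInc_spiderPos _ _ _ _ hm'] at huv
    rcases spiderPos_inj (Nat.le_trans hm (h i)) (Nat.le_trans hm' (h j)) huv with h1 | ⟨rfl, h1⟩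
    · omega
    · rw [show m = m' from Nat.succ.inj h1]

lemma IsSpiderMap.comp_inc {ℓ' ℓ : Fin s → ℕ} {σ : SpiderVertex ℓ → V} (h : IsSpiderMap G ℓ σ)
    (hℓ : ∀ i, ℓ' i ≤ ℓ i) : IsSpiderMap G ℓ' (σ ∘ spiderInc ℓ' ℓ) :=
  ⟨h.1.comp (spiderInc_injective hℓ), fun u v huv => h.2 _ _ (spiderInc_adj hℓ u v huv)⟩

lemma IsSpiderMap.isPath {ℓ : Fin s → ℕ} {σ : SpiderVertex ℓ → V} (h : IsSpiderMap G ℓ σ)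
    (i : Fin s) : IsPath G (ℓ i) fun m => σ (spiderPos ℓ i m) := by
  refine ⟨fun m hm => h.2 _ _ (spider_adj_spiderPos ℓ i m hm), fun m hm m' hm' he => ?_⟩
  rcases spiderPos_inj hm hm' (h.1 he) with h1 | h1 <;> omega

lemma IsSpiderMap.spiderAvoid {ℓ : Fin s → ℕ} {σ : SpiderVertex ℓ → V} (h : IsSpiderMap G ℓ σ)
    (W : Finset V) (hW : ∀ i m, m < ℓ i → σ (spiderPos ℓ i m) ∉ W) :
    SpiderAvoid G ℓ (fun i => σ (spiderPos ℓ i (ℓ i))) W := by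
  refine ⟨σ none, fun i m => σ (spiderPos ℓ i m), h.isPath, fun i => ?_, fun i => rfl,
    fun i j m m' hij h1 h2 h3 h4 he => ?_, hW⟩
  · exact congrArg σ (spiderPos_zero ℓ i)
  · rcases spiderPos_inj h3 h4 (h.1 he) with h5 | h5
    · omega
    · exact hij h5.1

/-- Lengthening spiders by moving their leaves to different neighbours of their parents. -/
lemma spiderAvoid_of_flexible {ℓ : Fin s → ℕ} (hℓ : ∀ i, 0 < ℓ i)
    (F : Finset (SpiderVertex ℓ → V)) (hF : ∀ σ ∈ F, IsSpiderMap G ℓ σ) (B : ℕ)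
    (hA : ∀ σ ∈ F, ∀ W : Finset V, #W ≤ B → ∃ σ' ∈ F,
      (∀ i, σ' (spiderPos ℓ i (ℓ i)) = σ (spiderPos ℓ i (ℓ i))) ∧
        ∀ i m, m < ℓ i → σ' (spiderPos ℓ i m) ∉ W)
    (hB : ∀ σ ∈ F, ∀ i, ∀ W : Finset V, #W ≤ B → ∃ σ' ∈ F,
      (∀ v, v ≠ spiderPos ℓ i (ℓ i) → σ' v = σ v) ∧ σ' (spiderPos ℓ i (ℓ i)) ∉ W) (n : ℕ) :
    ∀ e : Fin s → ℕ, ∑ i, e i = n →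
      (∀ i j, i ≠ j → ¬ (ℓ i = 1 ∧ ℓ j = 1 ∧ e i % 2 = 1 ∧ e j % 2 = 1)) →
      ∀ σ ∈ F, ∀ W : Finset V, #W + n + s ≤ B →
        SpiderAvoid G (fun i => ℓ i + e i) (fun i => σ (spiderPos ℓ i (ℓ i - e i % 2))) W := by
  classical
  -- Odd excess ends a leg at the parent of its old leaf. Two such parents coincide only if both
  -- legs have length one and the parent is the centre, the excluded case.
  have hzinj : ∀ e : Fin s → ℕ,
      (∀ i j, i ≠ j → ¬ (ℓ i = 1 ∧ ℓ j = 1 ∧ e i % 2 = 1 ∧ e j % 2 = 1)) → ∀ σ ∈ F, ∀ i j,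
        σ (spiderPos ℓ i (ℓ i - e i % 2)) = σ (spiderPos ℓ j (ℓ j - e j % 2)) → i = j := by
    intro e he σ hσ i j hij
    by_contra hne
    have hi := hℓ i
    have hj := hℓ j
    rcases spiderPos_inj (Nat.sub_le _ _) (Nat.sub_le _ _) ((hF σ hσ).1 hij) with h1 | h1
    · exact he i j hne (by omega)
    · exact hne h1.1
  have hposne : ∀ i j m, j ≠ i → m ≤ ℓ j → spiderPos ℓ j m ≠ spiderPos ℓ i (ℓ i) := by
    intro i j m hij hm h
    have hi := hℓ i
    rcases spiderPos_inj hm le_rfl h with h1 | h1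
    · omega
    · exact hij h1.1
  have hparne : ∀ i, spiderPos ℓ i (ℓ i - 1) ≠ spiderPos ℓ i (ℓ i) := by
    intro i h
    have hi := hℓ i
    rcases spiderPos_inj (Nat.sub_le _ _) le_rfl h with h1 | h1 <;> omega
  have hparadj : ∀ σ ∈ F, ∀ i, G.Adj (σ (spiderPos ℓ i (ℓ i - 1))) (σ (spiderPos ℓ i (ℓ i))) := by
    intro σ hσ i
    have hi := hℓ i
    have h := (hF σ hσ).2 _ _ (spider_adj_spiderPos ℓ i (ℓ i - 1) (by omega))
    rwa [show ℓ i - 1 + 1 = ℓ i by omega] at h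
  induction n with
  | zero =>
    intro e hen _ σ hσ W hW
    have he : ∀ i, e i = 0 := by simpa using hen
    obtain ⟨σ', hσ', h1, h2⟩ := hA σ hσ W (by omega)
    have h3 := (hF σ' hσ').spiderAvoid W h2
    have h4 : (fun i => ℓ i + e i) = ℓ := funext fun i => by rw [he, add_zero]
    have h5 : (fun i => σ (spiderPos ℓ i (ℓ i - e i % 2))) =
        fun i => σ' (spiderPos ℓ i (ℓ i)) := funext fun i => by
      rw [he, Nat.zero_mod, Nat.sub_zero, h1]
    rwa [h4, h5]
  | succ n ih =>
    intro e hen he σ hσ W hW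
    have hlast : ∀ i, 0 < e i → ∑ j, Function.update e i (e i - 1) j = n := by
      intro i hi
      have h1 := sum_update_of_mem (mem_univ i) e (e i - 1)
      have h2 := sum_eq_add_sum_sdiff_singleton_of_mem (mem_univ i) e
      omega
    have hfin : ∀ (i : Fin s) (y : V), 0 < e i → ∀ z : Fin s → V,
        SpiderAvoid G (fun j => ℓ j + Function.update e i (e i - 1) j) z (insert y W) →
        G.Adj (z i) y → z i ∉ W → (∀ j, y ≠ z j) →
        SpiderAvoid G (fun j => ℓ j + e j) (Function.update z i y) W := by
      intro i y hi z h1 h2 h3 h4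
      have h5 := h1.append i h2 h3 h4
      have h6 : Function.update (fun j => ℓ j + Function.update e i (e i - 1) j) i
          (ℓ i + Function.update e i (e i - 1) i + 1) = fun j => ℓ j + e j := by
        funext j
        rcases eq_or_ne j i with rfl | hj
        · rw [Function.update_self, Function.update_self]
          omega
        · rw [Function.update_of_ne hj, Function.update_of_ne hj]
      rwa [h6] at h5
    -- As for paths, one leg at a time. An odd leg moves its leaf and finally steps back to the old
    -- parent; if all excesses are even, the spider is rerouted with its leaves fixed and one leg
    -- ends by an edge from its new parent to its leaf.
    by_cases hodd : ∃ i, e i % 2 = 1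
    · obtain ⟨i, hi⟩ := hodd
      obtain ⟨σ', hσ', h1, h2⟩ := hB σ hσ i
        (W ∪ univ.image fun i => σ (spiderPos ℓ i (ℓ i - e i % 2))) (by
          have h1 := card_union_le W (univ.image fun i => σ (spiderPos ℓ i (ℓ i - e i % 2)))
          have h3 : #(univ.image fun i => σ (spiderPos ℓ i (ℓ i - e i % 2))) ≤ s :=
            card_image_le.trans (by simp)
          omega)
      rw [mem_union, not_or] at h2
      have h3 := ih (Function.update e i (e i - 1)) (hlast i (by omega)) (by
        intro j j' hj hjj
        refine he j j' hj ?_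
        have hkey : ∀ a, Function.update e i (e i - 1) a % 2 = 1 → e a % 2 = 1 := by
          intro a ha
          rcases eq_or_ne a i with rfl | hne
          · exact hi
          · rwa [Function.update_of_ne hne] at ha
        exact ⟨hjj.1, hjj.2.1, hkey _ hjj.2.2.1, hkey _ hjj.2.2.2⟩) σ' hσ'
        (insert (σ (spiderPos ℓ i (ℓ i - 1))) W) (by
          have := card_insert_le (σ (spiderPos ℓ i (ℓ i - 1))) W
          omega)
      have h4 := hfin i _ (by omega) _ h3 (by
        rw [Function.update_self, show (e i - 1) % 2 = 0 by omega, Nat.sub_zero,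
          ← h1 _ (hparne i)]
        exact (hparadj σ' hσ' i).symm) (by
        rw [Function.update_self, show (e i - 1) % 2 = 0 by omega, Nat.sub_zero]
        exact h2.1) (by
        intro j
        rcases eq_or_ne j i with rfl | hj
        · rw [Function.update_self, show (e j - 1) % 2 = 0 by omega, Nat.sub_zero,
            ← h1 _ (hparne j)]
          exact (hparadj σ' hσ' j).ne
        · rw [Function.update_of_ne hj, h1 _ (hposne i j _ hj (Nat.sub_le _ _))]
          intro h
          have := hzinj e he σ hσ i j (by rw [hi, h])
          exact hj this.symm)
      convert h4 using 1
      funext j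
      rcases eq_or_ne j i with rfl | hj
      · rw [Function.update_self, hi]
      · rw [Function.update_of_ne hj, Function.update_of_ne hj,
          h1 _ (hposne i j _ hj (Nat.sub_le _ _))]
    · have heven : ∀ i, e i % 2 = 0 := by
        intro i
        by_contra h
        exact hodd ⟨i, by omega⟩
      obtain ⟨i, hi⟩ : ∃ i, 0 < e i := by
        by_contra! h
        have : ∑ i, e i = 0 := sum_eq_zero fun i _ => Nat.le_zero.1 (h i)
        omega
      have hi2 := heven i
      obtain ⟨σ', hσ', h1, h2⟩ := hA σ hσ W (by omega)
      have hcond : ∀ j j', j ≠ j' → ¬ (ℓ j = 1 ∧ ℓ j' = 1 ∧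
          Function.update e i (e i - 1) j % 2 = 1 ∧
          Function.update e i (e i - 1) j' % 2 = 1) := by
        intro j j' hj hjj
        have hkey : ∀ a, Function.update e i (e i - 1) a % 2 = 1 → a = i := by
          intro a ha
          by_contra hne
          rw [Function.update_of_ne hne, heven a] at ha
          omega
        exact hj ((hkey _ hjj.2.2.1).trans (hkey _ hjj.2.2.2).symm)
      have h3 := ih (Function.update e i (e i - 1)) (hlast i hi) hcond σ' hσ'
        (insert (σ (spiderPos ℓ i (ℓ i))) W) (by
          have := card_insert_le (σ (spiderPos ℓ i (ℓ i))) W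
          omega)
      have hℓi := hℓ i
      have h4 := hfin i _ (by omega) _ h3 (by
        rw [Function.update_self, show (e i - 1) % 2 = 1 by omega, ← h1]
        exact hparadj σ' hσ' i) (by
        rw [Function.update_self, show (e i - 1) % 2 = 1 by omega]
        exact h2 i _ (by omega)) (by
        intro j
        rw [← h1]
        rcases eq_or_ne j i with rfl | hj
        · rw [Function.update_self, show (e j - 1) % 2 = 1 by omega]
          exact (hparadj σ' hσ' j).ne'
        · rw [Function.update_of_ne hj, heven, Nat.sub_zero]
          intro h
          exact hposne i j _ hj le_rfl ((hF σ' hσ').1 h).symm)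
      convert h4 using 1
      funext j
      rcases eq_or_ne j i with rfl | hj
      · rw [Function.update_self, heven, Nat.sub_zero]
      · rw [Function.update_of_ne hj, Function.update_of_ne hj, heven, Nat.sub_zero, h1]

end SpiderMaps

/-! ### From dense heavy spiders to robust longer spiders -/

section SpiderStep

open scoped Classical

universe u

lemma spiderPos_notMem_legEnds {s : ℕ} {ℓ : Fin s → ℕ} (hℓ : ∀ i, 0 < ℓ i) {i : Fin s} {m : ℕ}
    (hm : m < ℓ i) : spiderPos ℓ i m ∉ legEnds ℓ := by
  rintro ⟨j, h⟩
  have hj := hℓ j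
  rcases spiderPos_inj le_rfl hm.le h with h1 | ⟨rfl, h1⟩ <;> omega

/-- If a dense family of spiders has many members with the leaves of each of its members, then
there are robust longer spiders. -/
theorem spiderAvoid_of_dense_spiders {s : ℕ} (hs : 0 < s) (N A f₀ : ℕ) (ℓ L : Fin s → ℕ)
    (hℓ : ∀ i, 0 < ℓ i) (hℓL : ∀ i, ℓ i ≤ L i)
    (hcond : ∀ i j, i ≠ j →
      ¬ (ℓ i = 1 ∧ ℓ j = 1 ∧ (L i - ℓ i) % 2 = 1 ∧ (L j - ℓ j) % 2 = 1)) :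
    ∃ f Δ₀ : ℕ, ∀ (V : Type u) [Fintype V] (G : SimpleGraph V)
    (Δ : ℕ), (∀ v, #{w | G.Adj v w} ≤ Δ) → Δ₀ ≤ Δ → ∀ F₀ : Finset (SpiderVertex ℓ → V),
    (∀ σ ∈ F₀, IsSpiderMap G ℓ σ) →
    Fintype.card V * Δ ^ (∑ i, ℓ i) ≤ A * #F₀ → 0 < Fintype.card V * Δ ^ (∑ i, ℓ i) →
    (∀ σ ∈ F₀, f < #(agreeing F₀ (legEnds ℓ) σ)) →
    (∀ σ ∈ F₀, ∀ v ∉ legEnds ℓ, ∀ w, #{τ ∈ agreeing F₀ (legEnds ℓ) σ | τ v = w} ≤ f₀) →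
    ∃ z, ∀ W : Finset V, #W ≤ N → SpiderAvoid G L z W := by
  set n := ∑ i, (L i - ℓ i) with hn
  set B := N + n + s with hB
  set g := (∑ i, ℓ i + 1) * B * f₀ + 1 with hg
  refine ⟨2 * g, 2 * A * (s * (B + 1)) + 1, ?_⟩
  intro V _ G Δ hΔ hΔ₀ F₀ hF₀ hdense hpos hheavy hpin
  have hn0 : 0 < Fintype.card V := Nat.pos_of_mul_pos_right hpos
  have hΔpos : 0 < Δ := by omega
  have hsum : 0 < ∑ i, ℓ i := sum_pos (fun i _ => hℓ i) ⟨⟨0, hs⟩, mem_univ _⟩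
  let E : Option (Fin s) → Set (SpiderVertex ℓ) := fun r =>
    match r with
    | none => legEnds ℓ
    | some i => {v | v ≠ spiderPos ℓ i (ℓ i)}
  -- Large fibres over the leaves allow rerouting, and large fibres over everything but the leaf `i`
  -- allow moving that leaf. The former cost at most half of `F₀`; the latter have at most
  -- `Fintype.card V * Δ ^ (∑ i, ℓ i - 1)` restrictions per leg, negligible for large `Δ`.
  obtain ⟨F, hF, h1, h2⟩ := exists_large_restr_fibers F₀ E fun r =>
    match r with
    | none => g
    | some _ => B + 1
  have himg1 : 2 * g * restrCard F₀ (legEnds ℓ) ≤ #F₀ :=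
    mul_restrCard_le F₀ _ _ fun σ hσ => (hheavy σ hσ).le
  have himg2 : ∀ i, restrCard F₀ (E (some i)) ≤ Fintype.card V * Δ ^ (∑ i, ℓ i - 1) := by
    intro i
    set ℓ' : Fin s → ℕ := Function.update ℓ i (ℓ i - 1) with hℓ'
    have hle : ∀ j, ℓ' j ≤ ℓ j := by
      intro j
      rcases eq_or_ne j i with rfl | hj
      · rw [hℓ', Function.update_self]
        omega
      · rw [hℓ', Function.update_of_ne hj]
    have hcard : Fintype.card (SpiderVertex ℓ') - 1 = ∑ i, ℓ i - 1 := by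
      rw [card_spiderVertex, Nat.add_sub_cancel]
      have h1 := sum_update_of_mem (mem_univ i) ℓ (ℓ i - 1)
      have h2 := sum_eq_add_sum_sdiff_singleton_of_mem (mem_univ i) ℓ
      have h3 := hℓ i
      rw [hℓ']
      omega
    have h := card_le_of_hom (spider ℓ') (spider_preconnected ℓ') G Δ hΔ
      (F₀.image fun σ => σ ∘ spiderInc ℓ' ℓ) fun a ha => by
        obtain ⟨σ, hσ, rfl⟩ := mem_image.1 ha
        exact ((hF₀ σ hσ).comp_inc hle).2
    rw [hcard] at h
    refine (restrCard_le F₀ _ (spiderInc ℓ' ℓ) (fun v hv => ?_) _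
      fun σ hσ => mem_image_of_mem _ hσ).trans h
    have hv' : v ≠ spiderPos ℓ i (ℓ i) := hv
    rcases spiderPos_cases v with rfl | ⟨j, m, hm, rfl⟩
    · exact ⟨none, rfl⟩
    · refine ⟨spiderPos ℓ' j (m + 1), spiderInc_spiderPos _ _ _ _ ?_⟩
      rcases eq_or_ne j i with rfl | hj
      · rw [hℓ', Function.update_self]
        rcases Nat.lt_or_ge (m + 1) (ℓ j) with h | h
        · omega
        · exact absurd (by rw [show m + 1 = ℓ j by omega]) hv'
      · rw [hℓ', Function.update_of_ne hj]
        exact hm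
  have hFne : F.Nonempty := by
    rw [nonempty_iff_ne_empty]
    rintro rfl
    rw [card_empty, zero_add, Fintype.sum_option] at h2
    have h3 : ∑ i : Fin s, (B + 1) * restrCard F₀ (E (some i)) ≤
        s * ((B + 1) * (Fintype.card V * Δ ^ (∑ i, ℓ i - 1))) :=
      (sum_le_card_nsmul _ _ _ fun i _ => Nat.mul_le_mul_left _ (himg2 i)).trans (by simp)
    have h4 : #F₀ ≤ 2 * (s * ((B + 1) * (Fintype.card V * Δ ^ (∑ i, ℓ i - 1)))) := by
      have h5 : #F₀ ≤ g * restrCard F₀ (legEnds ℓ) +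
          ∑ i : Fin s, (B + 1) * restrCard F₀ (E (some i)) := h2
      rw [mul_assoc] at himg1
      omega
    have h5 : Fintype.card V * Δ ^ (∑ i, ℓ i) =
        Δ * (Fintype.card V * Δ ^ (∑ i, ℓ i - 1)) := by
      rw [mul_left_comm, ← pow_succ', Nat.sub_add_cancel hsum]
    have h6 : Δ * (Fintype.card V * Δ ^ (∑ i, ℓ i - 1)) ≤
        2 * A * (s * (B + 1)) * (Fintype.card V * Δ ^ (∑ i, ℓ i - 1)) := by
      rw [← h5]
      refine hdense.trans ((Nat.mul_le_mul_left A h4).trans_eq ?_)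
      ring
    have h7 := Nat.le_of_mul_le_mul_right h6 (Nat.mul_pos hn0 (Nat.pow_pos hΔpos))
    omega
  have hFmap : ∀ σ ∈ F, IsSpiderMap G ℓ σ := fun σ hσ => hF₀ σ (hF hσ)
  have hFA : ∀ σ ∈ F, ∀ W : Finset V, #W ≤ B → ∃ σ' ∈ F,
      (∀ i, σ' (spiderPos ℓ i (ℓ i)) = σ (spiderPos ℓ i (ℓ i))) ∧
        ∀ i m, m < ℓ i → σ' (spiderPos ℓ i m) ∉ W := by
    intro σ hσ W hW
    by_contra! hcon
    have h3 : g ≤ #(agreeing F (legEnds ℓ) σ) := h1 none σ hσ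
    have h4 := card_le_of_exists_pinned (agreeing F (legEnds ℓ) σ)
      ({v | v ∉ legEnds ℓ} : Finset (SpiderVertex ℓ)) W (fun v τ => τ v) f₀ (fun τ hτ => by
        rw [mem_agreeing] at hτ
        obtain ⟨i, m, hm, hmW⟩ := hcon τ hτ.1 fun i => hτ.2 _ ⟨i, rfl⟩
        exact ⟨_, mem_filter.2 ⟨mem_univ _, spiderPos_notMem_legEnds hℓ hm⟩, hmW⟩)
      fun v hv w _ => (card_le_card (filter_subset_filter _ (agreeing_mono hF _ _))).trans
        (hpin σ (hF hσ) v (mem_filter.1 hv).2 w)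
    have h5 : #({v | v ∉ legEnds ℓ} : Finset (SpiderVertex ℓ)) ≤ ∑ i, ℓ i + 1 := by
      rw [← card_spiderVertex]
      exact card_le_univ _
    have h6 : #({v | v ∉ legEnds ℓ} : Finset (SpiderVertex ℓ)) * #W * f₀ ≤
        (∑ i, ℓ i + 1) * B * f₀ := by gcongr
    omega
  have hFB : ∀ σ ∈ F, ∀ i, ∀ W : Finset V, #W ≤ B → ∃ σ' ∈ F,
      (∀ v, v ≠ spiderPos ℓ i (ℓ i) → σ' v = σ v) ∧ σ' (spiderPos ℓ i (ℓ i)) ∉ W := by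
    intro σ hσ i W hW
    by_contra! hcon
    have h3 : B + 1 ≤ #(agreeing F (E (some i)) σ) := h1 (some i) σ hσ
    have h4 : #(agreeing F (E (some i)) σ) ≤ #W := by
      refine card_le_card_of_injOn (fun τ => τ (spiderPos ℓ i (ℓ i))) (fun τ hτ => ?_) ?_
      · rw [mem_coe, mem_agreeing] at hτ
        exact hcon τ hτ.1 hτ.2
      · intro a ha b hb hab
        rw [mem_coe, mem_agreeing] at ha hb
        funext v
        by_cases hv : v = spiderPos ℓ i (ℓ i)
        · rw [hv]
          exact hab
        · rw [ha.2 v hv, hb.2 v hv]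
    omega
  obtain ⟨σ, hσ⟩ := hFne
  refine ⟨fun i => σ (spiderPos ℓ i (ℓ i - (L i - ℓ i) % 2)), fun W hW => ?_⟩
  have h := spiderAvoid_of_flexible hℓ F hFmap B hFA hFB n (fun i => L i - ℓ i) hn.symm hcond
    σ hσ W (by omega)
  have hL : (fun i => ℓ i + (L i - ℓ i)) = L := funext fun i => Nat.add_sub_cancel' (hℓL i)
  rwa [hL] at h

end SpiderStep

/-! ### Discarding the embeddings with heavy truncations -/

section Rounds

open scoped Classical

variable {V : Type*} {G : SimpleGraph V} {ι κ : Type*}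

/-- The family of the functions `a ∘ w` with `a ∈ D`. -/
noncomputable def trunc (D : Finset (ι → V)) (w : κ → ι) : Finset (κ → V) :=
  D.image fun a => a ∘ w

lemma mem_trunc {D : Finset (ι → V)} {w : κ → ι} {ρ : κ → V} :
    ρ ∈ trunc D w ↔ ∃ a ∈ D, a ∘ w = ρ := by
  rw [trunc, mem_image]

lemma trunc_mono {D D' : Finset (ι → V)} (h : D' ⊆ D) (w : κ → ι) : trunc D' w ⊆ trunc D w :=
  image_subset_image h

/-- The members of `F` whose fibre over `E` has more than `f` elements. -/
noncomputable def heavy (F : Finset (κ → V)) (E : Set κ) (f : ℕ) : Finset (κ → V) :=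
  {ρ ∈ F | f < #(agreeing F E ρ)}

lemma mem_heavy {F : Finset (κ → V)} {E : Set κ} {f : ℕ} {ρ : κ → V} :
    ρ ∈ heavy F E f ↔ ρ ∈ F ∧ f < #(agreeing F E ρ) := by
  rw [heavy, mem_filter]

lemma heavy_subset (F : Finset (κ → V)) (E : Set κ) (f : ℕ) : heavy F E f ⊆ F :=
  filter_subset _ _

/-- Heaviness depends only on the restriction to `E`, so the whole fibre of a heavy member survives
in `heavy F E f`. -/
lemma lt_card_agreeing_heavy {F : Finset (κ → V)} {E : Set κ} {f : ℕ} {ρ : κ → V}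
    (hρ : ρ ∈ heavy F E f) : f < #(agreeing (heavy F E f) E ρ) := by
  rw [mem_heavy] at hρ
  refine hρ.2.trans_le (card_le_card fun ρ' hρ' => ?_)
  rw [mem_agreeing] at hρ'
  rw [mem_agreeing, mem_heavy]
  refine ⟨⟨hρ'.1, ?_⟩, hρ'.2⟩
  have : agreeing F E ρ' = agreeing F E ρ := by
    ext τ
    rw [mem_agreeing, mem_agreeing]
    exact and_congr_right fun _ => forall₂_congr fun v hv => by rw [hρ'.2 v hv]
  rw [this]
  exact hρ.2

/-- By connectedness, a prescribed truncation extends in at most `Δ ^ (Fintype.card ι - Fintype.card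
κ)` ways. A sparse set of bad truncations thus spoils only a small proportion of the embeddings. -/
lemma card_filter_comp_mem_le [Fintype V] [Fintype ι] [Fintype κ] [Nonempty κ]
    (T : SimpleGraph ι) (hT : T.Preconnected)
    (Δ : ℕ) (hΔ : ∀ v, #{w | G.Adj v w} ≤ Δ) (D : Finset (ι → V))
    (hD : ∀ a ∈ D, ∀ u v, T.Adj u v → G.Adj (a u) (a v)) (w : κ → ι)
    (hw : Function.Injective w) (B : Finset (κ → V)) (D' : Finset (ι → V)) (hD' : D' ⊆ D)
    (hB : ∀ a ∈ D', a ∘ w ∈ B) :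
    #D' ≤ #B * Δ ^ (Fintype.card ι - Fintype.card κ) := by
  have hsub : D' ⊆ B.biUnion fun ρ => {a ∈ D | a ∘ w = ρ} := fun a ha =>
    mem_biUnion.2 ⟨_, hB a ha, mem_filter.2 ⟨hD' ha, rfl⟩⟩
  refine (card_le_card hsub).trans (card_biUnion_le.trans ?_)
  rw [← smul_eq_mul]
  refine sum_le_card_nsmul _ _ _ fun ρ _ => ?_
  rcases ({a ∈ D | a ∘ w = ρ} : Finset (ι → V)).eq_empty_or_nonempty with h | ⟨a₀, ha₀⟩
  · rw [h, card_empty]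
    exact Nat.zero_le _
  · have h := card_le_of_hom_extending T hT G Δ hΔ (univ.image w) (univ_nonempty.image _) a₀
      {a ∈ D | a ∘ w = ρ} (fun a ha => hD a (mem_filter.1 ha).1) fun a ha v hv => by
        obtain ⟨j, -, rfl⟩ := mem_image.1 hv
        exact congrFun ((mem_filter.1 ha).2.trans (mem_filter.1 ha₀).2.symm) j
    rwa [card_image_of_injective _ hw, card_univ] at h

/-- If the heavy fibres of finitely many truncations are sparse, a large subfamily has only light
fibres. -/
lemma exists_light_subfamily [Fintype V] [Fintype ι]
    (T : SimpleGraph ι) (hT : T.Preconnected) (Δ : ℕ) (hΔ : ∀ v, #{w | G.Adj v w} ≤ Δ)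
    (D : Finset (ι → V)) (hD : ∀ a ∈ D, ∀ u v, T.Adj u v → G.Adj (a u) (a v))
    {X : Type*} [Fintype X] (κ : X → Type*) [∀ x, Fintype (κ x)] [∀ x, Nonempty (κ x)]
    (w : ∀ x, κ x → ι) (hw : ∀ x, Function.Injective (w x)) (E : ∀ x, Set (κ x)) (f : X → ℕ)
    (A : ℕ) (hsparse : ∀ x, A * #(heavy (trunc D (w x)) (E x) (f x)) ≤
      Fintype.card V * Δ ^ (Fintype.card (κ x) - 1)) :
    ∃ D' ⊆ D, A * #D ≤ A * #D' + Fintype.card X * (Fintype.card V * Δ ^ (Fintype.card ι - 1)) ∧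
      ∀ x, FiberLe (trunc D' (w x)) (E x) (f x) := by
  let H : ∀ x, Finset (κ x → V) := fun x => heavy (trunc D (w x)) (E x) (f x)
  have hrem : ∀ x, A * #{a ∈ D | a ∘ w x ∈ H x} ≤
      Fintype.card V * Δ ^ (Fintype.card ι - 1) := by
    intro x
    have h1 := card_filter_comp_mem_le T hT Δ hΔ D hD (w x) (hw x) (H x)
      {a ∈ D | a ∘ w x ∈ H x} (filter_subset _ _) fun a ha => (mem_filter.1 ha).2
    have h2 : 0 < Fintype.card (κ x) := Fintype.card_pos
    have h3 : Fintype.card (κ x) ≤ Fintype.card ι := Fintype.card_le_of_injective _ (hw x)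
    calc A * #{a ∈ D | a ∘ w x ∈ H x}
        ≤ A * (#(H x) * Δ ^ (Fintype.card ι - Fintype.card (κ x))) := Nat.mul_le_mul_left _ h1
      _ = A * #(H x) * Δ ^ (Fintype.card ι - Fintype.card (κ x)) := by ring
      _ ≤ Fintype.card V * Δ ^ (Fintype.card (κ x) - 1) *
          Δ ^ (Fintype.card ι - Fintype.card (κ x)) := Nat.mul_le_mul_right _ (hsparse x)
      _ = _ := by
        rw [mul_assoc, ← pow_add]
        congr 2
        omega
  refine ⟨D \ univ.biUnion fun x => {a ∈ D | a ∘ w x ∈ H x}, sdiff_subset, ?_, fun x ρ hρ => ?_⟩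
  · have h1 : #D ≤ #(D \ univ.biUnion fun x => {a ∈ D | a ∘ w x ∈ H x}) +
        #(univ.biUnion fun x => {a ∈ D | a ∘ w x ∈ H x}) := by
      rw [card_sdiff_add_card]
      exact card_le_card subset_union_left
    have h2 : #(univ.biUnion fun x => {a ∈ D | a ∘ w x ∈ H x}) ≤
        ∑ x, #{a ∈ D | a ∘ w x ∈ H x} := card_biUnion_le
    have h3 : A * ∑ x, #{a ∈ D | a ∘ w x ∈ H x} ≤
        Fintype.card X * (Fintype.card V * Δ ^ (Fintype.card ι - 1)) := by
      rw [mul_sum]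
      exact (sum_le_card_nsmul _ _ _ fun x _ => hrem x).trans (by simp)
    have h4 := Nat.mul_le_mul_left A (h1.trans (Nat.add_le_add_left h2 _))
    rw [mul_add] at h4
    omega
  · obtain ⟨a, ha, rfl⟩ := mem_trunc.1 hρ
    rw [mem_sdiff] at ha
    have h1 : a ∘ w x ∉ H x := fun h =>
      ha.2 (mem_biUnion.2 ⟨x, mem_univ _, mem_filter.2 ⟨ha.1, h⟩⟩)
    rw [mem_heavy, not_and, not_lt] at h1
    exact (card_le_card (agreeing_mono (trunc_mono sdiff_subset _) _ _)).trans
      (h1 (mem_trunc.2 ⟨a, ha.1, rfl⟩))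

end Rounds

/-! ### Counting spider embeddings -/

section Embeddings

open scoped Classical

variable {V : Type*} {G : SimpleGraph V} {s : ℕ}

/-- Extending an embedding by a new leaf. -/
lemma isSpiderMap_extend {ℓ : Fin s → ℕ} (i : Fin s) (τ : SpiderVertex ℓ → V)
    (hτ : IsSpiderMap G ℓ τ) (y : V) (hy : G.Adj (τ (spiderPos ℓ i (ℓ i))) y)
    (hyτ : ∀ v, τ v ≠ y) :
    ∃ σ : SpiderVertex (Function.update ℓ i (ℓ i + 1)) → V,
      IsSpiderMap G (Function.update ℓ i (ℓ i + 1)) σ ∧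
      σ ∘ spiderInc ℓ (Function.update ℓ i (ℓ i + 1)) = τ ∧
      σ (spiderPos (Function.update ℓ i (ℓ i + 1)) i (ℓ i + 1)) = y := by
  set ℓ' := Function.update ℓ i (ℓ i + 1) with hℓ'
  have hi : ℓ' i = ℓ i + 1 := Function.update_self _ _ _
  have hj : ∀ j, j ≠ i → ℓ' j = ℓ j := fun j hj => Function.update_of_ne hj _ _
  have hle : ∀ j, ℓ j ≤ ℓ' j := fun j => by
    rcases eq_or_ne j i with rfl | h
    · omega
    · rw [hj j h]
  let σ : SpiderVertex ℓ' → V := fun v =>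
    if v = spiderPos ℓ' i (ℓ i + 1) then y else τ (spiderInc ℓ' ℓ v)
  have hσy : σ (spiderPos ℓ' i (ℓ i + 1)) = y := if_pos rfl
  have hσ : ∀ j m, m ≤ ℓ j → σ (spiderPos ℓ' j m) = τ (spiderPos ℓ j m) := by
    intro j m hm
    have hne : spiderPos ℓ' j m ≠ spiderPos ℓ' i (ℓ i + 1) := by
      intro h
      rcases spiderPos_inj (hm.trans (hle j)) hi.ge h with h1 | ⟨rfl, h1⟩ <;> omega
    simp only [σ, if_neg hne]
    rw [spiderInc_spiderPos ℓ' ℓ j m (hm.trans (hle j))]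
  have hcases : ∀ v : SpiderVertex ℓ', v = spiderPos ℓ' i (ℓ i + 1) ∨
      ∃ j m, m ≤ ℓ j ∧ v = spiderPos ℓ' j m := by
    intro v
    rcases spiderPos_cases v with rfl | ⟨j, m, hm, rfl⟩
    · exact Or.inr ⟨i, 0, Nat.zero_le _, (spiderPos_zero _ _).symm⟩
    · rcases eq_or_ne j i with rfl | h
      · rcases Nat.lt_or_ge m (ℓ j) with h | h
        · exact Or.inr ⟨j, m + 1, h, rfl⟩
        · left
          rw [show m = ℓ j by omega]
      · rw [hj j h] at hm
        exact Or.inr ⟨j, m + 1, hm, rfl⟩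
  refine ⟨σ, ⟨?_, ?_⟩, ?_, hσy⟩
  · intro u v huv
    rcases hcases u with rfl | ⟨j, m, hm, rfl⟩ <;> rcases hcases v with rfl | ⟨j', m', hm', rfl⟩
    · rfl
    · rw [hσy, hσ _ _ hm'] at huv
      exact absurd huv.symm (hyτ _)
    · rw [hσy, hσ _ _ hm] at huv
      exact absurd huv (hyτ _)
    · rw [hσ _ _ hm, hσ _ _ hm'] at huv
      rcases spiderPos_inj hm hm' (hτ.1 huv) with ⟨rfl, rfl⟩ | ⟨rfl, rfl⟩
      · rw [spiderPos_zero, spiderPos_zero]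
      · rfl
  · have key : ∀ j m, m < ℓ' j → G.Adj (σ (spiderPos ℓ' j m)) (σ (spiderPos ℓ' j (m + 1))) := by
      intro j m hm
      by_cases h : m + 1 ≤ ℓ j
      · rw [hσ j m (by omega), hσ j _ h]
        exact hτ.2 _ _ (spider_adj_spiderPos ℓ j m h)
      · obtain rfl : j = i := by
          by_contra hne
          rw [hj j hne] at hm
          omega
        obtain rfl : m = ℓ j := by omega
        rw [hσy, hσ _ _ le_rfl]
        exact hy
    intro u v huv
    obtain ⟨j, m, hm, ⟨rfl, rfl⟩ | ⟨rfl, rfl⟩⟩ := spider_adj_iff.1 huv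
    · exact key j m hm
    · exact (key j m hm).symm
  · funext v
    rcases spiderPos_cases v with rfl | ⟨j, m, hm, rfl⟩
    · have := hσ i 0 (Nat.zero_le _)
      rwa [spiderPos_zero, spiderPos_zero] at this
    · rw [Function.comp_apply, spiderInc_spiderPos _ _ _ _ hm, hσ j _ hm]

variable [Fintype V]

/-- The set of embeddings of a spider. -/
noncomputable def spiderMaps (G : SimpleGraph V) (ℓ : Fin s → ℕ) : Finset (SpiderVertex ℓ → V) :=
  {σ | IsSpiderMap G ℓ σ}

lemma mem_spiderMaps {ℓ : Fin s → ℕ} {σ : SpiderVertex ℓ → V} :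
    σ ∈ spiderMaps G ℓ ↔ IsSpiderMap G ℓ σ := by
  rw [spiderMaps, mem_filter]
  exact and_iff_right (mem_univ _)

/-- A lower bound for the number of embeddings of a spider in a graph of large minimum degree. -/
lemma le_card_spiderMaps (δ c : ℕ) (hδ : ∀ v, δ ≤ #{w | G.Adj v w}) (n : ℕ) :
    ∀ ℓ : Fin s → ℕ, ∑ i, ℓ i = n → n ≤ c →
      Fintype.card V * (δ - c) ^ n ≤ #(spiderMaps G ℓ) := by
  induction n with
  | zero =>
    intro ℓ hℓ _
    have h0 : ∀ i, ℓ i = 0 := by simpa using hℓ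
    have hnone : ∀ v : SpiderVertex ℓ, v = none := by
      intro v
      rcases spiderPos_cases v with h | ⟨i, m, hm, -⟩
      · exact h
      · have := h0 i
        omega
    rw [pow_zero, mul_one, ← card_univ]
    refine card_le_card_of_injOn (fun x _ => x) (fun x _ => ?_) fun x _ y _ hxy => ?_
    · rw [mem_coe, mem_spiderMaps]
      refine ⟨fun u v _ => (hnone u).trans (hnone v).symm, fun u v huv => ?_⟩
      exact absurd ((hnone u).trans (hnone v).symm) huv.ne
    · exact congrFun hxy none
  | succ n ih =>
    intro ℓ' hℓ' hn
    obtain ⟨i, hi⟩ : ∃ i, 0 < ℓ' i := by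
      by_contra! h
      have : ∑ i, ℓ' i = 0 := sum_eq_zero fun i _ => Nat.le_zero.1 (h i)
      omega
    obtain ⟨ℓ, rfl⟩ : ∃ ℓ : Fin s → ℕ, ℓ' = Function.update ℓ i (ℓ i + 1) := by
      refine ⟨Function.update ℓ' i (ℓ' i - 1), ?_⟩
      rw [Function.update_self, Function.update_idem, Nat.sub_add_cancel hi,
        Function.update_eq_self]
    have hsum : ∑ j, ℓ j = n := by
      have h1 := sum_update_of_mem (mem_univ i) ℓ (ℓ i + 1)
      have h2 := sum_eq_add_sum_sdiff_singleton_of_mem (mem_univ i) ℓ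
      omega
    have h1 := ih ℓ hsum (by omega)
    set ℓ' := Function.update ℓ i (ℓ i + 1) with hℓ'def
    have hmaps : ∀ σ ∈ spiderMaps G ℓ', σ ∘ spiderInc ℓ ℓ' ∈ spiderMaps G ℓ := by
      intro σ hσ
      rw [mem_spiderMaps] at hσ ⊢
      refine hσ.comp_inc fun j => ?_
      rcases eq_or_ne j i with rfl | h
      · rw [hℓ'def, Function.update_self]
        omega
      · rw [hℓ'def, Function.update_of_ne h]
    have hfib : ∀ τ ∈ spiderMaps G ℓ,
        δ - c ≤ #{σ ∈ spiderMaps G ℓ' | σ ∘ spiderInc ℓ ℓ' = τ} := by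
      intro τ hτ
      rw [mem_spiderMaps] at hτ
      set S : Finset V := ({w | G.Adj (τ (spiderPos ℓ i (ℓ i))) w} : Finset V) \
        (univ.erase (spiderPos ℓ i (ℓ i))).image τ with hS
      have hScard : δ - c ≤ #S := by
        have h2 := le_card_sdiff ((univ.erase (spiderPos ℓ i (ℓ i))).image τ)
          ({w | G.Adj (τ (spiderPos ℓ i (ℓ i))) w} : Finset V)
        have h3 := hδ (τ (spiderPos ℓ i (ℓ i)))
        have h4 : #((univ.erase (spiderPos ℓ i (ℓ i))).image τ) ≤ n := by
          refine card_image_le.trans ?_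
          rw [card_erase_of_mem (mem_univ _), card_univ, card_spiderVertex, hsum]
          exact le_of_eq (Nat.add_sub_cancel _ _)
        rw [← hS] at h2
        omega
      have hex : ∀ y ∈ S, ∃ σ : SpiderVertex ℓ' → V, IsSpiderMap G ℓ' σ ∧
          σ ∘ spiderInc ℓ ℓ' = τ ∧ σ (spiderPos ℓ' i (ℓ i + 1)) = y := by
        intro y hy
        rw [hS, mem_sdiff, mem_filter] at hy
        refine isSpiderMap_extend i τ hτ y hy.1.2 fun v hv => ?_
        by_cases h : v = spiderPos ℓ i (ℓ i)
        · rw [h] at hv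
          exact hy.1.2.ne hv
        · exact hy.2 (mem_image.2 ⟨v, mem_erase.2 ⟨h, mem_univ _⟩, hv⟩)
      choose! g hg1 hg2 hg3 using hex
      refine hScard.trans (card_le_card_of_injOn g (fun y hy => ?_) fun y hy y' hy' h => ?_)
      · rw [mem_coe, mem_filter, mem_spiderMaps]
        exact ⟨hg1 y hy, hg2 y hy⟩
      · rw [← hg3 y hy, h, hg3 y' hy']
    have h2 : #(spiderMaps G ℓ) * (δ - c) ≤ #(spiderMaps G ℓ') := by
      rw [card_eq_sum_card_fiberwise hmaps, ← smul_eq_mul]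
      exact card_nsmul_le_sum _ _ _ hfib
    calc Fintype.card V * (δ - c) ^ (n + 1) = Fintype.card V * (δ - c) ^ n * (δ - c) := by ring
      _ ≤ #(spiderMaps G ℓ) * (δ - c) := Nat.mul_le_mul_right _ h1
      _ ≤ _ := h2

end Embeddings

/-! ### Properties attainable at the cost of few embeddings -/

section Attainable

open scoped Classical

universe u

variable {s : ℕ}

/-- No tuple of leaves is joined by spiders avoiding every set of at most `N` vertices. -/
def NoSpider {V : Type*} (G : SimpleGraph V) (L : Fin s → ℕ) (N : ℕ) : Prop :=
  ¬ ∃ z, ∀ W : Finset V, #W ≤ N → SpiderAvoid G L z W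

/-- In graphs of large maximum degree without robustly connected leaves, each family of embeddings
of the spider has a subfamily with property `P` that omits only a small proportion. -/
def Attainable (L : Fin s → ℕ) (N : ℕ)
    (P : ℕ → ∀ V : Type u, Finset (SpiderVertex L → V) → Prop) : Prop :=
  -- The order matters: `r` must not depend on `A`, because `A` is finally chosen large in terms of
  -- `r`; `f` and `Δ₀` may depend on `A`.
  ∃ r, ∀ A, ∃ f Δ₀, ∀ (V : Type u) [Fintype V] [Nonempty V] (G : SimpleGraph V) (Δ : ℕ),
    (∀ v, #{w | G.Adj v w} ≤ Δ) → Δ₀ ≤ Δ → 0 < Δ → NoSpider G L N →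
    ∀ D : Finset (SpiderVertex L → V), (∀ σ ∈ D, IsSpiderMap G L σ) →
      ∃ D' ⊆ D, A * #D ≤ A * #D' + r * (Fintype.card V * Δ ^ ∑ i, L i) ∧ P f V D'

variable {L : Fin s → ℕ} {N : ℕ} {P Q : ℕ → ∀ V : Type u, Finset (SpiderVertex L → V) → Prop}

lemma Attainable.imp (h : Attainable L N P) (g : ℕ → ℕ)
    (hPQ : ∀ f V D, P f V D → Q (g f) V D) : Attainable L N Q := by
  obtain ⟨r, h⟩ := h
  refine ⟨r, fun A => ?_⟩
  obtain ⟨f, Δ₀, h⟩ := h A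
  refine ⟨g f, Δ₀, fun V _ _ G Δ h1 h2 h3 h4 D hD => ?_⟩
  obtain ⟨D', h5, h6, h7⟩ := h V G Δ h1 h2 h3 h4 D hD
  exact ⟨D', h5, h6, hPQ _ _ _ h7⟩

lemma attainable_of_forall (f : ℕ) (hP : ∀ V D, P f V D) : Attainable L N P :=
  ⟨0, fun _ => ⟨f, 0, fun V _ _ _ _ _ _ _ _ D _ =>
    ⟨D, Subset.rfl, by rw [zero_mul, add_zero], hP V D⟩⟩⟩

/-- Passing to light fibres of finitely many truncations. -/
lemma Attainable.and_fiberLe (h : Attainable L N P)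
    (hmono : ∀ f f' V D D', f ≤ f' → D' ⊆ D → P f V D → P f' V D')
    {X : Type} [Fintype X] (κ : X → Type) [∀ x, Fintype (κ x)] [∀ x, Nonempty (κ x)]
    (w : ∀ x, κ x → SpiderVertex L) (hw : ∀ x, Function.Injective (w x))
    (E : ∀ x, Set (κ x))
    (hstep : ∀ A f x, ∃ f' Δ₀, ∀ (V : Type u) [Fintype V] [Nonempty V] (G : SimpleGraph V)
      (Δ : ℕ), (∀ v, #{w | G.Adj v w} ≤ Δ) → Δ₀ ≤ Δ → 0 < Δ → NoSpider G L N →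
      ∀ D : Finset (SpiderVertex L → V), (∀ σ ∈ D, IsSpiderMap G L σ) → P f V D →
        A * #(heavy (trunc D (w x)) (E x) f') ≤
          Fintype.card V * Δ ^ (Fintype.card (κ x) - 1)) :
    Attainable L N fun f V D => P f V D ∧ ∀ x, FiberLe (trunc D (w x)) (E x) f := by
  obtain ⟨r, h⟩ := h
  refine ⟨r + Fintype.card X, fun A => ?_⟩
  obtain ⟨f, Δ₀, h⟩ := h A
  choose f' Δ₀' hstep using hstep A f
  refine ⟨f + ∑ x, f' x, Δ₀ + ∑ x, Δ₀' x, fun V _ _ G Δ h1 h2 h3 h4 D hD => ?_⟩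
  obtain ⟨D₁, hD₁, hcard, hP⟩ := h V G Δ h1 (by omega) h3 h4 D hD
  have hle : ∀ x, Δ₀' x ≤ Δ := fun x => by
    have := single_le_sum (fun x _ => Nat.zero_le (Δ₀' x)) (mem_univ x)
    omega
  obtain ⟨D₂, hD₂, hcard', hF⟩ := exists_light_subfamily (spider L) (spider_preconnected L) Δ h1
    D₁ (fun a ha => (hD a (hD₁ ha)).2) κ w hw E f' A fun x =>
      hstep x V G Δ h1 (hle x) h3 h4 D₁ (fun σ hσ => hD σ (hD₁ hσ)) hP
  rw [card_spiderVertex, Nat.add_sub_cancel] at hcard'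
  refine ⟨D₂, hD₂.trans hD₁, ?_, hmono _ _ _ _ _ (Nat.le_add_right _ _) hD₂ hP,
    fun x => (hF x).mono Subset.rfl ?_⟩
  · rw [add_mul]
    omega
  · have := single_le_sum (fun x _ => Nat.zero_le (f' x)) (mem_univ x)
    omega

end Attainable

/-! ### Light fibres for the subpaths of the legs -/

section Windows

open scoped Classical

universe u

variable {s : ℕ} {V : Type*}

/-- The window of length `m` at position `a` of the `i`-th leg. -/
def window (L : Fin s → ℕ) (i : Fin s) (a m : ℕ) : Fin (m + 1) → SpiderVertex L :=
  fun j => spiderPos L i (a + j)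

lemma window_injective {L : Fin s → ℕ} {i : Fin s} {a m : ℕ} (h : a + m ≤ L i) :
    Function.Injective (window L i a m) := by
  intro j j' hj
  have h1 := j.2
  have h2 := j'.2
  rcases spiderPos_inj (by omega) (by omega) hj with h3 | h3 <;> exact Fin.ext (by omega)

lemma isPath_window {G : SimpleGraph V} {L : Fin s → ℕ} {σ : SpiderVertex L → V}
    (h : IsSpiderMap G L σ) {i : Fin s} {a m : ℕ} (ha : a + m ≤ L i) :
    IsPath G m (seqExt (σ ∘ window L i a m)) := by
  have h1 := (h.isPath i).sub a m ha
  have h2 : ∀ j ≤ m, seqExt (σ ∘ window L i a m) j = σ (spiderPos L i (a + j)) := fun j hj => by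
    rw [seqExt_apply _ (Nat.lt_succ_of_le hj)]
    rfl
  refine ⟨fun j hj => ?_, fun j hj j' hj' he => ?_⟩
  · rw [h2 j hj.le, h2 (j + 1) hj]
    exact h1.1 j hj
  · rw [h2 j hj, h2 j' hj'] at he
    exact h1.2 j hj j' hj' he

/-- The windows of length at most `d` have light fibres over their ends. -/
def WindowBdd (L : Fin s → ℕ) (d f : ℕ) (V : Type*) (D : Finset (SpiderVertex L → V)) : Prop :=
  ∀ i a m, m ≤ d → a + m ≤ L i → FiberLe (trunc D (window L i a m)) {0, Fin.last m} f

lemma WindowBdd.mono {L : Fin s → ℕ} {d f f' : ℕ} {D D' : Finset (SpiderVertex L → V)}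
    (h : WindowBdd L d f V D) (hf : f ≤ f') (hD : D' ⊆ D) : WindowBdd L d f' V D' :=
  fun i a m hm ha => (h i a m hm ha).mono (trunc_mono hD _) hf

lemma sameEnds_eq_agreeing {l : ℕ} (F : Finset (Fin (l + 1) → V)) (ρ : Fin (l + 1) → V) :
    sameEnds F (seqExt ρ 0) (seqExt ρ l) = agreeing F {0, Fin.last l} ρ := by
  ext τ
  rw [mem_sameEnds, mem_agreeing]
  have h0 : ∀ ρ : Fin (l + 1) → V, seqExt ρ 0 = ρ 0 := fun ρ => seqExt_apply ρ (Nat.succ_pos l)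
  have hl : ∀ ρ : Fin (l + 1) → V, seqExt ρ l = ρ (Fin.last l) := fun ρ =>
    seqExt_apply ρ (Nat.lt_succ_self l)
  rw [h0, h0, hl, hl]
  simp

/-- A path through `w` at position `m` is determined by its parts before and after `w`, each of
which has prescribed ends. -/
lemma card_sameEnds_filter_le {l m : ℕ} (hm : m ≤ l) (F : Finset (Fin (l + 1) → V))
    (F₁ : Finset (Fin (m + 1) → V)) (F₂ : Finset (Fin (l - m + 1) → V)) (f₁ f₂ : ℕ)
    (h₁ : FiberLe F₁ {0, Fin.last m} f₁) (h₂ : FiberLe F₂ {0, Fin.last (l - m)} f₂)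
    (hF₁ : ∀ ρ ∈ F, (fun j : Fin (m + 1) => seqExt ρ j) ∈ F₁)
    (hF₂ : ∀ ρ ∈ F, (fun j : Fin (l - m + 1) => seqExt ρ (m + j)) ∈ F₂) (x y w : V) :
    #{ρ ∈ sameEnds F x y | seqExt ρ m = w} ≤ f₁ * f₂ := by
  rcases ({ρ ∈ sameEnds F x y | seqExt ρ m = w} : Finset _).eq_empty_or_nonempty with
    h | ⟨ρ₀, hρ₀⟩
  · rw [h, card_empty]
    exact Nat.zero_le _
  · have hmem : ∀ ρ, ρ ∈ ({ρ ∈ sameEnds F x y | seqExt ρ m = w} : Finset _) ↔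
        (ρ ∈ F ∧ seqExt ρ 0 = x ∧ seqExt ρ l = y) ∧ seqExt ρ m = w := fun ρ => by
      rw [mem_filter, mem_sameEnds]
    rw [hmem] at hρ₀
    refine le_trans ?_ (Nat.mul_le_mul (h₁ _ (hF₁ ρ₀ hρ₀.1.1)) (h₂ _ (hF₂ ρ₀ hρ₀.1.1)))
    rw [← card_product]
    refine card_le_card_of_injOn (fun ρ => (fun j : Fin (m + 1) => seqExt ρ j,
      fun j : Fin (l - m + 1) => seqExt ρ (m + j))) (fun ρ hρ => ?_) fun ρ hρ ρ' hρ' he => ?_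
    · rw [mem_coe, hmem] at hρ
      rw [mem_coe, mem_product, mem_agreeing, mem_agreeing]
      refine ⟨⟨hF₁ ρ hρ.1.1, fun v hv => ?_⟩, hF₂ ρ hρ.1.1, fun v hv => ?_⟩
      · rcases hv with rfl | hv
        · exact hρ.1.2.1.trans hρ₀.1.2.1.symm
        · rw [Set.mem_singleton_iff.1 hv]
          exact hρ.2.trans hρ₀.2.symm
      · rcases hv with rfl | hv
        · exact hρ.2.trans hρ₀.2.symm
        · rw [Set.mem_singleton_iff.1 hv]
          have := hρ.1.2.2.trans hρ₀.1.2.2.symm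
          simpa [Nat.add_sub_cancel' hm] using this
    · rw [Prod.mk.injEq] at he
      funext j
      have hj := j.2
      rw [← seqExt_val ρ j, ← seqExt_val ρ' j]
      rcases Nat.lt_or_ge (j : ℕ) (m + 1) with h | h
      · exact congrFun he.1 ⟨j, h⟩
      · have := congrFun he.2 ⟨j - m, by omega⟩
        simpa [show m + (j - m : ℕ) = j by omega] using this

/-- A dense set of heavy windows of length `d + 1` would give robust spiders by
`spiderAvoid_of_dense_paths`. Its hypotheses come from shorter windows: cutting at a pinned vertex
gives `f * f`, and the tails with given ends are windows of length `d`, at most `f` of them. -/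
lemma exists_window_step {L : Fin s → ℕ} (b k N d : ℕ) (hL : legLengths s b k = L)
    (hs : 0 < s) (hb : 1 ≤ b) (hbk : b ≤ k) (hd : 1 ≤ d)
    (hdk : d + 1 ≤ k) (A f : ℕ) (i : Fin s) (a : ℕ) (ha : a + (d + 1) ≤ L i) :
    ∃ f' Δ₀, ∀ (V : Type u) [Fintype V] [Nonempty V] (G : SimpleGraph V)
      (Δ : ℕ), (∀ v, #{w | G.Adj v w} ≤ Δ) → Δ₀ ≤ Δ → 0 < Δ →
      NoSpider G L N →
      ∀ D : Finset (SpiderVertex L → V),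
        (∀ σ ∈ D, IsSpiderMap G L σ) →
        WindowBdd L d f V D →
        A * #(heavy (trunc D (window L i a (d + 1))) {0, Fin.last (d + 1)} f') ≤
          Fintype.card V * Δ ^ (Fintype.card (Fin (d + 1 + 1)) - 1) := by
  obtain ⟨f', Δ₀, h⟩ := spiderAvoid_of_dense_paths s k b N A (f * f + f) d hs hb hbk hd hdk
  simp only [hL] at h
  refine ⟨f', Δ₀, fun V _ _ G Δ h1 h2 h3 h4 D hD hwin => ?_⟩
  rw [Fintype.card_fin, Nat.add_sub_cancel]
  by_contra! hdense
  set B := heavy (trunc D (window L i a (d + 1))) {0, Fin.last (d + 1)} f' with hB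
  have hmem : ∀ ρ ∈ B, ∃ σ ∈ D, σ ∘ window L i a (d + 1) = ρ := fun ρ hρ =>
    mem_trunc.1 (heavy_subset _ _ _ hρ)
  have hseq : ∀ (σ : SpiderVertex L → V) j, j < d + 2 →
      seqExt (σ ∘ window L i a (d + 1)) j = σ (spiderPos L i (a + j)) := fun σ j hj => by
    rw [seqExt_apply _ hj]
    rfl
  have hsub : ∀ c m, c + m ≤ d + 1 → ∀ ρ ∈ B,
      (fun j : Fin (m + 1) => seqExt ρ (c + j)) ∈ trunc D (window L i (a + c) m) := by
    intro c m hcm ρ hρ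
    obtain ⟨σ, hσ, rfl⟩ := hmem ρ hρ
    refine mem_trunc.2 ⟨σ, hσ, ?_⟩
    funext j
    have hj := j.2
    rw [hseq σ _ (by omega), ← add_assoc]
    rfl
  refine h4 (h V G Δ h1 h2 B (fun ρ hρ => ?_) hdense.le
    (Nat.mul_pos Fintype.card_pos (Nat.pow_pos h3)) (fun ρ hρ => ?_) (fun x y m w hm hmd => ?_)
    fun x y S hS => ?_)
  · obtain ⟨σ, hσ, rfl⟩ := hmem ρ hρ
    exact isPath_window (hD σ hσ) ha
  · rw [sameEnds_eq_agreeing]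
    exact lt_card_agreeing_heavy hρ
  · refine (card_sameEnds_filter_le hmd.le B _ _ f f (hwin i a m (by omega) (by omega))
      (hwin i (a + m) (d + 1 - m) (by omega) (by omega)) (fun ρ hρ => ?_)
      (hsub m (d + 1 - m) (by omega)) x y w).trans (Nat.le_add_right _ _)
    simpa using hsub 0 m (by omega) ρ hρ
  · rcases S.eq_empty_or_nonempty with rfl | ⟨r₀, hr₀⟩
    · simp
    · have htail : ∀ r ∈ S, r ∈ trunc D (window L i (a + 1) d) := by
        intro r hr
        obtain ⟨ρ, hρ, rfl, -⟩ := hS r hr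
        convert hsub 1 d (by omega) ρ hρ using 1
        funext j
        have hj := j.2
        rw [seqExt_apply ρ (show 1 + (j : ℕ) < d + 1 + 1 by omega), Fin.tail]
        congr 1
        exact Fin.ext (by rw [Fin.val_succ, add_comm])
      refine le_trans (card_le_card fun r hr => ?_)
        ((hwin i (a + 1) d le_rfl (by omega) r₀ (htail r₀ hr₀)).trans (Nat.le_add_left _ _))
      rw [← sameEnds_eq_agreeing, mem_sameEnds]
      obtain ⟨-, -, -, h5, h6⟩ := hS r hr
      obtain ⟨-, -, -, h7, h8⟩ := hS r₀ hr₀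
      exact ⟨htail r hr, h5.trans h7.symm, h6.trans h8.symm⟩

/-- Induction on the length; windows of length at most one are determined by their ends. -/
lemma attainable_windowBdd (b k N : ℕ) (hs : 0 < s) (hb : 1 ≤ b) (hbk : b ≤ k) (d : ℕ) (hd : 1 ≤ d)
    (hdk : d ≤ k) : Attainable.{u} (legLengths s b k) N (WindowBdd (legLengths s b k) d) := by
  induction d, hd using Nat.le_induction with
  | base =>
    refine attainable_of_forall 1 fun V D i a m hm ha ρ _ => ?_
    refine card_le_one.2 fun τ hτ τ' hτ' => ?_
    rw [mem_agreeing] at hτ hτ'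
    funext j
    have hj : j = 0 ∨ j = Fin.last m := by
      have := j.2
      rw [Fin.ext_iff, Fin.ext_iff, Fin.val_last, Fin.val_zero]
      omega
    exact (hτ.2 j hj).trans (hτ'.2 j hj).symm
  | succ d hd ih =>
    have hlen : ∀ i, legLengths s b k i ≤ k := fun i => by
      rw [legLengths]
      split_ifs <;> omega
    refine ((ih (by omega)).and_fiberLe (fun f f' V D D' h1 h2 h3 => h3.mono h1 h2)
      (X := {p : Fin s × Fin (k + 1) // (p.2 : ℕ) + (d + 1) ≤ legLengths s b k p.1})
      (fun _ => Fin (d + 1 + 1)) (fun p => window _ p.1.1 p.1.2 (d + 1))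
      (fun p => window_injective p.2) (fun _ => {0, Fin.last (d + 1)})
      fun A f p => exists_window_step b k N d rfl hs hb hbk hd hdk A f p.1.1 p.1.2 p.2).imp id
      fun f V D h i a m hm ha => ?_
    rcases hm.lt_or_eq with h1 | rfl
    · exact h.1 i a m (Nat.lt_succ_iff.1 h1) ha
    · have h2 := hlen i
      exact h.2 ⟨(i, ⟨a, by omega⟩), ha⟩

end Windows

/-! ### Light fibres for the paths of length two through the centre -/

section Cross

open scoped Classical

universe u

variable {s : ℕ} {V : Type*}

/-- The path of length two through the centre of a spider into two of its legs. -/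
def cross (L : Fin s → ℕ) (i j : Fin s) : Fin 3 → SpiderVertex L :=
  ![spiderPos L i 1, spiderPos L i 0, spiderPos L j 1]

lemma cross_injective {L : Fin s → ℕ} (hL : ∀ i, 0 < L i) {i j : Fin s} (hij : i ≠ j) :
    Function.Injective (cross L i j) := by
  have hi := hL i
  have hj := hL j
  have h01 : spiderPos L i 1 ≠ spiderPos L i 0 := fun h => by
    rcases spiderPos_inj hi (Nat.zero_le _) h with h | h <;> omega
  have h02 : spiderPos L i 1 ≠ spiderPos L j 1 := fun h => by
    rcases spiderPos_inj hi hj h with h | h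
    · omega
    · exact hij h.1
  have h12 : spiderPos L i 0 ≠ spiderPos L j 1 := fun h => by
    rcases spiderPos_inj (Nat.zero_le _) hj h with h | h <;> omega
  intro a b hab
  fin_cases a <;> fin_cases b <;> simp_all [cross]

lemma isPath_cross {G : SimpleGraph V} {L : Fin s → ℕ} (hL : ∀ i, 0 < L i)
    {σ : SpiderVertex L → V} (h : IsSpiderMap G L σ) {i j : Fin s} (hij : i ≠ j) :
    IsPath G 2 (seqExt (σ ∘ cross L i j)) := by
  refine ⟨fun m hm => ?_, fun m hm m' hm' he => ?_⟩
  · rw [seqExt_apply _ (show m < 2 + 1 by omega), seqExt_apply _ (show m + 1 < 2 + 1 by omega)]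
    have h1 := h.2 _ _ (spider_adj_spiderPos L i 0 (hL i))
    have h2 := h.2 _ _ (spider_adj_spiderPos L j 0 (hL j))
    rw [spiderPos_zero] at h1 h2
    interval_cases m
    · simpa [cross, spiderPos_zero] using h1.symm
    · simpa [cross, spiderPos_zero] using h2
  · rw [seqExt_apply _ (Nat.lt_succ_of_le hm), seqExt_apply _ (Nat.lt_succ_of_le hm')] at he
    exact congrArg Fin.val (cross_injective hL hij (h.1 he))

/-- The central paths of length two have light fibres over their ends. -/
def CrossBdd (L : Fin s → ℕ) (f : ℕ) (V : Type*) (D : Finset (SpiderVertex L → V)) : Prop :=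
  ∀ i j, i ≠ j → FiberLe (trunc D (cross L i j)) {0, Fin.last 2} f

lemma CrossBdd.mono {L : Fin s → ℕ} {f f' : ℕ} {D D' : Finset (SpiderVertex L → V)}
    (h : CrossBdd L f V D) (hf : f ≤ f') (hD : D' ⊆ D) : CrossBdd L f' V D' :=
  fun i j hij => (h i j hij).mono (trunc_mono hD _) hf

/-- The case of paths of length two in `spiderAvoid_of_dense_paths`. The pinning hypotheses hold
with bound `1`, since such a path is determined by its three vertices and its tail by two. -/
lemma exists_cross_step {L : Fin s → ℕ} (b k N : ℕ) (hL : legLengths s b k = L) (hs : 0 < s)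
    (hb : 1 ≤ b) (hbk : b ≤ k) (hk : 2 ≤ k) (hpos : ∀ i, 0 < L i) (A : ℕ) (i j : Fin s)
    (hij : i ≠ j) :
    ∃ f' Δ₀, ∀ (V : Type u) [Fintype V] [Nonempty V] (G : SimpleGraph V)
      (Δ : ℕ), (∀ v, #{w | G.Adj v w} ≤ Δ) → Δ₀ ≤ Δ → 0 < Δ → NoSpider G L N →
      ∀ D : Finset (SpiderVertex L → V), (∀ σ ∈ D, IsSpiderMap G L σ) →
        A * #(heavy (trunc D (cross L i j)) {0, Fin.last 2} f') ≤
          Fintype.card V * Δ ^ (Fintype.card (Fin 3) - 1) := by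
  obtain ⟨f', Δ₀, h⟩ := spiderAvoid_of_dense_paths s k b N A 1 1 hs hb hbk le_rfl hk
  simp only [hL] at h
  refine ⟨f', Δ₀, fun V _ _ G Δ h1 h2 h3 h4 D hD => ?_⟩
  rw [Fintype.card_fin]
  by_contra! hdense
  set B := heavy (trunc D (cross L i j)) {0, Fin.last 2} f' with hB
  refine h4 (h V G Δ h1 h2 B (fun ρ hρ => ?_) hdense.le
    (Nat.mul_pos Fintype.card_pos (Nat.pow_pos h3)) (fun ρ hρ => ?_) (fun x y m w hm hmd => ?_)
    fun x y S hS => ?_)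
  · obtain ⟨σ, hσ, rfl⟩ := mem_trunc.1 (heavy_subset _ _ _ hρ)
    exact isPath_cross hpos (hD σ hσ) hij
  · exact (sameEnds_eq_agreeing B ρ).symm ▸ lt_card_agreeing_heavy hρ
  · refine card_le_one.2 fun ρ hρ ρ' hρ' => ?_
    rw [mem_filter, mem_sameEnds] at hρ hρ'
    funext c
    have hc : (c : ℕ) = 0 ∨ (c : ℕ) = m ∨ (c : ℕ) = 2 := by
      have := c.2
      omega
    rw [← seqExt_val (l := 2) ρ c, ← seqExt_val (l := 2) ρ' c]
    rcases hc with hc | hc | hc <;> rw [hc]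
    · exact hρ.1.2.1.trans hρ'.1.2.1.symm
    · exact hρ.2.trans hρ'.2.symm
    · exact hρ.1.2.2.trans hρ'.1.2.2.symm
  · refine card_le_one.2 fun r hr r' hr' => ?_
    obtain ⟨-, -, -, h5, h6⟩ := hS r hr
    obtain ⟨-, -, -, h7, h8⟩ := hS r' hr'
    funext c
    have hc : (c : ℕ) = 0 ∨ (c : ℕ) = 1 := by
      have := c.2
      omega
    rw [← seqExt_val (l := 1) r c, ← seqExt_val (l := 1) r' c]
    rcases hc with hc | hc <;> rw [hc]
    · exact h5.trans h7.symm
    · exact h6.trans h8.symm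

/-- The restriction to `2 ≤ k` is what the path step needs for length two. For `k = 1` no leg has
any excess, and crosses are not needed later. -/
lemma attainable_crossBdd (b k N : ℕ) (hs : 0 < s) (hb : 1 ≤ b) (hbk : b ≤ k) :
    Attainable.{u} (legLengths s b k) N fun f V D =>
      WindowBdd (legLengths s b k) k f V D ∧ (2 ≤ k → CrossBdd (legLengths s b k) f V D) := by
  have h := attainable_windowBdd.{u} b k N hs hb hbk k (hb.trans hbk) le_rfl
  by_cases hk : 2 ≤ k
  · have hpos : ∀ i, 0 < legLengths s b k i := fun i => by
      rw [legLengths]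
      split_ifs <;> omega
    exact (h.and_fiberLe (fun f f' V D D' h1 h2 h3 => h3.mono h1 h2)
      (X := {p : Fin s × Fin s // p.1 ≠ p.2})
      (fun _ => Fin 3) (fun p => cross _ p.1.1 p.1.2)
      (fun p => cross_injective hpos p.2) (fun _ => {0, Fin.last 2})
      fun A f p => by
        obtain ⟨f', Δ₀, h⟩ := exists_cross_step b k N rfl hs hb hbk hk hpos A p.1.1 p.1.2 p.2
        exact ⟨f', Δ₀, fun V _ _ G Δ h1 h2 h3 h4 D hD _ => h V G Δ h1 h2 h3 h4 D hD⟩).imp id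
      fun f V D h => ⟨h.1, fun _ i j hij => h.2 ⟨(i, j), hij⟩⟩
  · exact h.imp id fun f V D h => ⟨h, fun h' => absurd h' hk⟩

end Cross

/-! ### Light fibres for subspiders, by induction on the number of edges -/

section SubSpiders

open scoped Classical

universe u

variable {s : ℕ} {V : Type*}

/-- The subspiders with at most `n` edges have light fibres over their leaves. -/
def SubSpiderBdd (L : Fin s → ℕ) (n f : ℕ) (V : Type*) (D : Finset (SpiderVertex L → V)) : Prop :=
  ∀ ℓ : Fin s → ℕ, (∀ i, 0 < ℓ i) → (∀ i, ℓ i ≤ L i) → ∑ i, ℓ i ≤ n →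
    FiberLe (trunc D (spiderInc ℓ L)) (legEnds ℓ) f

lemma SubSpiderBdd.mono {L : Fin s → ℕ} {n f f' : ℕ} {D D' : Finset (SpiderVertex L → V)}
    (h : SubSpiderBdd L n f V D) (hf : f ≤ f') (hD : D' ⊆ D) : SubSpiderBdd L n f' V D' :=
  fun ℓ h1 h2 h3 => (h ℓ h1 h2 h3).mono (trunc_mono hD _) hf

/-- The spiders with prescribed centre and leaves. -/
lemma card_pinned_center_le {L ℓ : Fin s → ℕ} {k f : ℕ} {D : Finset (SpiderVertex L → V)}
    (hwin : WindowBdd L k f V D) (hLk : ∀ i, L i ≤ k) (hℓL : ∀ i, ℓ i ≤ L i)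
    (F : Finset (SpiderVertex ℓ → V)) (hF : F ⊆ trunc D (spiderInc ℓ L))
    (σ : SpiderVertex ℓ → V) (w : V) :
    #{τ ∈ agreeing F (legEnds ℓ) σ | τ none = w} ≤ f ^ s := by
  rcases ({τ ∈ agreeing F (legEnds ℓ) σ | τ none = w} : Finset _).eq_empty_or_nonempty with
    h | ⟨τ₀, hτ₀⟩
  · rw [h, card_empty]
    exact Nat.zero_le _
  · have hmem : ∀ τ, τ ∈ ({τ ∈ agreeing F (legEnds ℓ) σ | τ none = w} : Finset _) ↔
        (τ ∈ F ∧ ∀ v ∈ legEnds ℓ, τ v = σ v) ∧ τ none = w := fun τ => by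
      rw [mem_filter, mem_agreeing]
    rw [hmem] at hτ₀
    have hsub : ∀ τ ∈ F, ∀ i, τ ∘ window ℓ i 0 (ℓ i) ∈ trunc D (window L i 0 (ℓ i)) := by
      intro τ hτ i
      obtain ⟨a, ha, rfl⟩ := mem_trunc.1 (hF hτ)
      refine mem_trunc.2 ⟨a, ha, ?_⟩
      funext j
      have := j.2
      simp only [Function.comp_apply, window]
      rw [spiderInc_spiderPos _ _ _ _ (by omega)]
    -- With centre and leaves fixed, each leg is a window with prescribed ends, so it has at most
    -- `f` choices.
    have hle : #(Fintype.piFinset fun i => agreeing (trunc D (window L i 0 (ℓ i)))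
        {0, Fin.last (ℓ i)} (τ₀ ∘ window ℓ i 0 (ℓ i))) ≤ f ^ s := by
      rw [Fintype.card_piFinset]
      refine (prod_le_pow_card _ _ f fun i _ => ?_).trans_eq (by rw [card_univ, Fintype.card_fin])
      exact hwin i 0 (ℓ i) ((hℓL i).trans (hLk i)) (by have := hℓL i; omega) _ (hsub τ₀ hτ₀.1.1 i)
    refine le_trans (card_le_card_of_injOn (fun τ i => τ ∘ window ℓ i 0 (ℓ i))
      (fun τ hτ => ?_) fun τ hτ τ' hτ' he => ?_) hle
    · rw [mem_coe, hmem] at hτ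
      rw [mem_coe, Fintype.mem_piFinset]
      intro i
      rw [mem_agreeing]
      refine ⟨hsub τ hτ.1.1 i, fun v hv => ?_⟩
      rcases hv with rfl | hv
      · simp only [Function.comp_apply, window, Fin.val_zero, add_zero, spiderPos_zero]
        exact hτ.2.trans hτ₀.2.symm
      · rw [Set.mem_singleton_iff.1 hv]
        simp only [Function.comp_apply, window, Fin.val_last, zero_add]
        exact (hτ.1.2 _ ⟨i, rfl⟩).trans (hτ₀.1.2 _ ⟨i, rfl⟩).symm
    · rw [mem_coe, hmem] at hτ hτ'
      funext v
      rcases spiderPos_cases v with rfl | ⟨i, m, hm, rfl⟩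
      · exact hτ.2.trans hτ'.2.symm
      · have := congrFun (congrFun he i) ⟨m + 1, by omega⟩
        simpa [window] using this

/-- The spiders with prescribed leaves and a prescribed inner vertex of a leg. -/
lemma card_pinned_leg_le {L ℓ : Fin s → ℕ} {k n f : ℕ} {D : Finset (SpiderVertex L → V)}
    (hwin : WindowBdd L k f V D) (hsp : SubSpiderBdd L n f V D)
    (hLk : ∀ i, L i ≤ k) (hℓ : ∀ i, 0 < ℓ i) (hℓL : ∀ i, ℓ i ≤ L i) (hn : ∑ i, ℓ i ≤ n + 1)
    (F : Finset (SpiderVertex ℓ → V)) (hF : F ⊆ trunc D (spiderInc ℓ L))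
    (σ : SpiderVertex ℓ → V) (i : Fin s) (m : ℕ) (hm : 0 < m) (hmi : m < ℓ i) (w : V) :
    #{τ ∈ agreeing F (legEnds ℓ) σ | τ (spiderPos ℓ i m) = w} ≤ f * f := by
  rcases ({τ ∈ agreeing F (legEnds ℓ) σ | τ (spiderPos ℓ i m) = w} :
    Finset _).eq_empty_or_nonempty with h | ⟨τ₀, hτ₀⟩
  · rw [h, card_empty]
    exact Nat.zero_le _
  · have hmem : ∀ τ, τ ∈ ({τ ∈ agreeing F (legEnds ℓ) σ | τ (spiderPos ℓ i m) = w} : Finset _) ↔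
        (τ ∈ F ∧ ∀ v ∈ legEnds ℓ, τ v = σ v) ∧ τ (spiderPos ℓ i m) = w := fun τ => by
      rw [mem_filter, mem_agreeing]
    rw [hmem] at hτ₀
    -- Cutting leg `i` at the pinned vertex leaves a spider with fewer edges and prescribed leaves,
    -- and a window with prescribed ends.
    set ℓ' := Function.update ℓ i m with hℓ'
    have hi : ℓ' i = m := Function.update_self _ _ _
    have hj : ∀ j, j ≠ i → ℓ' j = ℓ j := fun j hj => Function.update_of_ne hj _ _
    have hle : ∀ j, ℓ' j ≤ ℓ j := fun j => by
      rcases eq_or_ne j i with rfl | h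
      · omega
      · rw [hj j h]
    have hpos : ∀ j, 0 < ℓ' j := fun j => by
      rcases eq_or_ne j i with rfl | h
      · omega
      · rw [hj j h]
        exact hℓ j
    have hsum : ∑ j, ℓ' j ≤ n := by
      have : ∑ j, ℓ' j < ∑ j, ℓ j :=
        sum_lt_sum (fun j _ => hle j) ⟨i, mem_univ _, by omega⟩
      omega
    have hsub₁ : ∀ τ ∈ F, τ ∘ spiderInc ℓ' ℓ ∈ trunc D (spiderInc ℓ' L) := by
      intro τ hτ
      obtain ⟨a, ha, rfl⟩ := mem_trunc.1 (hF hτ)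
      refine mem_trunc.2 ⟨a, ha, ?_⟩
      funext v
      rcases spiderPos_cases v with rfl | ⟨j, c, hc, rfl⟩
      · rfl
      · have := hle j
        simp only [Function.comp_apply]
        rw [spiderInc_spiderPos _ _ _ _ hc, spiderInc_spiderPos _ _ _ _ hc,
          spiderInc_spiderPos _ _ _ _ (by omega)]
    have hsub₂ : ∀ τ ∈ F, τ ∘ window ℓ i m (ℓ i - m) ∈ trunc D (window L i m (ℓ i - m)) := by
      intro τ hτ
      obtain ⟨a, ha, rfl⟩ := mem_trunc.1 (hF hτ)
      refine mem_trunc.2 ⟨a, ha, ?_⟩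
      funext j
      have := j.2
      simp only [Function.comp_apply, window]
      rw [spiderInc_spiderPos _ _ _ _ (by omega)]
    have hLi := hLk i
    have hℓi := hℓL i
    refine le_trans ?_ (Nat.mul_le_mul
      (hsp ℓ' hpos (fun j => (hle j).trans (hℓL j)) hsum _ (hsub₁ τ₀ hτ₀.1.1))
      (hwin i m (ℓ i - m) (by omega) (by omega) _ (hsub₂ τ₀ hτ₀.1.1)))
    rw [← card_product]
    refine card_le_card_of_injOn (fun τ => (τ ∘ spiderInc ℓ' ℓ, τ ∘ window ℓ i m (ℓ i - m)))
      (fun τ hτ => ?_) fun τ hτ τ' hτ' he => ?_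
    · rw [mem_coe, hmem] at hτ
      rw [mem_coe, mem_product, mem_agreeing, mem_agreeing]
      refine ⟨⟨hsub₁ τ hτ.1.1, ?_⟩, hsub₂ τ hτ.1.1, fun v hv => ?_⟩
      · rintro v ⟨j, rfl⟩
        simp only [Function.comp_apply]
        rw [spiderInc_spiderPos _ _ _ _ le_rfl]
        rcases eq_or_ne j i with rfl | h
        · rw [hi]
          exact hτ.2.trans hτ₀.2.symm
        · rw [hj j h]
          exact (hτ.1.2 _ ⟨j, rfl⟩).trans (hτ₀.1.2 _ ⟨j, rfl⟩).symm
      · rcases hv with rfl | hv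
        · exact hτ.2.trans hτ₀.2.symm
        · rw [Set.mem_singleton_iff.1 hv]
          simp only [Function.comp_apply, window, Fin.val_last, Nat.add_sub_cancel' hmi.le]
          exact (hτ.1.2 _ ⟨i, rfl⟩).trans (hτ₀.1.2 _ ⟨i, rfl⟩).symm
    · rw [Prod.mk.injEq] at he
      funext v
      have hshort : ∀ j c, c ≤ ℓ' j → τ (spiderPos ℓ j c) = τ' (spiderPos ℓ j c) := by
        intro j c hc
        have := congrFun he.1 (spiderPos ℓ' j c)
        simpa only [Function.comp_apply, spiderInc_spiderPos _ _ _ _ hc] using this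
      rcases spiderPos_cases v with rfl | ⟨j, c, hc, rfl⟩
      · have := hshort i 0 (Nat.zero_le _)
        rwa [spiderPos_zero] at this
      · rcases eq_or_ne j i with rfl | h
        · rcases Nat.lt_or_ge m (c + 1) with h | h
          · have := congrFun he.2 ⟨c + 1 - m, by omega⟩
            simpa [window, show m + (c + 1 - m) = c + 1 by omega] using this
          · exact hshort _ _ (by omega)
        · exact hshort _ _ (by rw [hj j h]; exact hc)

/-- The spiders with prescribed leaves two of which are neighbours of the centre. -/
lemma fiberLe_of_cross {L ℓ : Fin s → ℕ} {k f : ℕ} {D : Finset (SpiderVertex L → V)}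
    (hwin : WindowBdd L k f V D) (hcr : CrossBdd L f V D) (hLk : ∀ i, L i ≤ k)
    (hℓL : ∀ i, ℓ i ≤ L i) (i j : Fin s) (hij : i ≠ j) (hi : ℓ i = 1) (hj : ℓ j = 1) :
    FiberLe (trunc D (spiderInc ℓ L)) (legEnds ℓ) (f * f ^ s) := by
  intro σ hσ
  set F := trunc D (spiderInc ℓ L)
  have hsub : agreeing F (legEnds ℓ) σ ⊆ ((agreeing F (legEnds ℓ) σ).image fun τ => τ none).biUnion
      fun c => {τ ∈ agreeing F (legEnds ℓ) σ | τ none = c} := fun τ hτ =>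
    mem_biUnion.2 ⟨τ none, mem_image_of_mem _ hτ, mem_filter.2 ⟨hτ, rfl⟩⟩
  refine (card_le_card hsub).trans (card_biUnion_le.trans ((sum_le_card_nsmul _ _ _ fun c _ =>
    card_pinned_center_le hwin hLk hℓL F Subset.rfl σ c).trans ?_))
  rw [smul_eq_mul]
  refine Nat.mul_le_mul_right _ ?_
  have htr : ∀ τ ∈ F, τ ∘ cross ℓ i j ∈ trunc D (cross L i j) := by
    intro τ hτ
    obtain ⟨a, ha, rfl⟩ := mem_trunc.1 hτ
    refine mem_trunc.2 ⟨a, ha, ?_⟩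
    funext c
    fin_cases c
    · simp [cross, spiderInc_spiderPos ℓ L i 1 hi.ge]
    · simp [cross, spiderInc_spiderPos ℓ L i 0 (Nat.zero_le _)]
    · simp [cross, spiderInc_spiderPos ℓ L j 1 hj.ge]
  refine le_trans ?_ (hcr i j hij _ (htr σ hσ))
  refine le_trans (card_le_card ?_) (card_image_le (s := agreeing (trunc D (cross L i j))
    {0, Fin.last 2} (σ ∘ cross ℓ i j)) (f := fun ρ => ρ 1))
  intro c hc
  obtain ⟨τ, hτ, rfl⟩ := mem_image.1 hc
  rw [mem_agreeing] at hτ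
  refine mem_image.2 ⟨τ ∘ cross ℓ i j, ?_, ?_⟩
  · rw [mem_agreeing]
    refine ⟨htr τ hτ.1, fun v hv => ?_⟩
    rcases hv with rfl | hv
    · have := hτ.2 _ ⟨i, rfl⟩
      simp only [hi] at this
      simpa [cross] using this
    · rw [Set.mem_singleton_iff.1 hv]
      have := hτ.2 _ ⟨j, rfl⟩
      simp only [hj] at this
      simpa [cross] using this
  · simp [cross, spiderPos_zero]

/-- If the parities permit lengthening from `ℓ` to `L`, dense heavy subspiders would give robust
spiders; the bound `f ^ s` covers a pinned centre and `f * f` a pinned vertex inside a leg.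
Otherwise two legs have length one, the centre is a common neighbour of their leaves, and the cross
bound leaves no heavy subspider at all. -/
lemma exists_subSpider_step {L ℓ : Fin s → ℕ} (k N n : ℕ) (hs : 0 < s) (hLk : ∀ i, L i ≤ k)
    (hℓ : ∀ i, 0 < ℓ i) (hℓL : ∀ i, ℓ i ≤ L i) (hn : ∑ i, ℓ i ≤ n + 1) (A f : ℕ) :
    ∃ f' Δ₀, ∀ (V : Type u) [Fintype V] [Nonempty V] (G : SimpleGraph V)
      (Δ : ℕ), (∀ v, #{w | G.Adj v w} ≤ Δ) → Δ₀ ≤ Δ → 0 < Δ → NoSpider G L N →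
      ∀ D : Finset (SpiderVertex L → V), (∀ σ ∈ D, IsSpiderMap G L σ) →
        (WindowBdd L k f V D ∧ (2 ≤ k → CrossBdd L f V D)) ∧ SubSpiderBdd L n f V D →
        A * #(heavy (trunc D (spiderInc ℓ L)) (legEnds ℓ) f') ≤
          Fintype.card V * Δ ^ (Fintype.card (SpiderVertex ℓ) - 1) := by
  by_cases hcond : ∀ i j, i ≠ j →
      ¬ (ℓ i = 1 ∧ ℓ j = 1 ∧ (L i - ℓ i) % 2 = 1 ∧ (L j - ℓ j) % 2 = 1)
  · obtain ⟨f', Δ₀, h⟩ :=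
      spiderAvoid_of_dense_spiders hs N A (f ^ s + f * f) ℓ L hℓ hℓL hcond
    refine ⟨f', Δ₀, fun V _ _ G Δ h1 h2 h3 h4 D hD hP => ?_⟩
    rw [card_spiderVertex, Nat.add_sub_cancel]
    by_contra! hdense
    refine h4 (h V G Δ h1 h2 _ (fun σ hσ => ?_) hdense.le
      (Nat.mul_pos Fintype.card_pos (Nat.pow_pos h3)) (fun σ hσ => lt_card_agreeing_heavy hσ)
      fun σ hσ v hv w => ?_)
    · obtain ⟨a, ha, rfl⟩ := mem_trunc.1 (heavy_subset _ _ _ hσ)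
      exact (hD a ha).comp_inc hℓL
    · rcases spiderPos_cases v with rfl | ⟨i, m, hm, rfl⟩
      · exact (card_pinned_center_le hP.1.1 hLk hℓL _ (heavy_subset _ _ _) σ w).trans
          (Nat.le_add_right _ _)
      · have hm' : m + 1 < ℓ i := by
          refine lt_of_le_of_ne hm fun h => hv ⟨i, ?_⟩
          simp only [h]
        exact (card_pinned_leg_le hP.1.1 hP.2 hLk hℓ hℓL hn _ (heavy_subset _ _ _) σ i (m + 1)
          (Nat.succ_pos m) hm' w).trans (Nat.le_add_left _ _)
  · push Not at hcond
    obtain ⟨i, j, hij, hi, hj, hLi, -⟩ := hcond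
    refine ⟨f * f ^ s, 0, fun V _ _ G Δ h1 h2 h3 h4 D hD hP => ?_⟩
    have hk : 2 ≤ k := by
      have := hLk i
      omega
    have h5 := fiberLe_of_cross hP.1.1 (hP.1.2 hk) hLk hℓL i j hij hi hj
    have h6 : heavy (trunc D (spiderInc ℓ L)) (legEnds ℓ) (f * f ^ s) = ∅ :=
      eq_empty_of_forall_notMem fun σ hσ => by
        rw [mem_heavy] at hσ
        exact absurd (h5 σ hσ.1) (not_le.2 hσ.2)
    rw [h6, card_empty, mul_zero]
    exact Nat.zero_le _

/-- Each round treats the finitely many length vectors with at most `n + 1` edges simultaneously.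
The start is vacuous because every leg is nonempty. -/
lemma attainable_subSpiderBdd (b k N : ℕ) (hs : 0 < s) (hb : 1 ≤ b) (hbk : b ≤ k) (n : ℕ) :
    Attainable.{u} (legLengths s b k) N fun f V D =>
      (WindowBdd (legLengths s b k) k f V D ∧ (2 ≤ k → CrossBdd (legLengths s b k) f V D)) ∧
        SubSpiderBdd (legLengths s b k) n f V D := by
  have hlen : ∀ i, legLengths s b k i ≤ k := fun i => by
    rw [legLengths]
    split_ifs <;> omega
  induction n with
  | zero =>
    refine (attainable_crossBdd b k N hs hb hbk).imp id fun f V D h => ⟨h, fun ℓ h1 _ h2 => ?_⟩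
    have h3 := single_le_sum (fun i _ => Nat.zero_le (ℓ i)) (mem_univ ⟨0, hs⟩)
    have h4 := h1 ⟨0, hs⟩
    omega
  | succ n ih =>
    refine (ih.and_fiberLe (fun f f' V D D' h1 h2 h3 =>
      ⟨⟨h3.1.1.mono h1 h2, fun h => (h3.1.2 h).mono h1 h2⟩, h3.2.mono h1 h2⟩)
      (X := {p : Fin s → Fin (k + 1) // (∀ i, 0 < (p i : ℕ)) ∧
        (∀ i, (p i : ℕ) ≤ legLengths s b k i) ∧ ∑ i, (p i : ℕ) ≤ n + 1})
      (fun p => SpiderVertex fun i => (p.1 i : ℕ)) (fun p => spiderInc _ _)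
      (fun p => spiderInc_injective p.2.2.1) (fun _ => legEnds _)
      fun A f p => exists_subSpider_step k N n hs hlen p.2.1 p.2.2.1 p.2.2.2 A f).imp id
      fun f V D h => ⟨h.1.1, fun ℓ h1 h2 h3 => ?_⟩
    exact h.2 ⟨fun i => ⟨ℓ i, Nat.lt_succ_of_le ((h2 i).trans (hlen i))⟩, h1, h2, h3⟩

end SubSpiders

/-! ### The degree bound for almost regular graphs -/

section Core

open scoped Classical

universe u

/-- The theorem for almost regular graphs. -/
lemma pow_minDegree_le (s t k b K : ℕ) (hs : 0 < s) (hb : 1 ≤ b) (hbk : b ≤ k) :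
    ∃ C : ℕ, ∀ (V : Type u) [Fintype V] [Nonempty V] (G : SimpleGraph V) (δ Δ : ℕ),
      (∀ v, δ ≤ #{w | G.Adj v w}) → (∀ v, #{w | G.Adj v w} ≤ Δ) → Δ ≤ K * δ →
      ¬ spiderBlowup t s b k ⊑ G →
      δ ^ ((s - 1) * k + b) ≤ C * Fintype.card V ^ (s - 1) := by
  set L := legLengths s b k with hL
  set M := (s - 1) * k + b with hM
  have hsum : ∑ i, L i = M := by
    obtain ⟨s, rfl⟩ : ∃ s', s = s' + 1 := ⟨s - 1, by omega⟩
    rw [Fin.sum_univ_succ, hL, hM]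
    simp [legLengths, add_comm]
  have hpos : ∀ i, 0 < L i := fun i => by
    rw [hL, legLengths]
    split_ifs <;> omega
  have hMpos : 0 < M := by omega
  obtain ⟨r, h⟩ := attainable_subSpiderBdd.{u} b k (s + t * ∑ i, (L i + 1)) hs hb hbk M
  -- The allowed loss `r * (n * Δ ^ M)` is at most `r * (2 * K) ^ M * #D` for the family `D` of all
  -- embeddings, so this value of `A` leaves `#D ≤ A * #D'`.
  obtain ⟨f, Δ₀, h⟩ := h (r * (2 * K) ^ M + 1)
  set A := r * (2 * K) ^ M + 1 with hA
  refine ⟨(2 * M) ^ M + Δ₀ ^ M + 2 ^ M * (A * f), fun V _ _ G δ Δ hδ hΔ hK hG => ?_⟩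
  set n := Fintype.card V with hn
  have hnpos : 0 < n := Fintype.card_pos
  have hn1 : 1 ≤ n ^ (s - 1) := Nat.one_le_pow _ _ hnpos
  have hδΔ : δ ≤ Δ := by
    obtain ⟨v⟩ := ‹Nonempty V›
    exact (hδ v).trans (hΔ v)
  suffices hmain : δ ^ M ≤ (2 * M) ^ M ∨ δ ^ M ≤ Δ₀ ^ M ∨
      δ ^ M ≤ 2 ^ M * (A * f) * n ^ (s - 1) by
    rw [add_mul, add_mul]
    rcases hmain with h1 | h1 | h1
    · have := Nat.le_mul_of_pos_right ((2 * M) ^ M) hn1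
      omega
    · have := Nat.le_mul_of_pos_right (Δ₀ ^ M) hn1
      omega
    · omega
  rcases Nat.lt_or_ge (2 * M) δ with h1 | h1
  swap
  · exact Or.inl (Nat.pow_le_pow_left h1 _)
  rcases Nat.lt_or_ge Δ Δ₀ with h2 | h2
  · exact Or.inr (Or.inl (Nat.pow_le_pow_left (by omega) _))
  refine Or.inr (Or.inr ?_)
  have hno : NoSpider G L (s + t * ∑ i, (L i + 1)) := by
    rintro ⟨z, hz⟩
    exact hG (blowup_isContained L hs hpos t z hz)
  obtain ⟨D', hD', hcard, hP⟩ := h V G Δ hΔ h2 (by omega) hno (spiderMaps G L)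
    fun σ hσ => mem_spiderMaps.1 hσ
  rw [← hn, show ∑ i, legLengths s b k i = M from hsum] at hcard
  have hD₀ : n * δ ^ M ≤ 2 ^ M * #(spiderMaps G L) := by
    have h3 := le_card_spiderMaps δ M hδ M L hsum le_rfl
    calc n * δ ^ M ≤ n * (2 * (δ - M)) ^ M :=
          Nat.mul_le_mul_left _ (Nat.pow_le_pow_left (by omega) _)
      _ = 2 ^ M * (n * (δ - M) ^ M) := by rw [mul_pow]; ring
      _ ≤ _ := Nat.mul_le_mul_left _ h3
  have hD₁ : n * Δ ^ M ≤ (2 * K) ^ M * #(spiderMaps G L) := by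
    calc n * Δ ^ M ≤ n * (K * δ) ^ M := Nat.mul_le_mul_left _ (Nat.pow_le_pow_left hK _)
      _ = K ^ M * (n * δ ^ M) := by rw [mul_pow]; ring
      _ ≤ K ^ M * (2 ^ M * #(spiderMaps G L)) := Nat.mul_le_mul_left _ hD₀
      _ = _ := by rw [mul_pow]; ring
  have hD₂ : #(spiderMaps G L) ≤ A * #D' := by
    have h3 := hcard.trans (Nat.add_le_add_left (Nat.mul_le_mul_left r hD₁) _)
    have h4 : A * #(spiderMaps G L) = r * ((2 * K) ^ M * #(spiderMaps G L)) +
        #(spiderMaps G L) := by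
      rw [hA]
      ring
    omega
  -- The whole spider is one of its own subspiders with at most `M` edges, so at most `f` members of
  -- `D'` share a tuple of leaves.
  have hD₃ : #D' ≤ f * n ^ s := by
    have hmem : ∀ σ ∈ D', σ ∈ trunc D' (spiderInc L L) := fun σ hσ =>
      mem_trunc.2 ⟨σ, hσ, funext fun v => by
        rcases spiderPos_cases v with rfl | ⟨i, m, hm, rfl⟩
        · rfl
        · rw [Function.comp_apply, spiderInc_spiderPos _ _ _ _ hm]⟩
    have h3 := hP.2 L hpos (fun _ => le_rfl) hsum.le
    have h4 := card_le_mul_card_image (f := fun (σ : SpiderVertex L → V) i =>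
      σ (spiderPos L i (L i))) D' f fun z hz => by
        obtain ⟨σ, hσ, rfl⟩ := mem_image.1 hz
        refine (card_le_card fun τ hτ => ?_).trans (h3 σ (hmem σ hσ))
        rw [mem_filter] at hτ
        rw [mem_agreeing]
        refine ⟨hmem τ hτ.1, ?_⟩
        rintro v ⟨i, rfl⟩
        exact congrFun hτ.2 i
    refine h4.trans (Nat.mul_le_mul_left _ ?_)
    refine (card_le_univ _).trans_eq ?_
    rw [Fintype.card_fun, Fintype.card_fin]
  refine Nat.le_of_mul_le_mul_left ?_ hnpos
  calc n * δ ^ M ≤ 2 ^ M * #(spiderMaps G L) := hD₀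
    _ ≤ 2 ^ M * (A * (f * n ^ s)) :=
      Nat.mul_le_mul_left _ (hD₂.trans (Nat.mul_le_mul_left _ hD₃))
    _ = 2 ^ M * (A * f) * n ^ (s - 1 + 1) := by rw [Nat.sub_add_cancel hs]; ring
    _ = n * (2 ^ M * (A * f) * n ^ (s - 1)) := by rw [pow_succ]; ring

end Core

/-! ### Almost regular induced subgraphs of dense graphs -/

section Regularization

open scoped Classical

variable {V : Type*} (G : SimpleGraph V)

/-- The number of ordered adjacent pairs inside `S`. -/
noncomputable def pairCount (S : Finset V) : ℕ := #{p ∈ S ×ˢ S | G.Adj p.1 p.2}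

lemma pairCount_eq_sum (S : Finset V) : pairCount G S = ∑ v ∈ S, #{w ∈ S | G.Adj v w} := by
  rw [pairCount, card_filter, sum_product]
  exact sum_congr rfl fun v _ => (card_filter _ _).symm

lemma pairCount_le_sq (S : Finset V) : pairCount G S ≤ #S * #S :=
  (card_filter_le _ _).trans_eq (card_product _ _)

lemma pairCount_le_erase (S : Finset V) (v : V) :
    pairCount G S ≤ pairCount G (S.erase v) + 2 * #{w ∈ S | G.Adj v w} := by
  have hsub : ({p ∈ S ×ˢ S | G.Adj p.1 p.2} : Finset (V × V)) ⊆
      {p ∈ S.erase v ×ˢ S.erase v | G.Adj p.1 p.2} ∪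
        (({w ∈ S | G.Adj v w} : Finset V).image (fun w => (v, w)) ∪
          ({w ∈ S | G.Adj v w} : Finset V).image fun w => (w, v)) := by
    rintro ⟨a, c⟩ hp
    simp only [mem_filter, mem_product] at hp
    simp only [mem_union, mem_filter, mem_product, mem_erase, mem_image, Prod.mk.injEq]
    by_cases ha : a = v
    · subst ha
      exact Or.inr (Or.inl ⟨c, ⟨hp.1.2, hp.2⟩, rfl, rfl⟩)
    · by_cases hc : c = v
      · subst hc
        exact Or.inr (Or.inr ⟨a, ⟨hp.1.1, hp.2.symm⟩, rfl, rfl⟩)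
      · exact Or.inl ⟨⟨⟨ha, hp.1.1⟩, hc, hp.1.2⟩, hp.2⟩
  have h1 := card_le_card hsub
  have h2 := card_union_le ({p ∈ S.erase v ×ˢ S.erase v | G.Adj p.1 p.2} : Finset (V × V))
    (({w ∈ S | G.Adj v w} : Finset V).image (fun w => (v, w)) ∪
      ({w ∈ S | G.Adj v w} : Finset V).image fun w => (w, v))
  have h3 := card_union_le (({w ∈ S | G.Adj v w} : Finset V).image (fun w => (v, w)))
    (({w ∈ S | G.Adj v w} : Finset V).image fun w => (w, v))
  have h4 := card_image_le (s := ({w ∈ S | G.Adj v w} : Finset V)) (f := fun w => (v, w))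
  have h5 := card_image_le (s := ({w ∈ S | G.Adj v w} : Finset V)) (f := fun w => (w, v))
  rw [pairCount, pairCount]
  omega

/-- A pair with one vertex in `A` lies inside `A ∪ B j`, where `B j` is a block containing the other
vertex. -/
lemma pairCount_le_sdiff_add (H A : Finset V) {T : ℕ} (B : Fin T → Finset V)
    (hB : H ⊆ univ.biUnion B) :
    pairCount G H ≤ pairCount G (H \ A) + ∑ j, pairCount G (A ∪ B j) := by
  have hsub : ({p ∈ H ×ˢ H | G.Adj p.1 p.2} : Finset (V × V)) ⊆
      {p ∈ (H \ A) ×ˢ (H \ A) | G.Adj p.1 p.2} ∪ univ.biUnion fun j =>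
        {p ∈ (A ∪ B j) ×ˢ (A ∪ B j) | G.Adj p.1 p.2} := by
    rintro ⟨a, c⟩ hp
    simp only [mem_filter, mem_product] at hp
    obtain ⟨i, -, hi⟩ := mem_biUnion.1 (hB hp.1.1)
    obtain ⟨j, -, hj⟩ := mem_biUnion.1 (hB hp.1.2)
    simp only [mem_union, mem_filter, mem_product, mem_sdiff, mem_biUnion, mem_univ, true_and]
    by_cases ha : a ∈ A
    · exact Or.inr ⟨j, ⟨Or.inl ha, Or.inr hj⟩, hp.2⟩
    · by_cases hc : c ∈ A
      · exact Or.inr ⟨i, ⟨Or.inr hi, Or.inl hc⟩, hp.2⟩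
      · exact Or.inl ⟨⟨⟨hp.1.1, ha⟩, hp.1.2, hc⟩, hp.2⟩
  exact (card_le_card hsub).trans ((card_union_le _ _).trans
    (Nat.add_le_add_left card_biUnion_le _))

/-- The blocks are the residue classes modulo `T` in an enumeration of `H`; `T ≤ #H` absorbs the
rounding into the factor two. -/
lemma exists_equitable_cover (H : Finset V) {T : ℕ} (hT : 0 < T) (hTH : T ≤ #H) :
    ∃ B : Fin T → Finset V, H ⊆ univ.biUnion B ∧ ∀ j, T * #(B j) ≤ 2 * #H := by
  let e := H.equivFin
  let B : Fin T → Finset V := fun j =>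
    (univ.filter fun v : H => (e v : ℕ) % T = j).map (Function.Embedding.subtype _)
  refine ⟨B, fun v hv => ?_, fun j => ?_⟩
  · refine mem_biUnion.2 ⟨⟨(e ⟨v, hv⟩ : ℕ) % T, Nat.mod_lt _ hT⟩, mem_univ _, ?_⟩
    simp only [B, mem_map, mem_filter, mem_univ, true_and]
    exact ⟨⟨v, hv⟩, rfl, rfl⟩
  · have h1 : #(B j) ≤ #H / T + 1 := by
      rw [card_map, ← card_range (#H / T + 1)]
      refine card_le_card_of_injOn (fun v => (e v : ℕ) / T) (fun v hv => ?_)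
        fun v hv v' hv' h => ?_
      · rw [mem_coe, mem_range, Nat.lt_succ_iff]
        exact Nat.div_le_div_right (e v).2.le
      · rw [mem_coe, mem_filter] at hv hv'
        refine e.injective (Fin.ext ?_)
        rw [← Nat.div_add_mod (e v : ℕ) T, ← Nat.div_add_mod (e v' : ℕ) T, hv.2, hv'.2]
        rw [show (e v : ℕ) / T = (e v' : ℕ) / T from h]
    have h2 := Nat.mul_div_le (#H) T
    calc T * #(B j) ≤ T * (#H / T + 1) := Nat.mul_le_mul_left _ h1
      _ = T * (#H / T) + T := by ring
      _ ≤ 2 * #H := by omega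

/-- A subgraph of almost maximal density without vertices of large degree. -/
lemma exists_dense_small_maxDegree {α : ℝ} (hα0 : 0 < α) (hα1 : α < 1) {T : ℕ}
    (hT : 18 ≤ (T : ℝ) ^ α) {c : ℝ} (hc : (T : ℝ) ≤ c) (H : Finset V) (hH : H.Nonempty)
    (hdH : (pairCount G H : ℝ) = c * (#H : ℝ) ^ (1 + α))
    (hd : ∀ S : Finset V, S ⊆ H → (pairCount G S : ℝ) ≤ c * (#S : ℝ) ^ (1 + α)) :
    ∃ S ⊆ H, (∀ v ∈ S, (#{w ∈ H | G.Adj v w} : ℝ) ≤ T * (c * (#H : ℝ) ^ α)) ∧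
      c * (#H : ℝ) ^ (1 + α) ≤ 2 * pairCount G S := by
  set m : ℝ := ((#H : ℕ) : ℝ) with hm
  have hm1 : 1 ≤ m := by
    rw [hm]
    exact_mod_cast hH.card_pos
  have hm0 : 0 < m := by linarith
  have hTpos : 0 < T := by
    rcases Nat.eq_zero_or_pos T with rfl | h
    · rw [Nat.cast_zero, Real.zero_rpow hα0.ne'] at hT
      norm_num at hT
    · exact h
  have hT0 : (0 : ℝ) < T := by exact_mod_cast hTpos
  have hc0 : 0 < c := hT0.trans_le hc
  have hpow : m ^ (1 + α) = m * m ^ α := by rw [Real.rpow_add hm0, Real.rpow_one]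
  have hma : 0 < m ^ α := Real.rpow_pos_of_pos hm0 _
  -- There are at most `m * m` pairs, so `T ≤ c ≤ c * m ^ α ≤ m`.
  have hTm : (T : ℝ) ≤ m := by
    have h1 : c * (m * m ^ α) ≤ m * m := by
      rw [← hpow, ← hdH, hm, ← Nat.cast_mul]
      exact Nat.cast_le.2 (pairCount_le_sq G H)
    have h2 : c * m ^ α ≤ m := by
      have : m * (c * m ^ α) ≤ m * m := by linarith
      exact le_of_mul_le_mul_left this hm0
    have h3 : 1 ≤ m ^ α := Real.one_le_rpow hm1 hα0.le
    nlinarith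
  set A : Finset V := {v ∈ H | T * (c * m ^ α) < (#{w ∈ H | G.Adj v w} : ℝ)} with hA
  have hAcard : T * (#A : ℝ) ≤ m := by
    have h1 : (#A : ℝ) * (T * (c * m ^ α)) ≤ c * (m * m ^ α) := by
      rw [← hpow, ← hdH, pairCount_eq_sum, Nat.cast_sum]
      calc (#A : ℝ) * (T * (c * m ^ α)) = ∑ v ∈ A, (T * (c * m ^ α)) := by
            rw [sum_const, nsmul_eq_mul]
        _ ≤ ∑ v ∈ A, (#{w ∈ H | G.Adj v w} : ℝ) :=
            sum_le_sum fun v hv => ((mem_filter.1 hv).2).le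
        _ ≤ _ := sum_le_sum_of_subset_of_nonneg (filter_subset _ _) fun _ _ _ => Nat.cast_nonneg _
    have h2 : 0 < c * m ^ α := mul_pos hc0 hma
    have h3 : (c * m ^ α) * (T * #A) ≤ (c * m ^ α) * m := by linarith
    exact le_of_mul_le_mul_left h3 h2
  have hTH : T ≤ #H := by
    rw [hm] at hTm
    exact_mod_cast hTm
  obtain ⟨B, hB, hBcard⟩ := exists_equitable_cover H hTpos hTH
  have hsplit := pairCount_le_sdiff_add G H A (fun j => B j ∩ H) fun v hv => by
    obtain ⟨j, hj, hj'⟩ := mem_biUnion.1 (hB hv)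
    exact mem_biUnion.2 ⟨j, hj, mem_inter.2 ⟨hj', hv⟩⟩
  -- By the double count above, `A` has at most `m / T` vertices, so `A ∪ B j` has at most `3 * m /
  -- T`. Since `H` is extremal in density, such a set spans at most `9 / T ^ α ≤ 1 / 2` of a `T`-th
  -- of the pairs. This is the origin of `18`; over all `j` at most half of the pairs is lost.
  have hblock : ∀ j, T * (pairCount G (A ∪ B j ∩ H) : ℝ) ≤ c * m ^ (1 + α) / 2 := by
    intro j
    have h1 : T * (#(A ∪ B j ∩ H) : ℝ) ≤ 3 * m := by
      have h2 : (#(A ∪ B j ∩ H) : ℝ) ≤ #A + #(B j) := by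
        exact_mod_cast (card_union_le _ _).trans
          (Nat.add_le_add_left (card_le_card inter_subset_left) _)
      have h3 : T * (#(B j) : ℝ) ≤ 2 * m := by
        rw [hm]
        exact_mod_cast hBcard j
      nlinarith
    have h4 : (#(A ∪ B j ∩ H) : ℝ) ≤ 3 * m / T := by
      rw [le_div_iff₀ hT0]
      linarith
    have h5 := hd (A ∪ B j ∩ H) (union_subset (filter_subset _ _) inter_subset_right)
    have h6 : (#(A ∪ B j ∩ H) : ℝ) ^ (1 + α) ≤ (3 * m / T) ^ (1 + α) :=
      Real.rpow_le_rpow (Nat.cast_nonneg _) h4 (by linarith)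
    have h7 : (3 * m / T) ^ (1 + α) = 3 ^ (1 + α) * m ^ (1 + α) / (T * T ^ α) := by
      rw [Real.div_rpow (by positivity) hT0.le, Real.mul_rpow (by norm_num) hm0.le,
        Real.rpow_add hT0, Real.rpow_one]
    have h8 : (3 : ℝ) ^ (1 + α) ≤ 9 := by
      calc (3 : ℝ) ^ (1 + α) ≤ 3 ^ (2 : ℝ) :=
            Real.rpow_le_rpow_of_exponent_le (by norm_num) (by linarith)
        _ = 9 := by norm_num
    have hmp : 0 < m ^ (1 + α) := Real.rpow_pos_of_pos hm0 _
    calc T * (pairCount G (A ∪ B j ∩ H) : ℝ)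
        ≤ T * (c * (3 ^ (1 + α) * m ^ (1 + α) / (T * T ^ α))) := by
          rw [← h7]
          exact mul_le_mul_of_nonneg_left (h5.trans (mul_le_mul_of_nonneg_left h6 hc0.le)) hT0.le
      _ = c * m ^ (1 + α) * (3 ^ (1 + α) / T ^ α) := by
          field_simp
      _ ≤ c * m ^ (1 + α) * (1 / 2) := by
          refine mul_le_mul_of_nonneg_left ?_ (by positivity)
          rw [div_le_div_iff₀ (by linarith) (by norm_num)]
          linarith
      _ = _ := by ring
  refine ⟨H \ A, sdiff_subset, fun v hv => ?_, ?_⟩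
  · rw [mem_sdiff, hA, mem_filter, not_and, not_lt] at hv
    exact hv.2 hv.1
  · have h1 : (pairCount G H : ℝ) ≤ pairCount G (H \ A) +
        ∑ j, (pairCount G (A ∪ B j ∩ H) : ℝ) := by exact_mod_cast hsplit
    have h2 : ∑ j, (pairCount G (A ∪ B j ∩ H) : ℝ) ≤ c * m ^ (1 + α) / 2 := by
      have h3 : T * ∑ j, (pairCount G (A ∪ B j ∩ H) : ℝ) ≤ T * (c * m ^ (1 + α) / 2) := by
        rw [mul_sum]
        refine (sum_le_card_nsmul _ _ _ fun j _ => hblock j).trans_eq ?_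
        rw [card_univ, Fintype.card_fin, nsmul_eq_mul]
      exact le_of_mul_le_mul_left h3 hT0
    rw [hdH] at h1
    linarith

/-- Every dense graph has a dense almost regular induced subgraph. -/
lemma exists_almost_regular {α : ℝ} (hα0 : 0 < α) (hα1 : α < 1) {T : ℕ}
    (hT : 18 ≤ (T : ℝ) ^ α) {C : ℝ} (hC : (T : ℝ) ≤ C) (U : Finset V) (hU : U.Nonempty)
    (hd : C * (#U : ℝ) ^ (1 + α) ≤ pairCount G U) :
    ∃ S : Finset V, S.Nonempty ∧ ∃ x : ℝ, C * (#S : ℝ) ^ α ≤ 5 * x ∧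
      ∀ v ∈ S, x ≤ #{w ∈ S | G.Adj v w} ∧ (#{w ∈ S | G.Adj v w} : ℝ) ≤ 5 * T * x := by
  -- Maximal normalized density makes every subset of `H` at most as dense as `H`, the hypothesis of
  -- `exists_dense_small_maxDegree`.
  obtain ⟨H, hHmem, hHmax⟩ := exists_max_image ({S ∈ U.powerset | S.Nonempty} : Finset (Finset V))
    (fun S => (pairCount G S : ℝ) / (#S : ℝ) ^ (1 + α))
    ⟨U, mem_filter.2 ⟨mem_powerset_self U, hU⟩⟩
  rw [mem_filter, mem_powerset] at hHmem
  have hcardpos : ∀ S : Finset V, S.Nonempty → (0 : ℝ) < (#S : ℝ) ^ (1 + α) := fun S hS =>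
    Real.rpow_pos_of_pos (by exact_mod_cast hS.card_pos) _
  set c : ℝ := (pairCount G H : ℝ) / (#H : ℝ) ^ (1 + α) with hc
  have hCc : C ≤ c := by
    refine le_trans ?_ (hHmax U (mem_filter.2 ⟨mem_powerset_self U, hU⟩))
    rwa [le_div_iff₀ (hcardpos U hU)]
  have hdH : (pairCount G H : ℝ) = c * (#H : ℝ) ^ (1 + α) := by
    rw [hc, div_mul_cancel₀ _ (hcardpos H hHmem.2).ne']
  have hdS : ∀ S : Finset V, S ⊆ H → (pairCount G S : ℝ) ≤ c * (#S : ℝ) ^ (1 + α) := by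
    intro S hS
    rcases S.eq_empty_or_nonempty with rfl | hne
    · rw [card_empty, Nat.cast_zero, Real.zero_rpow (by linarith)]
      simp [pairCount]
    · rw [← div_le_iff₀ (hcardpos S hne)]
      exact hHmax S (mem_filter.2 ⟨mem_powerset.2 (hS.trans hHmem.1), hne⟩)
  obtain ⟨S₁, hS₁H, hS₁deg, hS₁⟩ :=
    exists_dense_small_maxDegree G hα0 hα1 hT (hC.trans hCc) H hHmem.2 hdH hdS
  set m : ℝ := ((#H : ℕ) : ℝ) with hm
  have hm0 : 0 < m := by
    rw [hm]
    exact_mod_cast hHmem.2.card_pos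
  have hpow : m ^ (1 + α) = m * m ^ α := by rw [Real.rpow_add hm0, Real.rpow_one]
  have hT0 : (0 : ℝ) < T := by
    rcases Nat.eq_zero_or_pos T with rfl | h
    · rw [Nat.cast_zero, Real.zero_rpow hα0.ne'] at hT
      norm_num at hT
    · exact_mod_cast h
  have hc0 : 0 < c := hT0.trans_le (hC.trans hCc)
  have hma : 0 < m ^ α := Real.rpow_pos_of_pos hm0 _
  set x : ℝ := c * m ^ α / 5 with hx
  -- Deleting `v` loses at most twice its degree in pairs and gains `2 * x`, so at a maximizer every
  -- degree is at least `x`. The divisor `5` in `x` makes `2 * x * m` smaller than half of `c * m ^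
  -- (1 + α)`, so the maximizer is not empty.
  obtain ⟨S, hSmem, hSmax⟩ := exists_max_image S₁.powerset
    (fun S => (pairCount G S : ℝ) - 2 * x * #S) ⟨S₁, mem_powerset_self _⟩
  rw [mem_powerset] at hSmem
  have hSH := hSmem.trans hS₁H
  have hcard : ∀ S ⊆ H, (#S : ℝ) ≤ m := fun S hS => by
    rw [hm]
    exact_mod_cast card_le_card hS
  have hx0 : 0 < x := div_pos (mul_pos hc0 hma) (by norm_num)
  refine ⟨S, ?_, x, ?_, fun v hv => ⟨?_, ?_⟩⟩
  · rw [nonempty_iff_ne_empty]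
    rintro rfl
    have h1 := hSmax S₁ (mem_powerset_self _)
    have h2 := hcard S₁ hS₁H
    have h3 : (pairCount G (∅ : Finset V) : ℝ) = 0 := by simp [pairCount]
    rw [h3, card_empty, Nat.cast_zero, mul_zero, sub_zero] at h1
    rw [hpow] at hS₁
    have h4 : 2 * x * #S₁ ≤ 2 * x * m :=
      mul_le_mul_of_nonneg_left h2 (by linarith)
    have h5 : 0 < c * (m * m ^ α) := mul_pos hc0 (mul_pos hm0 hma)
    have h6 : x * m = c * (m * m ^ α) / 5 := by
      rw [hx]
      ring
    linarith
  · have h1 : (#S : ℝ) ^ α ≤ m ^ α :=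
      Real.rpow_le_rpow (Nat.cast_nonneg _) (hcard S hSH) hα0.le
    have h2 : C * (#S : ℝ) ^ α ≤ c * m ^ α :=
      mul_le_mul hCc h1 (Real.rpow_nonneg (Nat.cast_nonneg _) _) hc0.le
    rw [hx]
    linarith
  · have h1 := hSmax (S.erase v) (mem_powerset.2 ((erase_subset _ _).trans hSmem))
    have h2 : (pairCount G S : ℝ) ≤ pairCount G (S.erase v) + 2 * #{w ∈ S | G.Adj v w} := by
      exact_mod_cast pairCount_le_erase G S v
    have h3 : (#(S.erase v) : ℝ) = #S - 1 := by
      rw [card_erase_of_mem hv, Nat.cast_sub (card_pos.2 ⟨v, hv⟩), Nat.cast_one]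
    simp only [h3] at h1
    linarith
  · have h1 := hS₁deg v (hSmem hv)
    have h2 : (#{w ∈ S | G.Adj v w} : ℝ) ≤ #{w ∈ H | G.Adj v w} := by
      exact_mod_cast card_le_card (filter_subset_filter _ hSH)
    have h3 : 5 * T * x = T * (c * m ^ α) := by
      rw [hx]
      ring
    linarith

end Regularization

/-! ### The edge bound -/

section Turan

open scoped Classical

/-- The bound for the number of ordered adjacent pairs. -/
lemma exists_pairCount_lt (s t k b : ℕ) (hs : 2 ≤ s) (hb : 1 ≤ b) (hbk : b ≤ k) :
    ∃ C : ℝ, 0 < C ∧ ∀ (V : Type) [Fintype V] [Nonempty V] (G : SimpleGraph V),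
      ¬ spiderBlowup t s b k ⊑ G →
      (pairCount G univ : ℝ) < C * (Fintype.card V : ℝ) ^
        (1 + ((s : ℝ) - 1) / (((s : ℝ) - 1) * (k : ℝ) + (b : ℝ))) := by
  set α : ℝ := ((s : ℝ) - 1) / (((s : ℝ) - 1) * (k : ℝ) + (b : ℝ)) with hα
  have hs1 : (1 : ℝ) ≤ (s : ℝ) - 1 := by
    have : (2 : ℝ) ≤ s := by exact_mod_cast hs
    linarith
  have hb1 : (1 : ℝ) ≤ b := by exact_mod_cast hb
  have hk1 : (1 : ℝ) ≤ k := by exact_mod_cast hb.trans hbk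
  have hden : 0 < ((s : ℝ) - 1) * k + b := by positivity
  have hα0 : 0 < α := div_pos (by linarith) hden
  have hα1 : α < 1 := by
    rw [hα, div_lt_one hden]
    nlinarith
  set M : ℕ := (s - 1) * k + b with hM
  have hMcast : (M : ℝ) = ((s : ℝ) - 1) * k + b := by
    rw [hM]
    push_cast [Nat.cast_sub (show 1 ≤ s by omega)]
    ring
  have hαM : α * M = ((s - 1 : ℕ) : ℝ) := by
    rw [hMcast, hα, div_mul_cancel₀ _ hden.ne', Nat.cast_sub (by omega), Nat.cast_one]
  obtain ⟨T, hT⟩ : ∃ T : ℕ, 18 ≤ (T : ℝ) ^ α := by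
    obtain ⟨T, hT⟩ := exists_nat_ge ((18 : ℝ) ^ (1 / α))
    refine ⟨T, ?_⟩
    have h1 := Real.rpow_le_rpow (by positivity) hT hα0.le
    rwa [← Real.rpow_mul (by norm_num), one_div, inv_mul_cancel₀ hα0.ne', Real.rpow_one] at h1
  obtain ⟨C₁, hC₁⟩ := pow_minDegree_le.{0} s t k b (5 * T) (by omega) hb hbk
  -- The summand `T` meets the density requirement of the regularization, and `5 * (C₁ + 1)` gives
  -- `x ≥ (C₁ + 1) * n ^ α`. As `α * M = s - 1`, this contradicts `x ^ M ≤ C₁ * n ^ (s - 1)`.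
  refine ⟨5 * (C₁ + 1) + T, by positivity, fun V _ _ G hG => ?_⟩
  by_contra! hdense
  rw [← card_univ] at hdense
  have hC₁0 : (0 : ℝ) ≤ C₁ := Nat.cast_nonneg _
  obtain ⟨S, hS, x, hx, hdeg⟩ := exists_almost_regular G hα0 hα1 hT
    (C := 5 * (C₁ + 1) + T) (by linarith) univ univ_nonempty hdense
  set n : ℝ := ((#S : ℕ) : ℝ) with hn
  have hn0 : 0 < n := by
    rw [hn]
    exact_mod_cast hS.card_pos
  have hna : 0 < n ^ α := Real.rpow_pos_of_pos hn0 _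
  have hx1 : (C₁ + 1) * n ^ α ≤ x := by
    have h1 : 0 ≤ (T : ℝ) * n ^ α := by positivity
    linarith
  have hx0 : 0 ≤ x := le_trans (by positivity) hx1
  have : Nonempty S := hS.to_subtype
  have hdegS : ∀ (v : S) [DecidablePred fun w : S => (G.comap Subtype.val).Adj v w],
      #{w : S | (G.comap Subtype.val).Adj v w} = #{w ∈ S | G.Adj v w} := by
    intro v _
    rw [← card_map (Function.Embedding.subtype (· ∈ S))]
    congr 1
    ext w
    simp [and_comm]
  have hfree : ¬ spiderBlowup t s b k ⊑ G.comap (Subtype.val : S → V) := fun h =>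
    hG (h.trans (SimpleGraph.Embedding.comap ⟨_, Subtype.val_injective⟩ G).isContained)
  have hcore := hC₁ S (G.comap Subtype.val) ⌈x⌉₊ (5 * T * ⌈x⌉₊) (fun v => ?_) (fun v => ?_) le_rfl
    hfree
  · rw [Fintype.card_coe] at hcore
    have h1 : x ^ M ≤ C₁ * n ^ (s - 1) := by
      refine (pow_le_pow_left₀ hx0 (Nat.le_ceil x) M).trans ?_
      rw [hn]
      exact_mod_cast hcore
    have h2 : (C₁ + 1 : ℝ) ^ M * n ^ (s - 1) ≤ x ^ M := by
      have h3 := pow_le_pow_left₀ (by positivity) hx1 M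
      rwa [mul_pow, ← Real.rpow_natCast (n ^ α), ← Real.rpow_mul hn0.le, hαM,
        Real.rpow_natCast] at h3
    have h3 : (C₁ + 1 : ℝ) ≤ (C₁ + 1) ^ M := le_self_pow₀ (by linarith) (by omega)
    have h4 : 0 < n ^ (s - 1) := by positivity
    have h5 := mul_le_mul_of_nonneg_right h3 h4.le
    linarith
  · rw [hdegS]
    exact Nat.ceil_le.2 (hdeg v v.2).1
  · rw [hdegS]
    have h1 := (hdeg v v.2).2
    have h2 : 5 * T * x ≤ 5 * T * ⌈x⌉₊ :=
      mul_le_mul_of_nonneg_left (Nat.le_ceil x) (by positivity)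
    exact_mod_cast h1.trans h2

lemma two_mul_card_edgeFinset_eq_pairCount {V : Type*} [Fintype V] (G : SimpleGraph V)
    [DecidableRel G.Adj] : 2 * #G.edgeFinset = pairCount G univ := by
  rw [← sum_degrees_eq_twice_card_edges, pairCount_eq_sum]
  refine sum_congr rfl fun v _ => ?_
  rw [← card_neighborFinset_eq_degree]
  congr 1
  ext w
  simp

end Turan

end SpiderTuran

theorem theorem1p7 (s t k b : ℕ) (hs : 2 ≤ s) (ht : 2 ≤ t) (hb : 1 ≤ b) (hbk : b ≤ k) :
    (fun n : ℕ => (SimpleGraph.extremalNumber n (SimpleGraph.spiderBlowup t s b k) : ℝ))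
      =O[Filter.atTop]
    (fun n : ℕ => (n : ℝ) ^ (1 + ((s : ℝ) - 1) / (((s : ℝ) - 1) * (k : ℝ) + (b : ℝ)))) := by
  obtain ⟨C, hC, h⟩ := SpiderTuran.exists_pairCount_lt s t k b hs hb hbk
  refine Asymptotics.IsBigO.of_bound C ?_
  filter_upwards [Filter.eventually_ge_atTop 1] with n hn
  have : Nonempty (Fin n) := ⟨⟨0, hn⟩⟩
  have hpow : 0 ≤ (n : ℝ) ^ (1 + ((s : ℝ) - 1) / (((s : ℝ) - 1) * (k : ℝ) + (b : ℝ))) :=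
    Real.rpow_nonneg (Nat.cast_nonneg _) _
  rw [Real.norm_of_nonneg (Nat.cast_nonneg _), Real.norm_of_nonneg hpow]
  have hle := SimpleGraph.extremalNumber_le_iff_of_nonneg (V := Fin n)
    (SimpleGraph.spiderBlowup t s b k) (mul_nonneg hC.le hpow)
  rw [Fintype.card_fin] at hle
  refine hle.2 fun G _ hG => ?_
  have h1 := h (Fin n) G hG
  rw [Fintype.card_fin, ← SpiderTuran.two_mul_card_edgeFinset_eq_pairCount, Nat.cast_mul,
    Nat.cast_two] at h1
  have h2 : (0 : ℝ) ≤ (G.edgeFinset.card : ℝ) := Nat.cast_nonneg _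
  linarith
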